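/- **Setting.** Let $G$ be a topological group, $T\subset G$ a subgroup that is a torus, $N(T)$ its normalizer, $\exp:\mathfrak t\to T$ the exponential map and $\Pi=\ker(\exp)$ the integral lattice. Let $1\to U(1)\to\Pi^\tau\to\Pi\to 1$ be a central extension, together with a lift to $\Pi^\tau$ of the action of $N(T)$ on $\Pi$ that is trivial on $U(1)$. Let $L^2_\tau(\Pi)$ be the Hilbert space of functions $\varphi:\Pi^\tau\to\mathbb C$ with $\varphi(z^{-1}x)=z\varphi(x)$ for $z\in U(1)$ and $\|\varphi\|^2=\sum_{\eta\in\Pi}|\varphi(\hat\eta)|^2<\infty$ ($\hat\eta$ any lift of $\eta$), with the right regular representation of $\Pi^\tau$ and the conjugation action of $N(T)$. Let $Y$ be a smooth manifold with an action of $N(T)$ by diffeomorphisms, an $N(T)$-equivariant continuous map $\Phi:Y\to T$ and an $N(T)$-invariant Riemannian metric $g$. Let $q:\mathcal Y=\mathfrak t\times_TY\to Y$ be the induced $\Pi$-covering space, with the smooth structure and metric lifted from $Y$. Let $E\to Y$ be an $N(T)$-equivariant Hermitian vector bundle with a Hermitian connection $\nabla^E$; its pullback to $\mathcal Y$ is again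 denoted $E$. Let $S\to\mathcal Y$ be an $N(T)\ltimes\Pi^\tau$-equivariant $\mathbb Z_2$-graded Hermitian vector bundle of finite rank on which the central circle of $\Pi^\tau$ acts with weight $1$, with an equivariant odd self-adjoint Clifford action $\mathsf c$ of $T\mathcal Y$, $\mathsf c(v)^2=\|v\|^2$ (for instance a spinor module), and with a $\Pi^\tau$-invariant Hermitian connection $\nabla^S$ (for instance a Clifford connection). Put $$\mathcal V=(L^2_\tau(\Pi)\otimes S)/\Pi,$$ a smooth bundle of Hilbert spaces over $Y$, where $\Pi^\tau$ acts diagonally (so that the action descends to $\Pi$). It inherits an $N(T)$-action, a grading, a Clifford action of $TY$ and a connection $\nabla^{\mathcal V}$, induced by the invariant connection $d\otimes 1+1\otimes\nabla^S$ on $L^2_\tau(\Pi)\otimes S$. Let $\hat{\mathsf c}(v)s=(-1)^{\deg s}\mathsf c(v)s$, and let $$D^E=\hat{\mathsf c}\circ g^\sharp\circ\nabla^{\mathcal V\otimes E}\ \text{ on } C_c^\infty(Y,\mathcal V\otimes E),\qquad D^E_{\mathcal Y}=\hat{\mathsf c}\circ g^\sharp\circ\nabla^{S\otimes E}\ \text{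 on } C_c^\infty(\mathcal Y,S\otimes E),$$ the latter being the Dirac operator of $\mathcal Y$. The $L^2$ spaces are formed with the Riemannian measures of $Y$ and $\mathcal Y$. **Proposition.** There is a unitary isomorphism $$U: L^2(Y,\mathcal V\otimes E)\longrightarrow L^2(\mathcal Y,S\otimes E)$$ such that: 1. $U^{-1}$ maps $C_c^\infty(\mathcal Y,S\otimes E)$ into $C_c^\infty(Y,\mathcal V\otimes E)$; 2. $U$ is $N(T)$-equivariant; 3. $U$ respects the gradings and intertwines the Clifford actions, i.e. Clifford multiplication on $\mathcal V\otimes E$ by a smooth vector field $X$ on $Y$ corresponds to Clifford multiplication on $S\otimes E$ by the lift of $X$ to $\mathcal Y$; 4. $D^E$ corresponds to the Dirac operator $D^E_{\mathcal Y}$. Here two operators defined on smooth compactly supported sections correspond to each other if $U\times U$ maps the closure of the graph of the one onto the closure of the graph of the other; in 2 and 3 the operators are considered on smooth compactly supported sections as well. -/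

import Mathlib

open scoped Manifold ContDiff TensorProduct InnerProductSpace

set_option linter.unusedSectionVars false
set_option linter.unusedVariables false

noncomputable section

namespace PiCover

/-! ### Manifolds modelled on Euclidean space -/

/-- The Euclidean space `ℝⁿ`. -/
abbrev Eu (n : ℕ) := EuclideanSpace ℝ (Fin n)

/-- The standard basis vectors of `ℝⁿ`. -/
def stdVec {n : ℕ} (j : Fin n) : Eu n := EuclideanSpace.single j 1

/-- The Gram matrix of a bilinear form on `ℝⁿ` in the standard basis. -/
def gram {n : ℕ} (β : Eu n → Eu n → ℝ) : Matrix (Fin n) (Fin n) ℝ :=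
  Matrix.of fun i j => β (stdVec i) (stdVec j)

/-- Metric contraction: `∑ⱼₖ gʲᵏ cl(∂ⱼ) α(∂ₖ)`, where `gʲᵏ` is the inverse Gram matrix.  For a covariant
derivative `α = ∇σ` this is the composition of `∇`, the musical isomorphism `g^♯` and the (Clifford)
multiplication `cl`; if `e₁, …, eₙ` is an orthonormal basis it equals `∑ᵢ cl(eᵢ) α(eᵢ)`. -/
def contraction {n : ℕ} {M : Type*} [AddCommGroup M] [Module ℂ M] (β : Eu n → Eu n → ℝ)
    (cl : Eu n → M →ₗ[ℂ] M) (α : Eu n → M) : M :=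
  ∑ j, ∑ k, (((gram β)⁻¹ j k : ℝ) : ℂ) • cl (stdVec j) (α (stdVec k))

section Bundles

variable {n : ℕ} {B : Type*} [TopologicalSpace B] [ChartedSpace (Eu n) B]

/-- `X` is a smooth vector field on the set `u`. -/
def SmoothFieldOn [IsManifold (𝓡 n) ∞ B] (X : ∀ b : B, TangentSpace (𝓡 n) b) (u : Set B) : Prop :=
  ContMDiffOn (𝓡 n) (𝓡 n).tangent ∞ (fun b => (⟨b, X b⟩ : TangentBundle (𝓡 n) B)) u

/-- `μ` is the Riemannian volume measure of the Riemannian metric `h`: in every smooth chart it is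
`√(det g) dx`. -/
def IsRiemannianVolume [MeasurableSpace B] (h : ∀ b : B, TangentSpace (𝓡 n) b → TangentSpace (𝓡 n) b → ℝ)
    (μ : MeasureTheory.Measure B) : Prop :=
  ∀ e ∈ IsManifold.maximalAtlas (𝓡 n) ∞ B, ∀ A ⊆ e.source, MeasurableSet A →
    μ A = ∫⁻ x in e '' A, ENNReal.ofReal (Real.sqrt (gram (n := n) fun v w =>
      h (e.symm x) (mfderiv (𝓡 n) (𝓡 n) e.symm x v) (mfderiv (𝓡 n) (𝓡 n) e.symm x w)).det)

/-- A smooth Hermitian vector bundle (of finite, locally constant rank) on the family of inner product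
spaces `W b`, given by an atlas of smooth local orthonormal frames: near every point `b` there is a
frame `frame b i`, `i ∈ idx b`, on the open set `baseSet b`, and the transition functions between
frames are smooth.  Values of a frame outside of its `baseSet` are irrelevant. -/
structure HermitianBundle (n : ℕ) {B : Type*} [TopologicalSpace B] [ChartedSpace (Eu n) B]
    (W : B → Type*) [∀ b, NormedAddCommGroup (W b)] [∀ b, InnerProductSpace ℂ (W b)] where
  idx : B → Type
  fin : ∀ b, Fintype (idx b)
  baseSet : B → Set B
  isOpen_baseSet : ∀ b, IsOpen (baseSet b)
  mem_baseSet : ∀ b, b ∈ baseSet b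
  frame : ∀ b, idx b → ∀ x, W x
  orthonormal : ∀ b, ∀ x ∈ baseSet b, Orthonormal ℂ fun i => frame b i x
  span : ∀ b, ∀ x ∈ baseSet b, Submodule.span ℂ (Set.range fun i => frame b i x) = ⊤
  smooth : ∀ b b' i j, ContMDiffOn (𝓡 n) 𝓘(ℝ, ℂ) ∞ (fun x => ⟪frame b i x, frame b' j x⟫_ℂ)
    (baseSet b ∩ baseSet b')

attribute [instance] HermitianBundle.fin

variable {W : B → Type*} [∀ b, NormedAddCommGroup (W b)] [∀ b, InnerProductSpace ℂ (W b)]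

namespace HermitianBundle

variable (H : HermitianBundle n W)

/-- The frame at a point of its domain, as an orthonormal basis. -/
def onb (b x : B) (hx : x ∈ H.baseSet b) : OrthonormalBasis (H.idx b) ℂ (W x) :=
  OrthonormalBasis.mk (H.orthonormal b x hx) (H.span b x hx).ge

lemma onb_apply (b x : B) (hx : x ∈ H.baseSet b) (i : H.idx b) : H.onb b x hx i = H.frame b i x := by
  simp [onb]

/-- A section is smooth on `u` if its coefficients in all frames are smooth on `u`. -/
def SmoothOn (σ : ∀ b, W b) (u : Set B) : Prop :=
  ∀ b i, ContMDiffOn (𝓡 n) 𝓘(ℝ, ℂ) ∞ (fun x => ⟪H.frame b i x, σ x⟫_ℂ) (H.baseSet b ∩ u)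

/-- The space of smooth compactly supported sections. -/
def ccSubmodule : Submodule ℂ (∀ b, W b) where
  carrier := {σ | H.SmoothOn σ Set.univ ∧ ∃ K : Set B, IsCompact K ∧ ∀ b ∉ K, σ b = 0}
  zero_mem' := ⟨fun b i => by simpa using contMDiffOn_const, ∅, isCompact_empty, fun _ _ => rfl⟩
  add_mem' := by
    rintro σ τ ⟨hσ, K, hK, hK'⟩ ⟨hτ, L, hL, hL'⟩
    refine ⟨fun b i => ?_, K ∪ L, hK.union hL, fun b hb => ?_⟩
    · refine ((hσ b i).add (hτ b i)).congr fun x _ => ?_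
      simp only [Pi.add_apply, inner_add_right]
    · simp only [Set.mem_union, not_or] at hb
      simp [hK' b hb.1, hL' b hb.2]
  smul_mem' := by
    rintro c σ ⟨hσ, K, hK, hK'⟩
    refine ⟨fun b i => ?_, K, hK, fun b hb => by simp [hK' b hb]⟩
    have h : ContMDiff 𝓘(ℝ, ℂ) 𝓘(ℝ, ℂ) ∞ fun w : ℂ => c • w := (contDiff_const_smul c).contMDiff
    refine (h.comp_contMDiffOn (hσ b i)).congr fun x _ => ?_
    simp only [Pi.smul_apply, inner_smul_right, Function.comp_apply, smul_eq_mul]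

lemma continuous_inner {σ τ : ∀ b, W b} (hσ : H.SmoothOn σ Set.univ) (hτ : H.SmoothOn τ Set.univ) :
    Continuous fun b => ⟪σ b, τ b⟫_ℂ := by
  rw [continuous_iff_continuousAt]
  intro b
  have h : ContinuousOn (fun x => ∑ i, ⟪σ x, H.frame b i x⟫_ℂ * ⟪H.frame b i x, τ x⟫_ℂ)
      (H.baseSet b) := by
    refine continuousOn_finsetSum _ fun i _ => ?_
    have h1 := (hσ b i).continuousOn
    have h2 := (hτ b i).continuousOn
    rw [Set.inter_univ] at h1 h2
    refine ContinuousOn.mul ?_ h2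
    have := Complex.continuous_conj.comp_continuousOn h1
    refine this.congr fun x _ => ?_
    simp
  refine (h.congr fun x hx => ?_).continuousAt ((H.isOpen_baseSet b).mem_nhds (H.mem_baseSet b))
  have := (H.onb b x hx).sum_inner_mul_inner (σ x) (τ x)
  simp only [onb_apply] at this
  exact this.symm

/-- Smooth compactly supported sections, with the `L²` inner product of the measure `μ`. -/
def Cc [MeasurableSpace B] (_μ : MeasureTheory.Measure B) : Type _ := H.ccSubmodule

variable [MeasurableSpace B] (μ : MeasureTheory.Measure B)

instance : AddCommGroup (H.Cc μ) := inferInstanceAs (AddCommGroup H.ccSubmodule)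
instance : Module ℂ (H.Cc μ) := inferInstanceAs (Module ℂ H.ccSubmodule)
instance : CoeFun (H.Cc μ) fun _ => ∀ b, W b := ⟨fun σ => σ.1⟩

variable {H μ} in
lemma Cc.integrable [BorelSpace B] [T2Space B] [MeasureTheory.IsFiniteMeasureOnCompacts μ]
    (σ τ : H.Cc μ) : MeasureTheory.Integrable (fun b => ⟪σ b, τ b⟫_ℂ) μ := by
  refine (H.continuous_inner σ.2.1 τ.2.1).integrable_of_hasCompactSupport ?_
  obtain ⟨K, hK, hK'⟩ := σ.2.2
  exact HasCompactSupport.intro hK fun b hb => by rw [hK' b hb, inner_zero_left]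

variable [BorelSpace B] [T2Space B] [MeasureTheory.IsFiniteMeasureOnCompacts μ]

instance : PreInnerProductSpace.Core ℂ (H.Cc μ) where
  inner σ τ := ∫ b, ⟪σ b, τ b⟫_ℂ ∂μ
  conj_inner_symm σ τ := by
    rw [← integral_conj]
    simp
  re_inner_nonneg σ := by
    have h : ∀ b, ⟪σ b, σ b⟫_ℂ = ((‖σ b‖ ^ 2 : ℝ) : ℂ) := fun b => by
      rw [inner_self_eq_norm_sq_to_K]; norm_cast
    simp only [h]
    rw [integral_complex_ofReal]
    simp only [RCLike.re_to_complex, Complex.ofReal_re]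
    positivity
  add_left σ τ ρ := by
    rw [← MeasureTheory.integral_add (Cc.integrable σ ρ) (Cc.integrable τ ρ)]
    congr 1
    ext b
    exact inner_add_left _ _ _
  smul_left σ τ c := by
    rw [← MeasureTheory.integral_const_mul]
    congr 1
    ext b
    exact inner_smul_left _ _ _

instance : SeminormedAddCommGroup (H.Cc μ) := InnerProductSpace.Core.toSeminormedAddCommGroup (𝕜 := ℂ)
instance : InnerProductSpace ℂ (H.Cc μ) := InnerProductSpace.ofCore _

/-- The Hilbert space `L²(B, W)`: the completion of the smooth compactly supported sections. -/
abbrev L2 : Type _ := UniformSpace.Completion (H.Cc μ)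

end HermitianBundle

/-- A Hermitian connection `∇` on a Hermitian bundle; `nabla σ x v` is `∇_v σ` at the point `x`. -/
structure HermitianConnection [IsManifold (𝓡 n) ∞ B] (H : HermitianBundle n W) where
  nabla : (∀ b, W b) → ∀ b, TangentSpace (𝓡 n) b → W b
  map_add : ∀ σ x v w, nabla σ x (v + w) = nabla σ x v + nabla σ x w
  map_smul : ∀ σ x (r : ℝ) v, nabla σ x (r • v) = (r : ℂ) • nabla σ x v
  add : ∀ u, IsOpen u → ∀ σ τ, H.SmoothOn σ u → H.SmoothOn τ u → ∀ x ∈ u, ∀ v,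
    nabla (fun y => σ y + τ y) x v = nabla σ x v + nabla τ x v
  leibniz : ∀ u, IsOpen u → ∀ (f : B → ℂ) σ, ContMDiffOn (𝓡 n) 𝓘(ℝ, ℂ) ∞ f u → H.SmoothOn σ u →
    ∀ x ∈ u, ∀ v, nabla (fun y => f y • σ y) x v =
      (show ℂ from mfderiv (𝓡 n) 𝓘(ℝ, ℂ) f x v) • σ x + f x • nabla σ x v
  metric : ∀ u, IsOpen u → ∀ σ τ, H.SmoothOn σ u → H.SmoothOn τ u → ∀ x ∈ u, ∀ v,
    (show ℂ from mfderiv (𝓡 n) 𝓘(ℝ, ℂ) (fun y => ⟪σ y, τ y⟫_ℂ) x v) =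
      ⟪nabla σ x v, τ x⟫_ℂ + ⟪σ x, nabla τ x v⟫_ℂ
  smooth : ∀ u, IsOpen u → ∀ X σ, SmoothFieldOn X u → H.SmoothOn σ u →
    H.SmoothOn (fun x => nabla σ x (X x)) u

/-- A `ℤ₂`-graded Hermitian Clifford module structure on a Hermitian bundle, for the Riemannian metric
`h`: a smooth grading operator, and an odd, self-adjoint, smooth Clifford action `c` of tangent
vectors with `c(v)² = h(v, v)`. -/
structure CliffordModule [IsManifold (𝓡 n) ∞ B] (H : HermitianBundle n W)
    (h : ∀ b : B, TangentSpace (𝓡 n) b → TangentSpace (𝓡 n) b → ℝ) where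
  grading : ∀ b, W b →ₗᵢ[ℂ] W b
  grading_sq : ∀ b w, grading b (grading b w) = w
  grading_smooth : ∀ u, IsOpen u → ∀ σ, H.SmoothOn σ u → H.SmoothOn (fun b => grading b (σ b)) u
  c : ∀ b, TangentSpace (𝓡 n) b → W b →ₗ[ℂ] W b
  map_add : ∀ b v w, c b (v + w) = c b v + c b w
  map_smul : ∀ b (r : ℝ) v, c b (r • v) = (r : ℂ) • c b v
  sq : ∀ b v w, c b v (c b v w) = (h b v v : ℂ) • w
  symm : ∀ b v w w', ⟪c b v w, w'⟫_ℂ = ⟪w, c b v w'⟫_ℂ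
  odd : ∀ b v w, c b v (grading b w) = -grading b (c b v w)
  smooth : ∀ u, IsOpen u → ∀ X σ, SmoothFieldOn X u → H.SmoothOn σ u →
    H.SmoothOn (fun b => c b (X b) (σ b)) u

/-- The action of tangent vectors twisted by the grading: `ĉ(v) s = (-1)^{deg s} c(v) s`. -/
def CliffordModule.cHat [IsManifold (𝓡 n) ∞ B] {H : HermitianBundle n W}
    {h : ∀ b : B, TangentSpace (𝓡 n) b → TangentSpace (𝓡 n) b → ℝ} (C : CliffordModule H h)
    (b : B) (v : TangentSpace (𝓡 n) b) : W b →ₗ[ℂ] W b :=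
  C.c b v ∘ₗ (C.grading b).toLinearMap

/-- A unitary smooth action of a (discrete) group `K` on a Hermitian bundle, covering the action
`a : K → B → B` on the base. -/
structure BundleAction (H : HermitianBundle n W) {K : Type*} [Group K] (a : K → B → B) where
  map : ∀ k b, W b →ₗᵢ[ℂ] W (a k b)
  map_one : ∀ b w, (⟨a 1 b, map 1 b w⟩ : Σ b, W b) = ⟨b, w⟩
  map_mul : ∀ k l b w,
    (⟨a (k * l) b, map (k * l) b w⟩ : Σ b, W b) = ⟨a k (a l b), map k (a l b) (map l b w)⟩
  smooth : ∀ k σ τ, (∀ b, τ (a k b) = map k b (σ b)) → H.SmoothOn σ Set.univ →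
    H.SmoothOn τ Set.univ

/-- The connection is invariant: `∇_{da_k(v)} (k·σ) = k·∇_v σ`. -/
def HermitianConnection.IsInvariant [IsManifold (𝓡 n) ∞ B] {H : HermitianBundle n W} (D : HermitianConnection H) {K : Type*}
    [Group K] {a : K → B → B} (A : BundleAction H a) : Prop :=
  ∀ k σ τ, (∀ b, τ (a k b) = A.map k b (σ b)) → ∀ u, IsOpen u → H.SmoothOn σ u → ∀ b ∈ u, ∀ v,
    D.nabla τ (a k b) (mfderiv (𝓡 n) (𝓡 n) (a k) b v) = A.map k b (D.nabla σ b v)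

/-- The action is compatible with the grading and the Clifford action: `k·(c(v)w) = c(da_k(v))(k·w)`. -/
def CliffordModule.IsEquivariant [IsManifold (𝓡 n) ∞ B] {H : HermitianBundle n W}
    {h : ∀ b : B, TangentSpace (𝓡 n) b → TangentSpace (𝓡 n) b → ℝ} (C : CliffordModule H h)
    {K : Type*} [Group K] {a : K → B → B} (A : BundleAction H a) : Prop :=
  ∀ k b w, C.grading (a k b) (A.map k b w) = A.map k b (C.grading b w) ∧
    ∀ v, C.c (a k b) (mfderiv (𝓡 n) (𝓡 n) (a k) b v) (A.map k b w) = A.map k b (C.c b v w)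

end Bundles

/-! ### The tensor product `S ⊗ q^*E` -/

section Tensor

variable {n : ℕ} {B : Type*} [TopologicalSpace B] [ChartedSpace (Eu n) B]
  {B' : Type*} [TopologicalSpace B'] [ChartedSpace (Eu n) B']
  {S : B' → Type*} [∀ b, NormedAddCommGroup (S b)] [∀ b, InnerProductSpace ℂ (S b)]
  {E : B → Type*} [∀ b, NormedAddCommGroup (E b)] [∀ b, InnerProductSpace ℂ (E b)]

/-- The Hermitian bundle `S ⊗ q^*E`, with the frames `eᵢ ⊗ q^*fₐ`. -/
def tensorBundle (HS : HermitianBundle n S) (HE : HermitianBundle n E) (q : B' → B)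
    (hq : ContMDiff (𝓡 n) (𝓡 n) ∞ q) : HermitianBundle n fun p => S p ⊗[ℂ] E (q p) where
  idx p := HS.idx p × HE.idx (q p)
  fin p := inferInstance
  baseSet p := HS.baseSet p ∩ q ⁻¹' HE.baseSet (q p)
  isOpen_baseSet p := (HS.isOpen_baseSet p).inter ((HE.isOpen_baseSet _).preimage hq.continuous)
  mem_baseSet p := ⟨HS.mem_baseSet p, HE.mem_baseSet _⟩
  frame p i x := HS.frame p i.1 x ⊗ₜ[ℂ] HE.frame (q p) i.2 (q x)
  orthonormal p x hx := by
    have h := ((HS.onb p x hx.1).tensorProduct (HE.onb (q p) (q x) hx.2)).orthonormal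
    have h' : ∀ i, ((HS.onb p x hx.1).tensorProduct (HE.onb (q p) (q x) hx.2)) i =
        HS.frame p i.1 x ⊗ₜ[ℂ] HE.frame (q p) i.2 (q x) := fun i => by
      rw [OrthonormalBasis.tensorProduct_apply', HermitianBundle.onb_apply,
        HermitianBundle.onb_apply]
    exact (funext h') ▸ h
  span p x hx := by
    have h := ((HS.onb p x hx.1).tensorProduct (HE.onb (q p) (q x) hx.2)).toBasis.span_eq
    rw [← h]
    congr 2
    ext i
    rw [OrthonormalBasis.coe_toBasis, OrthonormalBasis.tensorProduct_apply',
      HermitianBundle.onb_apply, HermitianBundle.onb_apply]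
  smooth p p' i j := by
    simp only [TensorProduct.inner_tmul]
    have h1 := HS.smooth p p' i.1 j.1
    have h2 := (HE.smooth (q p) (q p') i.2 j.2).comp hq.contMDiffOn
      (s := (HS.baseSet p ∩ q ⁻¹' HE.baseSet (q p)) ∩ (HS.baseSet p' ∩ q ⁻¹' HE.baseSet (q p')))
      fun x hx => ⟨hx.1.2, hx.2.2⟩
    have h3 : ContMDiff 𝓘(ℝ, ℂ × ℂ) 𝓘(ℝ, ℂ) ∞ fun w : ℂ × ℂ => w.1 * w.2 := contDiff_mul.contMDiff
    exact h3.comp_contMDiffOn ((h1.mono fun x hx => ⟨hx.1.1, hx.2.1⟩).prodMk_space h2)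

/-- The tensor product connection on `S ⊗ q^*E`: in the frames `eᵢ ⊗ q^*fₐ`,
`∇(∑ σᵢₐ eᵢ ⊗ fₐ) = ∑ dσᵢₐ eᵢ ⊗ fₐ + σᵢₐ (∇eᵢ ⊗ fₐ + eᵢ ⊗ ∇_{dq}fₐ)`. -/
def tensorNabla [IsManifold (𝓡 n) ∞ B] [IsManifold (𝓡 n) ∞ B'] {HS : HermitianBundle n S} {HE : HermitianBundle n E} (DS : HermitianConnection HS)
    (DE : HermitianConnection HE) (q : B' → B) (σ : ∀ p, S p ⊗[ℂ] E (q p)) (p : B')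
    (v : TangentSpace (𝓡 n) p) : S p ⊗[ℂ] E (q p) :=
  ∑ i : HS.idx p, ∑ a : HE.idx (q p),
    ((show ℂ from mfderiv (𝓡 n) 𝓘(ℝ, ℂ)
        (fun x => ⟪HS.frame p i x ⊗ₜ[ℂ] HE.frame (q p) a (q x), σ x⟫_ℂ) p v) •
        (HS.frame p i p ⊗ₜ[ℂ] HE.frame (q p) a (q p)) +
      ⟪HS.frame p i p ⊗ₜ[ℂ] HE.frame (q p) a (q p), σ p⟫_ℂ •
        (DS.nabla (HS.frame p i) p v ⊗ₜ[ℂ] HE.frame (q p) a (q p) +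
          HS.frame p i p ⊗ₜ[ℂ]
            DE.nabla (HE.frame (q p) a) (q p) (mfderiv (𝓡 n) (𝓡 n) q p v)))

end Tensor

/-! ### The torus, its Lie algebra and its integral lattice -/

section Torus

variable {G : Type*} [Group G] [TopologicalSpace G] [IsTopologicalGroup G]

/-- The subgroup `T` is a torus. -/
class IsTorus (T : Subgroup G) : Prop where
  exists_iso : ∃ r : ℕ, Nonempty (T ≃ₜ* (Fin r → Circle))

instance (T : Subgroup G) [IsTorus T] : IsMulCommutative T := by
  obtain ⟨r, ⟨e⟩⟩ := IsTorus.exists_iso (T := T)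
  exact ⟨⟨fun a b => e.injective (by rw [map_mul, map_mul, mul_comm])⟩⟩

variable (T : Subgroup G)

/-- The normalizer `N(T)`. -/
abbrev Nrm := Subgroup.normalizer (T : Set G)

/-- The Lie algebra `𝔱`, realized as the group of one-parameter subgroups `ℝ → T` (under pointwise
multiplication), with the compact-open topology. -/
def LieT := Multiplicative ℝ →ₜ* T

instance : TopologicalSpace (LieT T) := inferInstanceAs (TopologicalSpace (Multiplicative ℝ →ₜ* T))
open scoped IsMulCommutative in
instance [IsTorus T] : CommGroup (LieT T) := inferInstanceAs (CommGroup (Multiplicative ℝ →ₜ* T))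

variable {T}

/-- The value of the one-parameter subgroup `ξ` at time `t`, i.e. `exp(tξ)`. -/
def LieT.val (ξ : LieT T) (t : ℝ) : T := ContinuousMonoidHom.toMonoidHom ξ (Multiplicative.ofAdd t)

/-- The exponential map `exp : 𝔱 → T`. -/
def LieT.exp (ξ : LieT T) : T := ξ.val 1

variable (T) in
/-- The exponential map as a homomorphism. -/
def LieT.expHom [IsTorus T] : LieT T →* T where
  toFun := LieT.exp
  map_one' := rfl
  map_mul' _ _ := rfl

variable (T) in
/-- The integral lattice `Π = ker(exp)`. -/
abbrev Lattice [IsTorus T] : Subgroup (LieT T) := (LieT.expHom T).ker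

/-- The adjoint action of `N(T)` on `𝔱`. -/
def LieT.conj (m : Nrm T) (ξ : LieT T) : LieT T where
  toMonoidHom := (MulDistribMulAction.toMonoidHom T m).comp (ContinuousMonoidHom.toMonoidHom ξ)
  continuous_toFun := by
    have h : Continuous fun t : T => m • t :=
      Continuous.subtype_mk ((continuous_const.mul continuous_subtype_val).mul continuous_const) _
    exact h.comp ξ.continuous_toFun

lemma LieT.exp_conj (m : Nrm T) (ξ : LieT T) : (ξ.conj m).exp = m • ξ.exp := rfl

lemma LieT.exp_surjective [IsTorus T] : Function.Surjective (LieT.exp : LieT T → T) := by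
  intro t
  obtain ⟨r, ⟨e⟩⟩ := IsTorus.exists_iso (T := T)
  choose θ hθ using fun i => Circle.exp_surjective (e t i)
  let f : Multiplicative ℝ →ₜ* (Fin r → Circle) :=
    { toFun := fun s i => Circle.exp (Multiplicative.toAdd s * θ i)
      map_one' := by ext i; simp
      map_mul' := fun a b => by
        funext i
        simp only [toAdd_mul, add_mul, Circle.exp_add, Pi.mul_apply]
      continuous_toFun := by
        refine continuous_pi fun i => Circle.exp.continuous.comp ?_
        exact (continuous_toAdd.mul continuous_const) }
  let ξ : Multiplicative ℝ →ₜ* T :=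
    { toMonoidHom := e.symm.toMulEquiv.toMonoidHom.comp f.toMonoidHom
      continuous_toFun := e.symm.continuous.comp f.continuous_toFun }
  refine ⟨ξ, ?_⟩
  change e.symm (fun i => Circle.exp (1 * θ i)) = t
  rw [ContinuousMulEquiv.symm_apply_eq]
  funext i
  rw [one_mul, hθ]

/-- A `U(1)`-central extension `1 → U(1) → P → Π → 1` of the integral lattice, together with a lift to `P`
of the action of `N(T)` on `Π` (trivial on the central circle). -/
structure CentralExtension (T : Subgroup G) [IsTorus T] (P : Type*) [Group P] where
  incl : Circle →* P
  proj : P →* Lattice T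
  incl_injective : Function.Injective incl
  proj_surjective : Function.Surjective proj
  exact : ∀ x, proj x = 1 ↔ x ∈ incl.range
  central : ∀ z x, incl z * x = x * incl z
  conj : Nrm T →* MulAut P
  proj_conj : ∀ m x, (proj (conj m x) : LieT T) = LieT.conj m (proj x)
  conj_incl : ∀ m z, conj m (incl z) = incl z

end Torus

/-! ### The twisted regular representation `L²_τ(Π)` -/

section Regular

variable {G : Type*} [Group G] [TopologicalSpace G] [IsTopologicalGroup G] {T : Subgroup G} [IsTorus T]
  {P : Type*} [Group P] (τ : CentralExtension T P)

/-- A set-theoretic section of `P → Π`. -/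
def CentralExtension.lift : Lattice T → P := Function.surjInv τ.proj_surjective

lemma CentralExtension.proj_lift (η : Lattice T) : τ.proj (τ.lift η) = η :=
  Function.surjInv_eq τ.proj_surjective η

/-- The space of functions `φ` on `P = Π^τ` with `φ(z⁻¹x) = zφ(x)` for `z ∈ U(1)`, which are square
integrable.  As `|φ|` is a function on the discrete group `Π`, this means that it is square
summable over `Π`; lifts of elements of `Π` may be chosen arbitrarily. -/
def l2Submodule : Submodule ℂ (P → ℂ) where
  carrier := {φ | (∀ (z : Circle) x, φ (τ.incl z⁻¹ * x) = z * φ x) ∧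
    Memℓp (fun η : Lattice T => φ (τ.lift η)) 2}
  zero_mem' := ⟨by simp, zero_memℓp⟩
  add_mem' {φ ψ} hφ hψ := ⟨fun z x => by
    change φ _ + ψ _ = z * (φ x + ψ x)
    rw [hφ.1, hψ.1, mul_add], hφ.2.add hψ.2⟩
  smul_mem' c φ hφ := ⟨fun z x => by
    change c * φ _ = z * (c * φ x)
    rw [hφ.1]
    ring, hφ.2.const_smul c⟩

/-- The Hilbert space `L²_τ(Π)`. -/
def L2tau : Type _ := l2Submodule τ

instance : AddCommGroup (L2tau τ) := inferInstanceAs (AddCommGroup (l2Submodule τ))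
instance : Module ℂ (L2tau τ) := inferInstanceAs (Module ℂ (l2Submodule τ))
instance : CoeFun (L2tau τ) fun _ => P → ℂ := ⟨fun φ => φ.1⟩

variable {τ}

lemma norm_eq_of_proj_eq {φ : P → ℂ} (hφ : ∀ (z : Circle) x, φ (τ.incl z⁻¹ * x) = z * φ x) {x y : P}
    (h : τ.proj x = τ.proj y) : ‖φ x‖ = ‖φ y‖ := by
  obtain ⟨z, hz⟩ := (τ.exact (x * y⁻¹)).1 (by rw [map_mul, h, map_inv, mul_inv_cancel])
  have : x = τ.incl (z⁻¹)⁻¹ * y := by rw [inv_inv, hz, inv_mul_cancel_right]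
  rw [this, hφ, norm_mul, Circle.norm_coe, one_mul]

lemma eq_zero_of_lift {φ : P → ℂ} (hφ : ∀ (z : Circle) x, φ (τ.incl z⁻¹ * x) = z * φ x)
    (h : ∀ η, φ (τ.lift η) = 0) : φ = 0 := by
  funext x
  have := norm_eq_of_proj_eq hφ (τ.proj_lift (τ.proj x))
  rw [h, norm_zero] at this
  exact norm_eq_zero.1 this.symm

variable (τ)

/-- The restriction of `φ ∈ L²_τ(Π)` to the chosen lifts. -/
def toLp : L2tau τ →ₗ[ℂ] lp (fun _ : Lattice T => ℂ) 2 where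
  toFun φ := ⟨fun η => φ (τ.lift η), φ.2.2⟩
  map_add' _ _ := rfl
  map_smul' _ _ := rfl

lemma toLp_injective : Function.Injective (toLp τ) := by
  rw [← LinearMap.ker_eq_bot, LinearMap.ker_eq_bot']
  intro φ hφ
  refine Subtype.ext (eq_zero_of_lift φ.2.1 fun η => ?_)
  exact congrFun (congrArg Subtype.val hφ) η

/-- `‖φ‖² = ∑_{η ∈ Π} |φ(η̂)|²`, where `η̂` is any lift of `η`. -/
instance : NormedAddCommGroup (L2tau τ) :=
  NormedAddCommGroup.induced _ _ (toLp τ) (toLp_injective τ)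

instance : InnerProductSpace ℂ (L2tau τ) where
  norm_smul_le c φ := by
    change ‖toLp τ (c • φ)‖ ≤ ‖c‖ * ‖toLp τ φ‖
    rw [map_smul, norm_smul]
  inner φ ψ := ⟪toLp τ φ, toLp τ ψ⟫_ℂ
  norm_sq_eq_re_inner φ := by
    change ‖toLp τ φ‖ ^ 2 = _
    exact norm_sq_eq_re_inner _
  conj_inner_symm φ ψ := inner_conj_symm _ _
  add_left φ ψ χ := by rw [map_add, inner_add_left]
  smul_left φ ψ c := by rw [map_smul, inner_smul_left]

/-- An isometric operator on `L²_τ(Π)` from a bijection of `P` which covers a bijection of `Π` and commutes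
with the central circle. -/
def precomp (f : P → P) (f₀ : Lattice T ≃ Lattice T) (hf : ∀ x, τ.proj (f x) = f₀ (τ.proj x))
    (hc : ∀ z x, f (τ.incl z * x) = τ.incl z * f x) : L2tau τ →ₗᵢ[ℂ] L2tau τ := by
  have key : ∀ φ : L2tau τ, ∀ η, ‖φ (f (τ.lift η))‖ = ‖φ (τ.lift (f₀ η))‖ := fun φ η =>
    norm_eq_of_proj_eq φ.2.1 (by rw [hf, τ.proj_lift, τ.proj_lift])
  have h2 : (0 : ℝ) < (2 : ENNReal).toReal := by norm_num
  refine ⟨⟨⟨fun φ => ⟨fun x => φ (f x), fun z x => ?_, ?_⟩, fun _ _ => rfl⟩, fun _ _ => rfl⟩, ?_⟩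
  · change φ.1 (f _) = z * φ.1 (f x)
    rw [hc, φ.2.1]
  · rw [memℓp_gen_iff h2]
    simp only [key]
    exact f₀.summable_iff (f := fun η => ‖φ (τ.lift η)‖ ^ (2 : ENNReal).toReal) |>.2
      ((memℓp_gen_iff h2).1 φ.2.2)
  · intro φ
    change ‖toLp τ _‖ = ‖toLp τ φ‖
    rw [lp.norm_eq_tsum_rpow h2, lp.norm_eq_tsum_rpow h2]
    congr 1
    refine Eq.trans (tsum_congr fun η => ?_)
      (f₀.tsum_eq fun η => ‖toLp τ φ η‖ ^ (2 : ENNReal).toReal)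
    exact congrArg (· ^ (2 : ENNReal).toReal) (key φ η)

/-- The right regular representation: `(ρ(g)φ)(x) = φ(xg)`. -/
def rho (g : P) : L2tau τ →ₗᵢ[ℂ] L2tau τ :=
  precomp τ (fun x => x * g) (Equiv.mulRight (τ.proj g)) (by simp) (by simp [mul_assoc])

lemma rho_apply (g : P) (φ : L2tau τ) (x : P) : rho τ g φ x = φ (x * g) := rfl

/-- The bijection of `Π` given by the action of an element of `N(T)`. -/
def latticeConj (m : Nrm T) : Lattice T ≃ Lattice T where
  toFun η := τ.proj (τ.conj m (τ.lift η))
  invFun η := τ.proj (τ.conj m⁻¹ (τ.lift η))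
  left_inv η := by
    apply Subtype.ext
    rw [τ.proj_conj, τ.proj_lift, ← τ.proj_conj, ← MulAut.mul_apply, ← map_mul]
    simp [τ.proj_lift]
  right_inv η := by
    apply Subtype.ext
    rw [τ.proj_conj, τ.proj_lift, ← τ.proj_conj, ← MulAut.mul_apply, ← map_mul]
    simp [τ.proj_lift]

/-- The conjugation action of `N(T)` on `L²_τ(Π)`: `(m·φ)(x) = φ(m⁻¹xm)`. -/
def conjRep (m : Nrm T) : L2tau τ →ₗᵢ[ℂ] L2tau τ :=
  precomp τ (fun x => τ.conj m⁻¹ x) (latticeConj τ m⁻¹)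
    (fun x => Subtype.ext (by
      change _ = ((τ.proj (τ.conj m⁻¹ (τ.lift (τ.proj x))) : Lattice T) : LieT T)
      rw [τ.proj_conj, τ.proj_conj, τ.proj_lift]))
    (fun z x => by rw [map_mul, τ.conj_incl])

lemma conjRep_apply (m : Nrm T) (φ : L2tau τ) (x : P) : conjRep τ m φ x = φ (τ.conj m⁻¹ x) := rfl

end Regular

/-! ### The covering space `𝒴 = 𝔱 ×_T Y` -/

section Cover

variable {G : Type*} [Group G] [TopologicalSpace G] [IsTopologicalGroup G] {T : Subgroup G}
  {Y : Type*} [TopologicalSpace Y]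

/-- The fibre product `𝒴 = 𝔱 ×_T Y` of `exp : 𝔱 → T` and `Φ : Y → T`. -/
def Cover (Φ : Y → T) : Type _ := {p : LieT T × Y // p.1.exp = Φ p.2}

namespace Cover

variable {Φ : Y → T}

instance : TopologicalSpace (Cover Φ) := inferInstanceAs (TopologicalSpace {p : LieT T × Y // _})

instance [IsTorus T] [T2Space Y] : T2Space (Cover Φ) := by
  obtain ⟨r, ⟨e⟩⟩ := IsTorus.exists_iso (T := T)
  have : T2Space T := e.toHomeomorph.isEmbedding.t2Space
  have : T2Space (LieT T) := inferInstanceAs (T2Space (Multiplicative ℝ →ₜ* T))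
  exact inferInstanceAs (T2Space {p : LieT T × Y // p.1.exp = Φ p.2})

/-- The covering map `q : 𝒴 → Y`. -/
def base (p : Cover Φ) : Y := p.1.2

variable [IsTorus T]

/-- The action of `Π` on `𝒴`, by translation of the first factor. -/
def deck (η : Lattice T) (p : Cover Φ) : Cover Φ :=
  ⟨(η * p.1.1, p.1.2), by
    have h : (η : LieT T).exp = 1 := η.2
    have h2 : ((η : LieT T) * p.1.1).exp = (η : LieT T).exp * p.1.1.exp := rfl
    exact h2.trans (by rw [h, one_mul, p.2])⟩

lemma base_deck (η : Lattice T) (p : Cover Φ) : (p.deck η).base = p.base := rfl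

variable (Φ) in
lemma base_surjective : Function.Surjective (base : Cover Φ → Y) := fun y => by
  obtain ⟨ξ, hξ⟩ := LieT.exp_surjective (Φ y)
  exact ⟨⟨(ξ, y), hξ⟩, rfl⟩

lemma exists_deck {p p' : Cover Φ} (h : p.base = p'.base) : ∃ η : Lattice T, p' = p.deck η := by
  refine ⟨⟨p'.1.1 * p.1.1⁻¹, ?_⟩, ?_⟩
  · have h1 : (LieT.expHom T) p'.1.1 = Φ p'.1.2 := p'.2
    have h2 : (LieT.expHom T) p.1.1 = Φ p.1.2 := p.2
    have h3 : p.1.2 = p'.1.2 := h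
    rw [MonoidHom.mem_ker, map_mul, map_inv, h1, h2, h3, mul_inv_cancel]
  · apply Subtype.ext
    apply Prod.ext
    · simp [deck]
    · exact h.symm

/-- The diagonal action of `N(T)` on `𝒴`, for an `N(T)`-equivariant map `Φ`. -/
def conj [MulAction (Nrm T) Y] (hΦ : ∀ (m : Nrm T) y, Φ (m • y) = m • Φ y) (m : Nrm T)
    (p : Cover Φ) : Cover Φ :=
  ⟨(p.1.1.conj m, m • p.1.2), by
    change (p.1.1.conj m).exp = Φ (m • p.1.2)
    rw [LieT.exp_conj, hΦ, p.2]⟩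

lemma base_conj [MulAction (Nrm T) Y] (hΦ : ∀ (m : Nrm T) y, Φ (m • y) = m • Φ y) (m : Nrm T)
    (p : Cover Φ) : (p.conj hΦ m).base = m • p.base := rfl

end Cover

variable {n : ℕ} [ChartedSpace (Eu n) Y] {Φ : Y → T} [ChartedSpace (Eu n) (Cover Φ)]

variable (n Φ) in
/-- The smooth structure on `𝒴` is the one lifted from `Y`, i.e. the unique one for which the covering
map `q : 𝒴 → Y` is a local diffeomorphism. -/
class IsSmoothCover : Prop where
  isLocalDiffeomorph : IsLocalDiffeomorph (𝓡 n) (𝓡 n) ∞ (Cover.base : Cover Φ → Y)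

variable (n Φ) in
lemma contMDiff_base [IsSmoothCover n Φ] : ContMDiff (𝓡 n) (𝓡 n) ∞ (Cover.base : Cover Φ → Y) :=
  IsSmoothCover.isLocalDiffeomorph.contMDiff

/-- The differential `dq : T_p𝒴 → T_{q(p)}Y`. -/
def dq (p : Cover Φ) : TangentSpace (𝓡 n) p →L[ℝ] TangentSpace (𝓡 n) p.base :=
  mfderiv (𝓡 n) (𝓡 n) (Cover.base : Cover Φ → Y) p

/-- The inverse `dq⁻¹ : T_{q(p)}Y → T_p𝒴` of the differential of the covering map. -/
def dqInv (p : Cover Φ) : TangentSpace (𝓡 n) p.base →L[ℝ] TangentSpace (𝓡 n) p :=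
  ContinuousLinearMap.inverse (dq p)

/-- A Riemannian metric on `Y`. -/
abbrev Metric (n : ℕ) (Y : Type*) [TopologicalSpace Y] [ChartedSpace (Eu n) Y]
    [IsManifold (𝓡 n) ∞ Y] :=
  Bundle.ContMDiffRiemannianMetric (𝓡 n) ∞ (Eu n) (TangentSpace (𝓡 n) : Y → Type _)

variable [IsManifold (𝓡 n) ∞ Y]

/-- A Riemannian metric as a family of bilinear forms. -/
def Metric.form (g : Metric n Y) (y : Y) (v w : TangentSpace (𝓡 n) y) : ℝ := g.inner y v w

variable (Φ) in
/-- The metric on `𝒴` lifted from `Y`. -/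
def Metric.lift (g : Metric n Y) (p : Cover Φ) (v w : TangentSpace (𝓡 n) p) : ℝ :=
  g.form p.base (dq p v) (dq p w)

end Cover

/-! ### The Hilbert bundle `(L²_τ(Π) ⊗ W)/Π` over `Y` -/

section Quotient

variable {G : Type*} [Group G] [TopologicalSpace G] [IsTopologicalGroup G] {T : Subgroup G} [IsTorus T]
  {P : Type*} [Group P] {τ : CentralExtension T P}
  {n : ℕ} {Y : Type*} [TopologicalSpace Y] {Φ : Y → T} [ChartedSpace (Eu n) (Cover Φ)]
  {W : Cover Φ → Type*} [∀ p, NormedAddCommGroup (W p)] [∀ p, InnerProductSpace ℂ (W p)]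

/-- The contraction `⟨e, ·⟩ : L ⊗ V → L` with a vector `e ∈ V`, which is
antilinear in `e` and sends `φ ⊗ w` to `⟨e, w⟩ φ`. -/
def coeff {L V : Type*} [NormedAddCommGroup L] [InnerProductSpace ℂ L] [NormedAddCommGroup V]
    [InnerProductSpace ℂ V] (e : V) : L ⊗[ℂ] V →ₗ[ℂ] L :=
  (TensorProduct.rid ℂ L).toLinearMap ∘ₗ LinearMap.lTensor L (innerₛₗ ℂ e)

lemma coeff_tmul {L V : Type*} [NormedAddCommGroup L] [InnerProductSpace ℂ L] [NormedAddCommGroup V]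
    [InnerProductSpace ℂ V] (e : V) (φ : L) (w : V) : coeff e (φ ⊗ₜ[ℂ] w) = ⟪e, w⟫_ℂ • φ := by
  simp [coeff]

lemma sum_inner_coeff {L V ι : Type*} [NormedAddCommGroup L] [InnerProductSpace ℂ L]
    [NormedAddCommGroup V] [InnerProductSpace ℂ V] [Fintype ι] (b : OrthonormalBasis ι ℂ V)
    (x y : L ⊗[ℂ] V) : ∑ i, ⟪coeff (b i) x, coeff (b i) y⟫_ℂ = ⟪x, y⟫_ℂ := by
  induction x with
  | zero => simp
  | add x x' hx hx' => simp [inner_add_left, Finset.sum_add_distrib, hx, hx']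
  | tmul φ v =>
    induction y with
    | zero => simp
    | add y y' hy hy' => simp only [map_add, inner_add_right, Finset.sum_add_distrib, hy, hy']
    | tmul ψ w =>
      simp only [coeff_tmul, inner_smul_left, inner_smul_right, TensorProduct.inner_tmul]
      rw [← b.sum_inner_mul_inner v w, Finset.mul_sum]
      refine Finset.sum_congr rfl fun i _ => ?_
      rw [inner_conj_symm]
      ring

/-- The fibre at `y ∈ Y` of the quotient `(L²_τ(Π) ⊗ W)/Π` of a `Π^τ`-equivariant bundle over `𝒴`.  A point
of the fibre is a `Π`-orbit, i.e. an invariant family of elements `f(p) ∈ L²_τ(Π) ⊗ W_p` for the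
points `p` of the `Π`-orbit `q⁻¹(y)`; here `Π^τ` acts diagonally, by the right regular
representation on the first factor. -/
def QFib (τ : CentralExtension T P) (act : ∀ (g : P) (p : Cover Φ), W p →ₗᵢ[ℂ] W (p.deck (τ.proj g)))
    (y : Y) : Submodule ℂ (∀ p : {p : Cover Φ // p.base = y}, L2tau τ ⊗[ℂ] W p.1) where
  carrier := {f | ∀ g p, f ⟨p.1.deck (τ.proj g), p.2⟩ =
    TensorProduct.mapIsometry (rho τ g) (act g p.1) (f p)}
  zero_mem' g p := by simp
  add_mem' {f f'} h h' g p := by simp only [Pi.add_apply, h g p, h' g p, map_add]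
  smul_mem' c f h g p := by simp only [Pi.smul_apply, h g p, map_smul]

variable {act : ∀ (g : P) (p : Cover Φ), W p →ₗᵢ[ℂ] W (p.deck (τ.proj g))}

/-- The invariant section of `L²_τ(Π) ⊗ W` over `𝒴` corresponding to a section of the quotient over `Y`. -/
def upstairs (v : ∀ y, QFib τ act y) (p : Cover Φ) : L2tau τ ⊗[ℂ] W p := (v p.base).1 ⟨p, rfl⟩

lemma upstairs_deck (v : ∀ y, QFib τ act y) (g : P) (p : Cover Φ) :
    upstairs v (p.deck (τ.proj g)) =
      TensorProduct.mapIsometry (rho τ g) (act g p) (upstairs v p) :=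
  (v p.base).2 g ⟨p, rfl⟩

/-- A section of `L²_τ(Π) ⊗ W` is smooth if its coefficients in the frames of `W` are smooth
`L²_τ(Π)`-valued functions; a section of the quotient over `Y` is smooth if the
corresponding section over the covering space `𝒴` is. -/
def QSmooth (H : HermitianBundle n W) (v : ∀ y, QFib τ act y) : Prop :=
  ∀ p i, ContMDiffOn (𝓡 n) 𝓘(ℝ, L2tau τ) ∞ (fun x => coeff (H.frame p i x) (upstairs v x))
    (H.baseSet p)

/-- The pointwise inner product of two sections of the quotient: the inner product in
`L²_τ(Π) ⊗ W_p`, for any `p ∈ q⁻¹(y)`. -/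
def qInner (v w : ∀ y, QFib τ act y) (y : Y) : ℂ :=
  ⟪(v y).1 ⟨_, Function.surjInv_eq (Cover.base_surjective Φ) y⟩,
    (w y).1 ⟨_, Function.surjInv_eq (Cover.base_surjective Φ) y⟩⟫_ℂ

lemma qInner_base (v w : ∀ y, QFib τ act y) (p : Cover Φ) :
    qInner v w p.base = ⟪upstairs v p, upstairs w p⟫_ℂ := by
  set p' : Cover Φ := Function.surjInv (Cover.base_surjective Φ) p.base with hp'
  have hb : p'.base = p.base := Function.surjInv_eq (Cover.base_surjective Φ) p.base
  obtain ⟨η, hη⟩ := Cover.exists_deck hb.symm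
  obtain ⟨g, rfl⟩ := τ.proj_surjective η
  have h : ∀ (y : Y) (h : p'.base = y), ⟪(v y).1 ⟨p', h⟩, (w y).1 ⟨p', h⟩⟫_ℂ =
      ⟪upstairs v p', upstairs w p'⟫_ℂ := by
    rintro _ rfl; rfl
  have h1 : qInner v w p.base = ⟪upstairs v p', upstairs w p'⟫_ℂ := h _ hb
  rw [h1, hη, upstairs_deck, upstairs_deck, LinearIsometry.inner_map_map]

lemma qInner_conj (v w : ∀ y, QFib τ act y) (y : Y) :
    (starRingEnd ℂ) (qInner w v y) = qInner v w y := by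
  obtain ⟨p, rfl⟩ := Cover.base_surjective Φ y
  rw [qInner_base, qInner_base]
  exact inner_conj_symm (𝕜 := ℂ) (upstairs v p) (upstairs w p)

lemma qInner_self (v : ∀ y, QFib τ act y) (y : Y) : ∃ r : ℝ, 0 ≤ r ∧ qInner v v y = (r : ℂ) := by
  obtain ⟨p, rfl⟩ := Cover.base_surjective Φ y
  refine ⟨‖upstairs v p‖ ^ 2, sq_nonneg _, ?_⟩
  rw [qInner_base]
  refine (inner_self_eq_norm_sq_to_K (𝕜 := ℂ) (upstairs v p)).trans ?_
  norm_cast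

lemma qInner_add (v w u : ∀ y, QFib τ act y) (y : Y) :
    qInner (v + w) u y = qInner v u y + qInner w u y := by
  obtain ⟨p, rfl⟩ := Cover.base_surjective Φ y
  rw [qInner_base, qInner_base, qInner_base]
  exact inner_add_left (𝕜 := ℂ) (upstairs v p) (upstairs w p) (upstairs u p)

lemma qInner_smul (v w : ∀ y, QFib τ act y) (c : ℂ) (y : Y) :
    qInner (c • v) w y = (starRingEnd ℂ) c * qInner v w y := by
  obtain ⟨p, rfl⟩ := Cover.base_surjective Φ y
  rw [qInner_base, qInner_base]
  exact inner_smul_left (𝕜 := ℂ) (upstairs v p) (upstairs w p) c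

variable [ChartedSpace (Eu n) Y] [IsSmoothCover n Φ]

lemma continuous_qInner (H : HermitianBundle n W) {v w : ∀ y, QFib τ act y} (hv : QSmooth H v)
    (hw : QSmooth H w) : Continuous (qInner v w) := by
  have hloc : IsLocalHomeomorph (Cover.base : Cover Φ → Y) :=
    (IsSmoothCover.isLocalDiffeomorph (n := n)).isLocalHomeomorph
  have hquot : Topology.IsQuotientMap (Cover.base : Cover Φ → Y) :=
    hloc.isOpenMap.isQuotientMap hloc.continuous (Cover.base_surjective Φ)
  rw [hquot.continuous_iff]
  change Continuous fun p : Cover Φ => qInner v w p.base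
  simp only [qInner_base]
  rw [continuous_iff_continuousAt]
  intro p
  have h : ContinuousOn (fun x => ∑ i, ⟪coeff (H.frame p i x) (upstairs v x),
      coeff (H.frame p i x) (upstairs w x)⟫_ℂ) (H.baseSet p) :=
    continuousOn_finsetSum _ fun i _ => ContinuousOn.inner (hv p i).continuousOn (hw p i).continuousOn
  refine (h.congr fun x hx => ?_).continuousAt ((H.isOpen_baseSet p).mem_nhds (H.mem_baseSet p))
  have := sum_inner_coeff (H.onb p x hx) (upstairs v x) (upstairs w x)
  simp only [HermitianBundle.onb_apply] at this
  exact this.symm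

/-- The space of smooth compactly supported sections over `Y` of the quotient bundle. -/
def qccSubmodule (H : HermitianBundle n W) (τ : CentralExtension T P)
    (act : ∀ (g : P) (p : Cover Φ), W p →ₗᵢ[ℂ] W (p.deck (τ.proj g))) :
    Submodule ℂ (∀ y, QFib τ act y) where
  carrier := {v | QSmooth H v ∧ ∃ K : Set Y, IsCompact K ∧ ∀ y ∉ K, v y = 0}
  zero_mem' := by
    refine ⟨fun p i => ?_, ∅, isCompact_empty, fun _ _ => rfl⟩
    have : (fun x => coeff (H.frame p i x) (upstairs (0 : ∀ y, QFib τ act y) x)) = fun _ => 0 := by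
      funext x
      exact map_zero _
    rw [this]
    exact contMDiffOn_const
  add_mem' := by
    rintro v w ⟨hv, K, hK, hK'⟩ ⟨hw, L, hL, hL'⟩
    refine ⟨fun p i => ?_, K ∪ L, hK.union hL, fun y hy => ?_⟩
    · refine ((hv p i).add (hw p i)).congr fun x _ => ?_
      exact map_add (coeff _) _ _
    · simp only [Set.mem_union, not_or] at hy
      simp [hK' y hy.1, hL' y hy.2]
  smul_mem' := by
    rintro c v ⟨hv, K, hK, hK'⟩
    refine ⟨fun p i => ?_, K, hK, fun y hy => by simp [hK' y hy]⟩
    have h : ContMDiff 𝓘(ℝ, L2tau τ) 𝓘(ℝ, L2tau τ) ∞ fun φ : L2tau τ => c • φ :=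
      (contDiff_const_smul c).contMDiff
    refine (h.comp_contMDiffOn (hv p i)).congr fun x _ => ?_
    exact map_smul (coeff _) _ _

variable [MeasurableSpace Y]

/-- Smooth compactly supported sections of the quotient bundle, with the `L²` inner product of the
measure `μ` on `Y`. -/
def QCc (H : HermitianBundle n W) (τ : CentralExtension T P)
    (act : ∀ (g : P) (p : Cover Φ), W p →ₗᵢ[ℂ] W (p.deck (τ.proj g)))
    (_μ : MeasureTheory.Measure Y) : Type _ := qccSubmodule H τ act

variable (H : HermitianBundle n W) (μ : MeasureTheory.Measure Y)

instance : AddCommGroup (QCc H τ act μ) := inferInstanceAs (AddCommGroup (qccSubmodule H τ act))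
instance : Module ℂ (QCc H τ act μ) := inferInstanceAs (Module ℂ (qccSubmodule H τ act))
instance : CoeFun (QCc H τ act μ) fun _ => ∀ y, QFib τ act y := ⟨fun v => v.1⟩

variable {H μ} in
lemma QCc.integrable [BorelSpace Y] [T2Space Y] [MeasureTheory.IsFiniteMeasureOnCompacts μ]
    (v w : QCc H τ act μ) : MeasureTheory.Integrable (qInner v w) μ := by
  refine (continuous_qInner H v.2.1 w.2.1).integrable_of_hasCompactSupport ?_
  obtain ⟨K, hK, hK'⟩ := v.2.2
  exact HasCompactSupport.intro hK fun y hy => by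
    rw [qInner, hK' y hy]
    exact inner_zero_left _

variable [BorelSpace Y] [T2Space Y] [MeasureTheory.IsFiniteMeasureOnCompacts μ]

instance : PreInnerProductSpace.Core ℂ (QCc H τ act μ) where
  inner v w := ∫ y, qInner v w y ∂μ
  conj_inner_symm v w := by
    rw [← integral_conj]
    simp only [qInner_conj]
  re_inner_nonneg v := by
    have h := fun y => qInner_self (v : ∀ y, QFib τ act y) y
    choose r hr h using h
    simp only [h]
    rw [integral_complex_ofReal]
    simp only [RCLike.re_to_complex, Complex.ofReal_re]
    exact MeasureTheory.integral_nonneg hr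
  add_left v w u := by
    rw [← MeasureTheory.integral_add (QCc.integrable v u) (QCc.integrable w u)]
    exact congrArg _ (funext fun y => qInner_add _ _ _ y)
  smul_left v w c := by
    rw [← MeasureTheory.integral_const_mul]
    exact congrArg _ (funext fun y => qInner_smul _ _ _ y)

instance : SeminormedAddCommGroup (QCc H τ act μ) :=
  InnerProductSpace.Core.toSeminormedAddCommGroup (𝕜 := ℂ)
instance : InnerProductSpace ℂ (QCc H τ act μ) := InnerProductSpace.ofCore _

variable (τ act) in
/-- The Hilbert space of square integrable sections over `Y` of the quotient of `L²_τ(Π) ⊗ W` by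
`Π`: the completion of the smooth compactly supported sections. -/
abbrev QL2 : Type _ := UniformSpace.Completion (QCc H τ act μ)

end Quotient

/-- The connection `d ⊗ 1 + 1 ⊗ ∇` on `L ⊗ W`, for a Hilbert space `L` and a bundle `W` with connection `∇`:
in a frame, `∇(∑ φᵢ ⊗ eᵢ) = ∑ dφᵢ ⊗ eᵢ + φᵢ ⊗ ∇eᵢ`. -/
def hilbertNabla (L : Type*) [NormedAddCommGroup L] [InnerProductSpace ℂ L]
    {n : ℕ} {B : Type*} [TopologicalSpace B] [ChartedSpace (Eu n) B]
    {W : B → Type*} [∀ b, NormedAddCommGroup (W b)] [∀ b, InnerProductSpace ℂ (W b)]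
    (H : HermitianBundle n W) (nabla : (∀ b, W b) → ∀ b, TangentSpace (𝓡 n) b → W b)
    (f : ∀ b, L ⊗[ℂ] W b) (b : B) (v : TangentSpace (𝓡 n) b) : L ⊗[ℂ] W b :=
  ∑ i : H.idx b,
    ((show L from mfderiv (𝓡 n) 𝓘(ℝ, L) (fun x => coeff (H.frame b i x) (f x)) b v) ⊗ₜ[ℂ]
        H.frame b i b +
      coeff (H.frame b i b) (f b) ⊗ₜ[ℂ] nabla (H.frame b i) b v)

/-! ### Operators on sections over `𝒴` and over `Y` -/

section Operators

variable {G : Type*} [Group G] [TopologicalSpace G] [IsTopologicalGroup G] {T : Subgroup G} [IsTorus T]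
  {P : Type*} [Group P] {τ : CentralExtension T P}
  {n : ℕ} {Y : Type*} [TopologicalSpace Y] [ChartedSpace (Eu n) Y] [IsManifold (𝓡 n) ∞ Y] {Φ : Y → T}
  [ChartedSpace (Eu n) (Cover Φ)] [IsManifold (𝓡 n) ∞ (Cover Φ)] [IsSmoothCover n Φ]
  {S : Cover Φ → Type*} [∀ p, NormedAddCommGroup (S p)] [∀ p, InnerProductSpace ℂ (S p)]
  {E : Y → Type*} [∀ y, NormedAddCommGroup (E y)] [∀ y, InnerProductSpace ℂ (E y)]
  {HS : HermitianBundle n S} {HE : HermitianBundle n E}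

variable (HS HE) in
/-- The Hermitian bundle `S ⊗ E = S ⊗ q^*E` over `𝒴`. -/
abbrev bundleSE : HermitianBundle n fun p : Cover Φ => S p ⊗[ℂ] E p.base :=
  tensorBundle HS HE Cover.base (contMDiff_base n Φ)

variable (E) in
/-- The action of `Π^τ` on `S ⊗ q^*E`, trivial on the second factor. -/
def actSE (AS : BundleAction HS fun (x : P) (p : Cover Φ) => p.deck (τ.proj x)) (x : P) (p : Cover Φ) :
    S p ⊗[ℂ] E p.base →ₗᵢ[ℂ] S (p.deck (τ.proj x)) ⊗[ℂ] E (p.deck (τ.proj x)).base :=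
  TensorProduct.mapIsometry (AS.map x p) (LinearIsometry.id : E p.base →ₗᵢ[ℂ] E p.base)

section Translation

variable [MulAction (Nrm T) Y] {hΦ : ∀ (m : Nrm T) y, Φ (m • y) = m • Φ y}
  (NS : BundleAction HS (Cover.conj hΦ)) (NE : BundleAction HE fun (m : Nrm T) y => m • y)

/-- The action of `N(T)` on `S ⊗ q^*E`. -/
def normSE (m : Nrm T) (p : Cover Φ) :
    S p ⊗[ℂ] E p.base →ₗᵢ[ℂ] S (p.conj hΦ m) ⊗[ℂ] E (p.conj hΦ m).base :=
  TensorProduct.mapIsometry (NS.map m p) (NE.map m p.base)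

/-- `σ' = m · σ` for sections of `S ⊗ E` over `𝒴`. -/
def IsTranslateUp (m : Nrm T) (σ σ' : ∀ p : Cover Φ, S p ⊗[ℂ] E p.base) : Prop :=
  ∀ p, σ' (p.conj hΦ m) = normSE NS NE m p (σ p)

/-- `v' = m · v` for sections of `𝒱 ⊗ E` over `Y`; `N(T)` acts on `𝒱 = (L²_τ(Π) ⊗ S)/Π` through the
conjugation action on `L²_τ(Π)` and the action on `S`. -/
def IsTranslateDown {act : ∀ (x : P) (p : Cover Φ),
      S p ⊗[ℂ] E p.base →ₗᵢ[ℂ] S (p.deck (τ.proj x)) ⊗[ℂ] E (p.deck (τ.proj x)).base}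
    (m : Nrm T) (v v' : ∀ y, QFib τ act y) : Prop :=
  ∀ p, upstairs (W := fun p : Cover Φ => S p ⊗[ℂ] E p.base) (act := act) v' (p.conj hΦ m) =
    TensorProduct.mapIsometry (conjRep τ m) (normSE NS NE m p) (upstairs (W := fun p : Cover Φ => S p ⊗[ℂ] E p.base) (act := act) v p)

end Translation

variable {act : ∀ (x : P) (p : Cover Φ),
  S p ⊗[ℂ] E p.base →ₗᵢ[ℂ] S (p.deck (τ.proj x)) ⊗[ℂ] E (p.deck (τ.proj x)).base}

/-- `σ' = (A ⊗ 1) σ` for sections of `S ⊗ E` over `𝒴` and a bundle endomorphism `A` of `S`. -/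
def IsEndoUp (A : ∀ p, S p →ₗ[ℂ] S p) (σ σ' : ∀ p : Cover Φ, S p ⊗[ℂ] E p.base) : Prop :=
  ∀ p, σ' p = (A p).rTensor (E p.base) (σ p)

/-- `v' = A v` for sections of `𝒱 ⊗ E` over `Y`, where the bundle endomorphism `A` of `S` acts
on `𝒱 = (L²_τ(Π) ⊗ S)/Π` through the second factor. -/
def IsEndoDown (A : ∀ p, S p →ₗ[ℂ] S p) (v v' : ∀ y, QFib τ act y) : Prop :=
  ∀ p, upstairs (W := fun p : Cover Φ => S p ⊗[ℂ] E p.base) (act := act) v' p =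
    ((A p).rTensor (E p.base)).lTensor (L2tau τ) (upstairs (W := fun p : Cover Φ => S p ⊗[ℂ] E p.base) (act := act) v p)

variable {g : Metric n Y} (CS : CliffordModule HS (g.lift Φ))

/-- Clifford multiplication on `S` by (the lift to `𝒴` of) a vector field `X` on `Y`. -/
def cliff (X : ∀ y : Y, TangentSpace (𝓡 n) y) (p : Cover Φ) : S p →ₗ[ℂ] S p :=
  CS.c p (dqInv p (X p.base))

variable (DS : HermitianConnection HS) (DE : HermitianConnection HE)

/-- `σ' = Dσ`, where `D = ĉ ∘ g^♯ ∘ ∇^{S ⊗ E}` is the Dirac operator on sections of `S ⊗ E` over `𝒴`. -/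
def IsDiracUp (σ σ' : ∀ p : Cover Φ, S p ⊗[ℂ] E p.base) : Prop :=
  ∀ p, σ' p = contraction (g.lift Φ p) (fun v => (CS.cHat p v).rTensor (E p.base))
    (tensorNabla DS DE Cover.base σ p)

/-- `v' = D^E v`, where `D^E = ĉ ∘ g^♯ ∘ ∇^{𝒱 ⊗ E}` acts on sections of `𝒱 ⊗ E` over `Y`, and
`∇^{𝒱 ⊗ E}` is the connection induced by the invariant connection `d ⊗ 1 + 1 ⊗ ∇^{S ⊗ E}` on
`L²_τ(Π) ⊗ (S ⊗ E)`.  Tangent vectors of `Y` are lifted to `𝒴`. -/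
def IsDiracDown (v v' : ∀ y, QFib τ act y) : Prop :=
  ∀ p : Cover Φ, upstairs (W := fun p : Cover Φ => S p ⊗[ℂ] E p.base) (act := act) v' p = contraction (g.form p.base)
    (fun w => ((CS.cHat p (dqInv p w)).rTensor (E p.base)).lTensor (L2tau τ))
    (fun w => hilbertNabla (L2tau τ) (bundleSE HS HE) (tensorNabla DS DE Cover.base) (upstairs (W := fun p : Cover Φ => S p ⊗[ℂ] E p.base) (act := act) v) p
      (dqInv p w))

end Operators

/-- The map `U` from `L²(Y, 𝒱 ⊗ E)` to `L²(𝒴, S ⊗ E)` identifies two (possibly unbounded) operators which are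
defined on smooth compactly supported sections by the relations `R₁`, `R₂` (`R σ σ'` means that
the operator sends `σ` to `σ'`): `U × U` maps the closure of the graph of the first operator onto
the closure of the graph of the second. -/
def Corresponds {G : Type*} [Group G] [TopologicalSpace G] [IsTopologicalGroup G] {T : Subgroup G}
    [IsTorus T] {P : Type*} [Group P] {τ : CentralExtension T P} {n : ℕ}
    {Y : Type*} [TopologicalSpace Y] [T2Space Y] [MeasurableSpace Y] [BorelSpace Y]
    [ChartedSpace (Eu n) Y] {Φ : Y → T}
    [MeasurableSpace (Cover Φ)] [BorelSpace (Cover Φ)] [ChartedSpace (Eu n) (Cover Φ)]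
    [IsSmoothCover n Φ]
    {μY : MeasureTheory.Measure Y} [MeasureTheory.IsFiniteMeasureOnCompacts μY]
    {μ : MeasureTheory.Measure (Cover Φ)} [MeasureTheory.IsFiniteMeasureOnCompacts μ]
    {W : Cover Φ → Type*} [∀ p, NormedAddCommGroup (W p)] [∀ p, InnerProductSpace ℂ (W p)]
    {H : HermitianBundle n W} {act : ∀ (x : P) (p : Cover Φ), W p →ₗᵢ[ℂ] W (p.deck (τ.proj x))}
    (U : QL2 τ act H μY ≃ₗᵢ[ℂ] H.L2 μ)
    (R₁ : (∀ y, QFib τ act y) → (∀ y, QFib τ act y) → Prop)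
    (R₂ : (∀ p, W p) → (∀ p, W p) → Prop) : Prop :=
  (fun x => (U x.1, U x.2)) ''
      closure {x : QL2 τ act H μY × QL2 τ act H μY | ∃ v v' : QCc H τ act μY, R₁ v v' ∧ x = (↑v, ↑v')} =
    closure {x : H.L2 μ × H.L2 μ | ∃ σ σ' : H.Cc μ, R₂ σ σ' ∧ x = (↑σ, ↑σ')}

end PiCover

end

/-! An invariant section of L²_τ(Π) ⊗ W over 𝒴 has a value for each point p and each x ∈ Π^τ, and
invariance ties the two variables together: the value at (p, x) is x⁻¹ applied to the value at (xp,
1) (`ev_upstairs`). So a section v of the quotient bundle over Y is determined by the section `sec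
v` of W over 𝒴 obtained by evaluating at 1. By Parseval the squared norm of v at y is the sum of
|sec v|² over the fibre q⁻¹(y) (`hasSum_qInner`), and since q is a Riemannian covering, integrating
fibre sums over Y is integrating over 𝒴 (`integral_fiberSum`).

Fibres of q may be infinite, so v ↦ `sec v` need not preserve compact supports; its inverse does.
The lattice is discrete and acts properly, so a compactly supported section over 𝒴 descends to a
locally finite sum of delta functions. The resulting map `descendCc` is isometric
(`inner_descendCc`) with dense range (`denseRange_descendCc`), and U is the extension of its inverse
to the completions (`exists_unitary`).

Each operator commutes with evaluation at 1, so a relation holds over Y exactly when it holds over 𝒴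
for the sections `sec` (`isTranslateDown_iff`, `isEndoDown_iff`, `isDiracDown_iff`). One inclusion
of graph closures is then immediate. For the other, a pair over Y has to be approximated by pairs
that are compactly supported over 𝒴. A partition of unity on Y reduces to sections over a compact
set covered by one sheet V, and such a section is restricted to the translates ηV with η in a finite
set F (`trunc`). The translates are disjoint and open, so truncation is locally the identity or zero
and creates no commutator with a local operator. As F grows the truncations converge, by Dini's
theorem. The partition of unity does not commute with the Dirac operator, but the commutators are
Clifford products with gradients of functions with sum 1, and these cancel
(`sum_gradCliff_eq_zero`). -/

noncomputable section

namespace PiCover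

/-! ### Metric contraction and changes of basis -/

section Contraction

variable {n : ℕ} {M M' : Type*} [AddCommGroup M] [Module ℂ M] [AddCommGroup M'] [Module ℂ M']

lemma sum_smul_stdVec (v : Eu n) : ∑ j, v j • stdVec j = v := by
  ext i
  simp [stdVec, Finset.sum_apply, Pi.single_apply]

/-- The matrix of an endomorphism of `ℝⁿ` in the standard basis. -/
def stdMatrix (A : Eu n →ₗ[ℝ] Eu n) : Matrix (Fin n) (Fin n) ℝ :=
  Matrix.of fun i j => A (stdVec j) i

lemma map_stdVec (A : Eu n →ₗ[ℝ] Eu n) (j : Fin n) :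
    A (stdVec j) = ∑ i, stdMatrix A i j • stdVec i :=
  (sum_smul_stdVec (A (stdVec j))).symm

lemma stdMatrix_mul (A B : Eu n →ₗ[ℝ] Eu n) : stdMatrix A * stdMatrix B = stdMatrix (A ∘ₗ B) := by
  ext i j
  rw [Matrix.mul_apply]
  change _ = A (B (stdVec j)) i
  rw [map_stdVec B j, map_sum]
  simp [stdMatrix, mul_comm]

lemma stdMatrix_id : stdMatrix (LinearMap.id : Eu n →ₗ[ℝ] Eu n) = 1 := by
  ext i j
  simp [stdMatrix, stdVec, Matrix.one_apply, PiLp.single_apply]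

lemma gram_comp (β : Eu n →ₗ[ℝ] Eu n →ₗ[ℝ] ℝ) (A : Eu n →ₗ[ℝ] Eu n) :
    gram (fun v w => β (A v) (A w)) =
      (stdMatrix A).transpose * gram (fun v w => β v w) * stdMatrix A := by
  ext i j
  simp only [gram, Matrix.of_apply, Matrix.mul_apply, Matrix.transpose_apply]
  rw [map_stdVec A i, map_stdVec A j]
  simp only [map_sum, map_smul, LinearMap.sum_apply, LinearMap.smul_apply, smul_eq_mul,
    Finset.sum_mul, Finset.mul_sum]
  refine Finset.sum_congr rfl fun k _ => Finset.sum_congr rfl fun l _ => ?_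
  ring

/-- Mostly used with f an evaluation `ev τ x` or an isometry between fibres over one orbit: it lets
such maps pass through the Dirac operators. -/
lemma contraction_map (f : M →ₗ[ℂ] M') (β : Eu n → Eu n → ℝ) {cl : Eu n → M →ₗ[ℂ] M}
    {cl' : Eu n → M' →ₗ[ℂ] M'} {α : Eu n → M} {α' : Eu n → M'} (hcl : ∀ v x, f (cl v x) = cl' v (f x))
    (hα : ∀ v, f (α v) = α' v) : f (contraction β cl α) = contraction β cl' α' := by
  simp only [contraction, map_sum, map_smul, hcl, hα]

lemma contraction_add (β : Eu n → Eu n → ℝ) (cl : Eu n → M →ₗ[ℂ] M) (α α' : Eu n → M) :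
    contraction β cl (fun v => α v + α' v) = contraction β cl α + contraction β cl α' := by
  simp only [contraction, map_add, smul_add, Finset.sum_add_distrib]

lemma contraction_smul (β : Eu n → Eu n → ℝ) (cl : Eu n → M →ₗ[ℂ] M) (a : ℂ) (α : Eu n → M) :
    contraction β cl (fun v => a • α v) = a • contraction β cl α := by
  simp only [contraction, map_smul, Finset.smul_sum]
  refine Finset.sum_congr rfl fun j _ => Finset.sum_congr rfl fun k _ => smul_comm _ _ _

/-- The metric contraction does not depend on the basis. -/
lemma contraction_comp (β : Eu n →ₗ[ℝ] Eu n →ₗ[ℝ] ℝ) (A : Eu n ≃ₗ[ℝ] Eu n)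
    {cl : Eu n → M →ₗ[ℂ] M} {α : Eu n → M}
    (hcl_add : ∀ v w x, cl (v + w) x = cl v x + cl w x)
    (hcl_smul : ∀ (r : ℝ) v x, cl (r • v) x = (r : ℂ) • cl v x)
    (hα_add : ∀ v w, α (v + w) = α v + α w) (hα_smul : ∀ (r : ℝ) v, α (r • v) = (r : ℂ) • α v) :
    contraction (fun v w => β (A v) (A w)) (fun v => cl (A v)) (fun v => α (A v)) =
      contraction (fun v w => β v w) cl α := by
  set a := stdMatrix A.toLinearMap
  set b := stdMatrix A.symm.toLinearMap
  have hab : a * b = 1 := by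
    rw [stdMatrix_mul, ← stdMatrix_id]; congr 1; ext v; simp
  have hba : b * a = 1 := by
    rw [stdMatrix_mul, ← stdMatrix_id]; congr 1; ext v; simp
  set G := gram (fun v w => β v w)
  -- Nondegeneracy of β plays no role: `Matrix.mul_inv_rev` holds for the total inverse, and only a
  -- and its transpose are genuinely inverted.
  have hG : (gram fun v w => β (A v) (A w))⁻¹ = b * G⁻¹ * b.transpose := by
    have := gram_comp β A.toLinearMap
    simp only [LinearEquiv.coe_coe] at this
    rw [this, Matrix.mul_inv_rev, Matrix.mul_inv_rev, Matrix.inv_eq_left_inv hba,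
      Matrix.inv_eq_left_inv (show b.transpose * a.transpose = 1 by
        rw [← Matrix.transpose_mul, hab, Matrix.transpose_one]), Matrix.mul_assoc]
  let C : Eu n →+ (M →ₗ[ℂ] M) := AddMonoidHom.mk' cl fun v w => LinearMap.ext fun x => hcl_add v w x
  let D : Eu n →+ M := AddMonoidHom.mk' α hα_add
  have hcl' : ∀ j x, cl (A (stdVec j)) x = ∑ i, (a i j : ℂ) • cl (stdVec i) x := fun j x => by
    have h : A (stdVec j) = ∑ i, a i j • stdVec i := map_stdVec A.toLinearMap j
    rw [h]
    change C (∑ i, a i j • stdVec i) x = _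
    rw [map_sum, LinearMap.sum_apply]
    exact Finset.sum_congr rfl fun i _ => hcl_smul _ _ _
  have hα' : ∀ k, α (A (stdVec k)) = ∑ l, (a l k : ℂ) • α (stdVec l) := fun k => by
    have h : A (stdVec k) = ∑ i, a i k • stdVec i := map_stdVec A.toLinearMap k
    rw [h]
    change D (∑ i, a i k • stdVec i) = _
    rw [map_sum]
    exact Finset.sum_congr rfl fun i _ => hα_smul _ _
  have hG2 : a * (gram fun v w => β (A v) (A w))⁻¹ * a.transpose = G⁻¹ := by
    have h3 : b.transpose * a.transpose = 1 := by
      rw [← Matrix.transpose_mul, hab, Matrix.transpose_one]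
    rw [hG, Matrix.mul_assoc, Matrix.mul_assoc, Matrix.mul_assoc, h3, Matrix.mul_one,
      ← Matrix.mul_assoc, hab, Matrix.one_mul]
  set G' := (gram fun v w => β (A v) (A w))⁻¹
  have hG3 : ∀ i l, ((G⁻¹ i l : ℝ) : ℂ) = ∑ j, ∑ k, ((G' j k : ℝ) : ℂ) * ((a i j : ℂ) * (a l k : ℂ)) := by
    intro i l
    rw [← hG2]
    simp only [Matrix.mul_apply, Matrix.transpose_apply, Finset.sum_mul]
    push_cast
    rw [Finset.sum_comm]
    refine Finset.sum_congr rfl fun j _ => Finset.sum_congr rfl fun k _ => by ring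
  simp only [contraction, hcl', hα', map_sum, map_smul, Finset.smul_sum, smul_smul]
  change ∑ j, ∑ k, ∑ i, ∑ l, (((G' j k : ℝ) : ℂ) * _) • _ = _
  have hR : ∀ i l, ((G⁻¹ i l : ℝ) : ℂ) • cl (stdVec i) (α (stdVec l)) =
      ∑ j, ∑ k, (((G' j k : ℝ) : ℂ) * ((a i j : ℂ) * (a l k : ℂ))) • cl (stdVec i) (α (stdVec l)) := by
    intro i l
    rw [hG3]
    simp only [Finset.sum_smul]
  calc _ = ∑ j, ∑ k, ∑ i, ∑ l, (((G' j k : ℝ) : ℂ) * ((a i j : ℂ) * (a l k : ℂ))) •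
      cl (stdVec i) (α (stdVec l)) := by
        refine Finset.sum_congr rfl fun j _ => Finset.sum_congr rfl fun k _ => ?_
        exact Finset.sum_congr rfl fun i _ => Finset.sum_congr rfl fun l _ => by ring_nf
    _ = ∑ i, ∑ l, ∑ j, ∑ k, (((G' j k : ℝ) : ℂ) * ((a i j : ℂ) * (a l k : ℂ))) •
      cl (stdVec i) (α (stdVec l)) := by
        refine ((Finset.sum_congr rfl fun j _ => Finset.sum_comm).trans Finset.sum_comm).trans ?_
        exact Finset.sum_congr rfl fun i _ =>
          (Finset.sum_congr rfl fun j _ => Finset.sum_comm).trans Finset.sum_comm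
    _ = _ := Finset.sum_congr rfl fun i _ => Finset.sum_congr rfl fun l _ => (hR i l).symm

end Contraction

/-! ### Evaluation of elements of `L²_τ(Π) ⊗ V` -/

section Evaluation

variable {G : Type*} [Group G] [TopologicalSpace G] [IsTopologicalGroup G] {T : Subgroup G} [IsTorus T]
  {P : Type*} [Group P] (τ : CentralExtension T P)

/-- The central element by which `x ∈ P` differs from the chosen lift of its image in `Π`. -/
def CentralExtension.phase (x : P) : Circle :=
  ((τ.exact (x * (τ.lift (τ.proj x))⁻¹)).1 (by
    rw [map_mul, map_inv, τ.proj_lift, mul_inv_cancel])).choose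

lemma CentralExtension.incl_phase_mul (x : P) : τ.incl (τ.phase x) * τ.lift (τ.proj x) = x := by
  have h : τ.incl (τ.phase x) = x * (τ.lift (τ.proj x))⁻¹ := ((τ.exact (x * (τ.lift (τ.proj x))⁻¹)).1 (by
    rw [map_mul, map_inv, τ.proj_lift, mul_inv_cancel])).choose_spec
  rw [h, inv_mul_cancel_right]

lemma CentralExtension.proj_incl (z : Circle) : τ.proj (τ.incl z) = 1 := (τ.exact _).2 ⟨z, rfl⟩

lemma CentralExtension.phase_incl_mul (z : Circle) (x : P) :
    τ.phase (τ.incl z * x) = z * τ.phase x := by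
  apply τ.incl_injective
  have h := τ.incl_phase_mul (τ.incl z * x)
  rw [map_mul, τ.proj_incl, one_mul] at h
  rw [map_mul]
  refine mul_right_cancel (b := τ.lift (τ.proj x)) (h.trans ?_)
  rw [mul_assoc, τ.incl_phase_mul]

lemma CentralExtension.phase_lift (η : Lattice T) : τ.phase (τ.lift η) = 1 := by
  apply τ.incl_injective
  have h := τ.incl_phase_mul (τ.lift η)
  rw [τ.proj_lift] at h
  rw [map_one]
  exact mul_eq_right.1 h

variable {τ}

lemma L2tau.apply_incl_mul (φ : L2tau τ) (z : Circle) (x : P) : φ (τ.incl z * x) = (z⁻¹ : Circle) * φ x := by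
  have := φ.2.1 z⁻¹ x
  rwa [inv_inv] at this

lemma L2tau.apply_eq_phase (φ : L2tau τ) (x : P) :
    φ x = ((τ.phase x)⁻¹ : Circle) * φ (τ.lift (τ.proj x)) := by
  nth_rewrite 1 [← τ.incl_phase_mul x]
  exact φ.apply_incl_mul _ _

/-- The absolute value of φ is a function on Π, so one value is one term of the ℓ² norm. This bound
makes evaluation continuous, hence smooth. -/
lemma L2tau.norm_apply_le (φ : L2tau τ) (x : P) : ‖φ x‖ ≤ ‖φ‖ := by
  rw [norm_eq_of_proj_eq φ.2.1 (τ.proj_lift (τ.proj x)).symm]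
  exact lp.norm_apply_le_norm (by norm_num) (toLp τ φ) (τ.proj x)

variable (τ)

/-- Evaluation at `x ∈ P`, as a continuous functional on `L²_τ(Π)`. -/
def evalL (x : P) : L2tau τ →L[ℂ] ℂ :=
  LinearMap.mkContinuous (⟨⟨fun φ => φ x, fun _ _ => rfl⟩, fun _ _ => rfl⟩ : L2tau τ →ₗ[ℂ] ℂ) 1 fun φ => by
    rw [one_mul]
    exact φ.norm_apply_le x

lemma evalL_apply (x : P) (φ : L2tau τ) : evalL τ x φ = φ x := rfl

open Classical in
/-- The function on `P` which is supported on the lifts of `η` and takes the value `1` at the chosen lift. -/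
def delta (η : Lattice T) : L2tau τ :=
  ⟨fun x => if τ.proj x = η then (((τ.phase x)⁻¹ : Circle) : ℂ) else 0, by
    refine ⟨fun z x => ?_, ?_⟩
    · simp only [map_mul, τ.proj_incl, one_mul, τ.phase_incl_mul, mul_inv, inv_inv, Circle.coe_mul]
      split_ifs <;> simp
    · simp only [τ.proj_lift, τ.phase_lift, inv_one, Circle.coe_one]
      -- Finite support puts the function in ℓ⁰, hence in ℓ².
      exact (memℓp_zero_iff.2 (Set.Finite.subset (Set.finite_singleton η) fun ζ h => by
        simpa using h)).of_exponent_ge (by simp)⟩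

open Classical in
lemma delta_apply (η : Lattice T) (x : P) :
    delta τ η x = if τ.proj x = η then (((τ.phase x)⁻¹ : Circle) : ℂ) else 0 := rfl

variable {V V' : Type*} [NormedAddCommGroup V] [InnerProductSpace ℂ V] [NormedAddCommGroup V']
  [InnerProductSpace ℂ V']

/-- Evaluation `L²_τ(Π) ⊗ V → V` at `x ∈ P`. -/
def ev (x : P) : L2tau τ ⊗[ℂ] V →ₗ[ℂ] V :=
  (TensorProduct.lid ℂ V).toLinearMap ∘ₗ LinearMap.rTensor V (evalL τ x).toLinearMap

lemma ev_tmul (x : P) (φ : L2tau τ) (v : V) : ev τ x (φ ⊗ₜ[ℂ] v) = φ x • v := by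
  simp [ev, evalL_apply]

lemma ev_eq_phase (x : P) (t : L2tau τ ⊗[ℂ] V) :
    ev τ x t = (((τ.phase x)⁻¹ : Circle) : ℂ) • ev τ (τ.lift (τ.proj x)) t := by
  induction t with
  | zero => simp
  | add t t' h h' => rw [map_add, map_add, h, h', smul_add]
  | tmul φ v => rw [ev_tmul, ev_tmul, smul_smul, ← φ.apply_eq_phase]

/-- Passes from L²-valued to scalar coefficients: the smoothness required in `QSmooth` is thereby
inherited by evaluated sections. -/
lemma inner_ev (x : P) (e : V) (t : L2tau τ ⊗[ℂ] V) :
    ⟪e, ev τ x t⟫_ℂ = evalL τ x (coeff e t) := by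
  induction t with
  | zero => simp
  | add t t' h h' => simp only [map_add, inner_add_right, h, h']
  | tmul φ v =>
    rw [ev_tmul, coeff_tmul, inner_smul_right, map_smul, evalL_apply, smul_eq_mul, mul_comm]

lemma ev_mapIsometry_rho (x g : P) (A : V →ₗᵢ[ℂ] V') (t : L2tau τ ⊗[ℂ] V) :
    ev τ x (TensorProduct.mapIsometry (rho τ g) A t) = A (ev τ (x * g) t) := by
  induction t with
  | zero => simp
  | add t t' h h' => simp only [map_add, h, h']
  | tmul φ v => simp [ev_tmul, rho_apply]

lemma ev_mapIsometry_conjRep (x : P) (m : Nrm T) (A : V →ₗᵢ[ℂ] V') (t : L2tau τ ⊗[ℂ] V) :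
    ev τ x (TensorProduct.mapIsometry (conjRep τ m) A t) = A (ev τ (τ.conj m⁻¹ x) t) := by
  induction t with
  | zero => simp
  | add t t' h h' => simp only [map_add, h, h']
  | tmul φ v => simp [ev_tmul, conjRep_apply]

lemma ev_lTensor (x : P) (A : V →ₗ[ℂ] V') (t : L2tau τ ⊗[ℂ] V) :
    ev τ x (A.lTensor (L2tau τ) t) = A (ev τ x t) := by
  induction t with
  | zero => simp
  | add t t' h h' => simp only [map_add, h, h']
  | tmul φ v => simp [ev_tmul]

/-- Parseval in the first factor. By sesquilinearity only pure tensors matter, and there the sum is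
the ℓ² inner product of φ and ψ times ⟪v, w⟫. -/
lemma hasSum_inner_ev (s t : L2tau τ ⊗[ℂ] V) :
    HasSum (fun η => ⟪ev τ (τ.lift η) s, ev τ (τ.lift η) t⟫_ℂ) ⟪s, t⟫_ℂ := by
  induction s with
  | zero => simp
  | add s s' h h' => simpa only [map_add, inner_add_left] using h.add h'
  | tmul φ v =>
    induction t with
    | zero => simp
    | add t t' h h' => simpa only [map_add, inner_add_right] using h.add h'
    | tmul ψ w =>
      simp only [ev_tmul, inner_smul_left, inner_smul_right, TensorProduct.inner_tmul]
      have := (lp.hasSum_inner (toLp τ φ) (toLp τ ψ)).mul_right ⟪v, w⟫_ℂ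
      refine Eq.mp (congrArg (fun f => HasSum f _) (funext fun η => ?_)) this
      change ψ (τ.lift η) * (starRingEnd ℂ) (φ (τ.lift η)) * _ = _
      ring

/-- By Parseval the inner product of `s - t` with itself is a sum of zeros. Identities in the tensor
product are henceforth checked value by value. -/
lemma ev_ext {s t : L2tau τ ⊗[ℂ] V} (h : ∀ x, ev τ x s = ev τ x t) : s = t := by
  rw [← sub_eq_zero, ← inner_self_eq_zero (𝕜 := ℂ)]
  refine (hasSum_inner_ev τ (s - t) (s - t)).unique ?_
  simp [h]

lemma sum_coeff_tmul {L ι : Type*} [NormedAddCommGroup L] [InnerProductSpace ℂ L] [Fintype ι]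
    (b : OrthonormalBasis ι ℂ V) (t : L ⊗[ℂ] V) : ∑ i, coeff (b i) t ⊗ₜ[ℂ] b i = t := by
  induction t with
  | zero => simp
  | add t t' h h' => simp only [map_add, TensorProduct.add_tmul, Finset.sum_add_distrib, h, h']
  | tmul φ v =>
    simp only [coeff_tmul, TensorProduct.smul_tmul, ← TensorProduct.tmul_sum]
    rw [b.sum_repr' v]

end Evaluation

end PiCover

end

noncomputable section

namespace PiCover

/-! ### The integral lattice is discrete -/

section Lattice

variable {G : Type*} [Group G] [TopologicalSpace G] [IsTopologicalGroup G] {T : Subgroup G} [IsTorus T]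

open scoped IsMulCommutative in
instance : IsTopologicalGroup (LieT T) := inferInstanceAs (IsTopologicalGroup (Multiplicative ℝ →ₜ* T))

variable (T) in
lemma IsTorus.t2Space : T2Space T := by
  obtain ⟨r, ⟨e⟩⟩ := IsTorus.exists_iso (T := T)
  exact e.toHomeomorph.isEmbedding.t2Space

instance : T2Space (LieT T) :=
  have : T2Space T := IsTorus.t2Space T
  inferInstanceAs (T2Space (Multiplicative ℝ →ₜ* T))

lemma LieT.val_add (ξ : LieT T) (s t : ℝ) : ξ.val (s + t) = ξ.val s * ξ.val t :=
  map_mul (ContinuousMonoidHom.toMonoidHom ξ) (Multiplicative.ofAdd s) (Multiplicative.ofAdd t)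

lemma LieT.ext {ξ ζ : LieT T} (h : ∀ t, ξ.val t = ζ.val t) : ξ = ζ :=
  ContinuousMonoidHom.ext fun x => h x.toAdd

lemma LieT.one_val (t : ℝ) : (1 : LieT T).val t = 1 := rfl

/-- Lattice elements are 1-periodic, hence controlled by their values on the compact interval [0,
1]. -/
lemma LieT.val_add_int {ξ : LieT T} (h : ξ.exp = 1) (t : ℝ) (k : ℤ) : ξ.val (t + k) = ξ.val t := by
  have h1 : ∀ s, ξ.val (s + 1) = ξ.val s := fun s => by
    rw [LieT.val_add]
    change _ * ξ.exp = _
    rw [h, mul_one]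
  induction k with
  | zero => simp
  | succ k ih => rw [← ih]; push_cast; rw [← add_assoc, h1]
  | pred k ih => rw [← ih, ← h1]; congr 1; push_cast; ring

/-- A family of elements of the circle with positive real parts which is stable under squaring is trivial. -/
lemma circle_eq_one_of_sq {α : Type*} (f : α → Circle) (d : α → α) (hd : ∀ a, f (d a) = f a * f a)
    (hf : ∀ a, 0 < (f a : ℂ).re) (a : α) : f a = 1 := by
  have hn : ∀ a, (f a : ℂ).re ^ 2 + (f a : ℂ).im ^ 2 = 1 := fun a => by
    have := Circle.normSq_coe (f a)
    rw [Complex.normSq_apply] at this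
    nlinarith
  have hre : ∀ a, (f (d a) : ℂ).re = (f a : ℂ).re ^ 2 - (f a : ℂ).im ^ 2 := fun a => by
    rw [hd, Circle.coe_mul, Complex.mul_re]; ring
  have him : ∀ a, (f (d a) : ℂ).im = 2 * (f a : ℂ).re * (f a : ℂ).im := fun a => by
    rw [hd, Circle.coe_mul, Complex.mul_im]; ring
  -- From re² > im² and re² + im² = 1 follows re² > 1/2, so the new im² = 4 re² im² is at least
  -- twice the old one. Being bounded by 1 under iteration, im² is zero.
  have hgrow : ∀ a, 2 * (f a : ℂ).im ^ 2 ≤ (f (d a) : ℂ).im ^ 2 := fun a => by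
    have h1 := hf (d a)
    rw [hre] at h1
    rw [him]
    have h2 := hn a
    nlinarith [sq_nonneg (f a : ℂ).im]
  have hpow : ∀ k : ℕ, ∀ a, 2 ^ k * (f a : ℂ).im ^ 2 ≤ 1 := fun k => by
    induction k with
    | zero => intro a; have := hn a; nlinarith [sq_nonneg (f a : ℂ).re]
    | succ k ih =>
      intro a
      have h1 := ih (d a)
      have h2 := mul_le_mul_of_nonneg_left (hgrow a) (show (0 : ℝ) ≤ 2 ^ k by positivity)
      rw [pow_succ]
      nlinarith
  have h0 : (f a : ℂ).im = 0 := by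
    by_contra hne
    have hpos : 0 < (f a : ℂ).im ^ 2 := by positivity
    obtain ⟨k, hk⟩ := pow_unbounded_of_one_lt (1 / (f a : ℂ).im ^ 2) (one_lt_two)
    rw [div_lt_iff₀ hpos] at hk
    exact absurd (hpow k a) (not_le.2 hk)
  have h1 : (f a : ℂ).re = 1 := by
    have := hn a
    rw [h0] at this
    nlinarith [hf a]
  exact Circle.ext (Complex.ext (by simpa using h1) (by simpa using h0))

/-- In the compact-open topology, mapping [0, 1] into the open set where all circle coordinates have
positive real part is a neighbourhood condition at 1. For a lattice element periodicity extends it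
to all times, and since doubling the time squares the value, `circle_eq_one_of_sq` makes the element
trivial. -/
instance : DiscreteTopology (Lattice T) := by
  obtain ⟨r, ⟨e⟩⟩ := IsTorus.exists_iso (T := T)
  rw [discreteTopology_iff_isOpen_singleton_one]
  let U : Set T := {t | ∀ i, 0 < ((e t i : Circle) : ℂ).re}
  have hU : IsOpen U := by
    simp only [U, Set.ofPred_forall]
    refine isOpen_iInter_of_finite fun i => isOpen_lt continuous_const ?_
    exact Complex.continuous_re.comp (continuous_subtype_val.comp
      ((continuous_apply i).comp e.continuous_toFun))
  let K : Set (Multiplicative ℝ) := Multiplicative.toAdd ⁻¹' Set.Icc (0 : ℝ) 1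
  have hK : IsCompact K := isCompact_Icc (α := ℝ)
  let N : Set (LieT T) := {ξ | Set.MapsTo (ContinuousMonoidHom.toContinuousMap ξ) K U}
  have hN : IsOpen N :=
    (ContinuousMap.isOpen_setOfPred_mapsTo hK hU).preimage
      (ContinuousMonoidHom.isInducing_toContinuousMap (Multiplicative ℝ) T).continuous
  have : ({1} : Set (Lattice T)) = Subtype.val ⁻¹' N := by
    ext η
    simp only [Set.mem_singleton_iff, Set.mem_preimage]
    constructor
    · rintro rfl t _ i
      change 0 < ((e ((1 : LieT T).val (Multiplicative.toAdd t)) i : Circle) : ℂ).re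
      rw [LieT.one_val, map_one]
      simp
    · intro h
      apply Subtype.ext
      apply LieT.ext
      intro t
      apply e.injective
      funext i
      have hp : ∀ t, 0 < ((e (η.1.val t) i : Circle) : ℂ).re := fun t => by
        have h1 := LieT.val_add_int (ξ := η.1) η.2 (Int.fract t) ⌊t⌋
        rw [Int.fract_add_floor] at h1
        rw [h1]
        exact h (show Multiplicative.ofAdd (Int.fract t) ∈ K from
          ⟨Int.fract_nonneg t, (Int.fract_lt_one t).le⟩) i
      have := circle_eq_one_of_sq (fun t => e (η.1.val t) i) (fun t => t + t)
        (fun t => by simp only [LieT.val_add, map_mul, Pi.mul_apply]) hp t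
      rw [this]
      change _ = e ((1 : LieT T).val t) i
      rw [LieT.one_val, map_one]
      rfl
  rw [this]
  exact hN.preimage continuous_subtype_val

-- A discrete subgroup of a Hausdorff group is closed, so it meets the compact set `B * A⁻¹` in a
-- compact discrete, hence finite, set.
open scoped Pointwise in
lemma finite_lattice_of_isCompact {A B : Set (LieT T)} (hA : IsCompact A) (hB : IsCompact B) :
    {η : Lattice T | ∃ a ∈ A, (η : LieT T) * a ∈ B}.Finite := by
  have hC : IsCompact (B * A⁻¹) := hB.mul hA.inv
  have hcl : IsClosed ((Lattice T : Subgroup (LieT T)) : Set (LieT T)) := Subgroup.isClosed_of_discrete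
  have h1 : IsCompact (Subtype.val ⁻¹' (B * A⁻¹) : Set (Lattice T)) :=
    hcl.isClosedEmbedding_subtypeVal.isCompact_preimage hC
  refine h1.finite_of_discrete.subset ?_
  rintro η ⟨a, ha, hb⟩
  exact Set.mem_mul.2 ⟨_, hb, a⁻¹, Set.inv_mem_inv.2 ha, by simp⟩

end Lattice

/-! ### The covering `𝒴 → Y` -/

section CoverTopology

variable {G : Type*} [Group G] [TopologicalSpace G] [IsTopologicalGroup G] {T : Subgroup G} [IsTorus T]
  {Y : Type*} [TopologicalSpace Y] {Φ : Y → T}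

namespace Cover

lemma deck_one (p : Cover Φ) : p.deck 1 = p := Subtype.ext (Prod.ext (one_mul _) rfl)

lemma deck_mul (η ζ : Lattice T) (p : Cover Φ) : p.deck (η * ζ) = (p.deck ζ).deck η :=
  Subtype.ext (Prod.ext (mul_assoc _ _ _) rfl)

lemma deck_inv_deck (η : Lattice T) (p : Cover Φ) : (p.deck η).deck η⁻¹ = p := by
  rw [← deck_mul, inv_mul_cancel, deck_one]

lemma deck_deck_inv (η : Lattice T) (p : Cover Φ) : (p.deck η⁻¹).deck η = p := by
  rw [← deck_mul, mul_inv_cancel, deck_one]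

lemma deck_injective (p : Cover Φ) : Function.Injective fun η : Lattice T => p.deck η := fun η ζ h => by
  have h1 : (η : LieT T) * p.1.1 = ζ * p.1.1 := congrArg (fun p : Cover Φ => p.1.1) h
  exact Subtype.ext (mul_right_cancel h1)

lemma continuous_deck (η : Lattice T) : Continuous fun p : Cover Φ => p.deck η :=
  Continuous.subtype_mk ((continuous_const.mul (continuous_fst.comp continuous_subtype_val)).prodMk
    (continuous_snd.comp continuous_subtype_val)) _

lemma continuous_base : Continuous (base : Cover Φ → Y) := continuous_snd.comp continuous_subtype_val

/-- Proper discontinuity, read off from the 𝔱-coordinates. It makes sums over Π of translates of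
compactly supported sections locally finite. -/
lemma finite_deck {K K' : Set (Cover Φ)} (hK : IsCompact K) (hK' : IsCompact K') :
    {η : Lattice T | ∃ p ∈ K, p.deck η ∈ K'}.Finite := by
  have hc : Continuous fun p : Cover Φ => p.1.1 := continuous_fst.comp continuous_subtype_val
  refine (finite_lattice_of_isCompact (hK.image hc) (hK'.image hc)).subset ?_
  rintro η ⟨p, hp, hp'⟩
  exact ⟨p.1.1, ⟨p, hp, rfl⟩, ⟨_, hp', rfl⟩⟩

lemma _root_.PiCover.LieT.continuous_conj (m : Nrm T) : Continuous (LieT.conj m : LieT T → LieT T) := by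
  have h : Continuous fun t : T => m • t :=
    Continuous.subtype_mk ((continuous_const.mul continuous_subtype_val).mul continuous_const) _
  exact ContinuousMonoidHom.continuous_comp_right (A := Multiplicative ℝ)
    (⟨MulDistribMulAction.toMonoidHom T m, h⟩ : T →ₜ* T)

section Conj

variable [MulAction (Nrm T) Y] (hΦ : ∀ (m : Nrm T) y, Φ (m • y) = m • Φ y)

lemma continuous_conj {m : Nrm T} (hm : Continuous fun y : Y => m • y) :
    Continuous fun p : Cover Φ => p.conj hΦ m :=
  Continuous.subtype_mk (((LieT.continuous_conj m).comp (continuous_fst.comp continuous_subtype_val)).prodMk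
    (hm.comp (continuous_snd.comp continuous_subtype_val))) _

lemma conj_one (p : Cover Φ) : p.conj hΦ 1 = p := by
  refine Subtype.ext (Prod.ext (LieT.ext fun t => ?_) (one_smul _ _))
  change (1 : Nrm T) • p.1.1.val t = _
  rw [one_smul]

lemma conj_mul (m m' : Nrm T) (p : Cover Φ) : p.conj hΦ (m * m') = (p.conj hΦ m').conj hΦ m := by
  refine Subtype.ext (Prod.ext (LieT.ext fun t => ?_) (mul_smul _ _ _))
  change (m * m') • p.1.1.val t = m • m' • p.1.1.val t
  rw [mul_smul]

lemma conj_inv_conj (m : Nrm T) (p : Cover Φ) : (p.conj hΦ m).conj hΦ m⁻¹ = p := by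
  rw [← conj_mul, inv_mul_cancel, conj_one]

lemma conj_conj_inv (m : Nrm T) (p : Cover Φ) : (p.conj hΦ m⁻¹).conj hΦ m = p := by
  rw [← conj_mul, mul_inv_cancel, conj_one]

/-- The relation by which N(T) and Π^τ together act on 𝒴 as the semidirect product; conjugation by m
distributes over the product in 𝔱. -/
lemma deck_conj {P : Type*} [Group P] (τ : CentralExtension T P) (m : Nrm T) (x : P) (p : Cover Φ) :
    (p.deck (τ.proj x)).conj hΦ m = (p.conj hΦ m).deck (τ.proj (τ.conj m x)) := by
  refine Subtype.ext (Prod.ext (LieT.ext fun t => ?_) rfl)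
  change m • ((τ.proj x : LieT T) * p.1.1).val t = ((τ.proj (τ.conj m x) : LieT T) * p.1.1.conj m).val t
  rw [τ.proj_conj]
  change m • ((τ.proj x : LieT T).val t * p.1.1.val t) = m • (τ.proj x : LieT T).val t * m • p.1.1.val t
  rw [smul_mul']

end Conj

end Cover

end CoverTopology

/-! ### The covering map as a local diffeomorphism -/

section CoverSmooth

variable {G : Type*} [Group G] [TopologicalSpace G] [IsTopologicalGroup G] {T : Subgroup G} [IsTorus T]
  {n : ℕ} {Y : Type*} [TopologicalSpace Y] [ChartedSpace (Eu n) Y] {Φ : Y → T}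
  [ChartedSpace (Eu n) (Cover Φ)] [IsSmoothCover n Φ]

namespace Cover

lemma isLocalHomeomorph_base (n : ℕ) [ChartedSpace (Eu n) Y] [ChartedSpace (Eu n) (Cover Φ)] [IsSmoothCover n Φ]
    : IsLocalHomeomorph (base : Cover Φ → Y) :=
  (IsSmoothCover.isLocalDiffeomorph (n := n)).isLocalHomeomorph

lemma isOpenMap_base (n : ℕ) [ChartedSpace (Eu n) Y] [ChartedSpace (Eu n) (Cover Φ)] [IsSmoothCover n Φ]
    : IsOpenMap (base : Cover Φ → Y) := (isLocalHomeomorph_base n).isOpenMap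

/-- Every point of `𝒴` has an open neighbourhood on which `q` is injective. -/
lemma exists_sheet (n : ℕ) [ChartedSpace (Eu n) Y] [ChartedSpace (Eu n) (Cover Φ)] [IsSmoothCover n Φ]
    (p : Cover Φ) : ∃ V : Set (Cover Φ), IsOpen V ∧ p ∈ V ∧ V.InjOn base := by
  obtain ⟨e, he, h⟩ := isLocalHomeomorph_base (Φ := Φ) n p
  exact ⟨e.source, e.open_source, he, by rw [h]; exact e.injOn⟩

/-- The part of a sheet over a compact set is compact. -/
lemma isCompact_sheet_inter (n : ℕ) [ChartedSpace (Eu n) Y] [ChartedSpace (Eu n) (Cover Φ)] [IsSmoothCover n Φ]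
    {V : Set (Cover Φ)} (hV : IsOpen V) (hinj : V.InjOn base) {K : Set Y}
    (hK : IsCompact K) (hKV : K ⊆ base '' V) : IsCompact (V ∩ base ⁻¹' K) := by
  rw [isCompact_iff_compactSpace]
  let f : V → Y := fun p => p.1.base
  have hf : Topology.IsOpenEmbedding f := by
    refine Topology.IsOpenEmbedding.of_continuous_injective_isOpenMap
      (continuous_base.comp continuous_subtype_val) (fun a b h => Subtype.ext (hinj a.2 b.2 h)) ?_
    exact (isOpenMap_base n).comp hV.isOpenMap_subtype_val
  have h1 : IsCompact (f ⁻¹' K) := hf.isInducing.isCompact_preimage' hK (by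
    rintro y hy
    obtain ⟨p, hp, rfl⟩ := hKV hy
    exact ⟨⟨p, hp⟩, rfl⟩)
  have h2 := h1.image continuous_subtype_val
  have : Subtype.val '' (f ⁻¹' K) = V ∩ base ⁻¹' K := by
    ext p
    constructor
    · rintro ⟨p, hp, rfl⟩
      exact ⟨p.2, hp⟩
    · rintro ⟨h1, h2⟩
      exact ⟨⟨p, h1⟩, h2, rfl⟩
  rw [this] at h2
  exact isCompact_iff_compactSpace.1 h2

/-- A continuous lift of a smooth map to `𝒴` is smooth. -/
lemma contMDiff_of_base {M : Type*} [TopologicalSpace M] [ChartedSpace (Eu n) M] {f : M → Cover Φ}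
    (hf : Continuous f) (h : ContMDiff (𝓡 n) (𝓡 n) ∞ fun x => (f x).base) : ContMDiff (𝓡 n) (𝓡 n) ∞ f := by
  intro x
  have hq := (IsSmoothCover.isLocalDiffeomorph (n := n) (Φ := Φ)) (f x)
  -- Continuity keeps f in one sheet near x, and there f is the local inverse of q composed with the
  -- smooth map below.
  have h1 : ContMDiffAt (𝓡 n) (𝓡 n) ∞ (hq.localInverse ∘ fun x => (f x).base) x :=
    hq.localInverse_contMDiffAt.comp x (h x)
  refine h1.congr_of_eventuallyEq ?_
  have h2 := hq.localInverse_eventuallyEq_left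
  have h3 := hf.continuousAt.eventually h2
  filter_upwards [h3] with a ha
  exact ha.symm

variable (n) in
lemma contMDiff_deck (η : Lattice T) : ContMDiff (𝓡 n) (𝓡 n) ∞ fun p : Cover Φ => p.deck η :=
  contMDiff_of_base (continuous_deck η) (contMDiff_base n Φ)

end Cover

variable (n) in
lemma isInvertible_dq (p : Cover Φ) : (dq (n := n) p).IsInvertible := by
  have hq := (IsSmoothCover.isLocalDiffeomorph (n := n) (Φ := Φ)) p
  exact ⟨hq.mfderivToContinuousLinearEquiv (by simp), hq.mfderivToContinuousLinearEquiv_coe (by simp)⟩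

lemma dq_dqInv (p : Cover Φ) (w : TangentSpace (𝓡 n) p.base) : dq p (dqInv p w) = w := by
  obtain ⟨e, he⟩ := isInvertible_dq n p
  rw [dqInv, ← he, ContinuousLinearMap.inverse_equiv]
  exact e.apply_symm_apply w

lemma dqInv_dq (p : Cover Φ) (v : TangentSpace (𝓡 n) p) : dqInv p (dq p v) = v := by
  obtain ⟨e, he⟩ := isInvertible_dq n p
  rw [dqInv, ← he, ContinuousLinearMap.inverse_equiv]
  exact e.symm_apply_apply v

lemma dq_mfderiv_deck (η : Lattice T) (p : Cover Φ) (v : TangentSpace (𝓡 n) p) :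
    dq (p.deck η) (mfderiv (𝓡 n) (𝓡 n) (fun p : Cover Φ => p.deck η) p v) = dq p v := by
  have h := mfderiv_comp p ((contMDiff_base n Φ).mdifferentiableAt (x := p.deck η) (by simp))
    ((Cover.contMDiff_deck n η).mdifferentiableAt (x := p) (by simp))
  exact (DFunLike.congr_fun h v).symm

/-- Since q is invariant under deck transformations, these permute the lifts of a given tangent
vector of Y. Clifford multiplication by lifted vectors is therefore compatible with Π^τ. -/
lemma dqInv_deck (η : Lattice T) (p : Cover Φ) (w : TangentSpace (𝓡 n) p.base) :
    dqInv (p.deck η) w = mfderiv (𝓡 n) (𝓡 n) (fun p : Cover Φ => p.deck η) p (dqInv p w) := by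
  have h := dq_mfderiv_deck η p (dqInv p w)
  rw [dq_dqInv] at h
  rw [← dqInv_dq (p.deck η) (mfderiv (𝓡 n) (𝓡 n) (fun p : Cover Φ => p.deck η) p (dqInv p w))]
  exact congrArg _ h.symm

end CoverSmooth

end PiCover

end

noncomputable section

namespace PiCover

/-! ### Integration over `𝒴` and over `Y` -/

section Integration

open MeasureTheory

variable {G : Type*} [Group G] [TopologicalSpace G] [IsTopologicalGroup G] {T : Subgroup G} [IsTorus T]
  {n : ℕ} {Y : Type*} [TopologicalSpace Y] [ChartedSpace (Eu n) Y] {Φ : Y → T}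
  [ChartedSpace (Eu n) (Cover Φ)] [IsSmoothCover n Φ]

/-- The derivatives take values in tangent spaces at `f x` and at `f' x`, which are different types.
Read in the model space `Eu n`, base point and derivative can be replaced separately. -/
lemma form_mfderiv_congr [IsManifold (𝓡 n) ∞ Y] (g : Metric n Y) {f f' : Eu n → Y} {x : Eu n}
    (h : f =ᶠ[nhds x] f') (v w : Eu n) :
    g.form (f x) (mfderiv (𝓡 n) (𝓡 n) f x v) (mfderiv (𝓡 n) (𝓡 n) f x w) =
      g.form (f' x) (mfderiv (𝓡 n) (𝓡 n) f' x v) (mfderiv (𝓡 n) (𝓡 n) f' x w) := by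
  let F : Y → (Eu n →L[ℝ] Eu n) → ℝ := fun y D => g.form y (D v) (D w)
  change F (f x) (mfderiv (𝓡 n) (𝓡 n) f x) = F (f' x) (mfderiv (𝓡 n) (𝓡 n) f' x)
  have h1 := h.eq_of_nhds
  have h2 : (mfderiv (𝓡 n) (𝓡 n) f x : Eu n →L[ℝ] Eu n) = mfderiv (𝓡 n) (𝓡 n) f' x := h.mfderiv_eq
  rw [h1, h2]

/-- Near every point, the covering map preserves the Riemannian measures. -/
lemma Cover.exists_sheet_measure [IsManifold (𝓡 n) ∞ Y] [IsManifold (𝓡 n) ∞ (Cover Φ)]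
    [MeasurableSpace Y] [BorelSpace Y] [MeasurableSpace (Cover Φ)] [BorelSpace (Cover Φ)]
    {g : Metric n Y} {μY : Measure Y} (hμY : IsRiemannianVolume g.form μY)
    {μ : Measure (Cover Φ)} (hμ : IsRiemannianVolume (g.lift Φ) μ) (p : Cover Φ) :
    ∃ V : Set (Cover Φ), IsOpen V ∧ p ∈ V ∧ V.InjOn base ∧
      ∀ A ⊆ V, MeasurableSet A → μ A = μY (base '' A) := by
  obtain ⟨ψ, hp, hψ⟩ := (IsSmoothCover.isLocalDiffeomorph (n := n) (Φ := Φ)) p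
  let e0 : OpenPartialHomeomorph (Cover Φ) Y := ψ.toOpenPartialHomeomorph
  have he0 : ∀ x ∈ e0.source, e0 x = x.base := fun x hx => (hψ hx).symm
  let e' := chartAt (Eu n) p.base
  -- A chart of 𝒴 made from q and a chart of Y. In these two charts q is the identity, so both
  -- volume densities are the same function on the same set.
  let e := e0.trans e'
  have hsrc : ∀ x ∈ e.source, x ∈ e0.source ∧ x.base ∈ e'.source := fun x hx => by
    have : x ∈ e0.source ∩ e0 ⁻¹' e'.source := by rwa [← OpenPartialHomeomorph.trans_source]
    exact ⟨this.1, by rw [← he0 x this.1]; exact this.2⟩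
  have he : ∀ x ∈ e.source, e x = e' x.base := fun x hx => by
    change e' (e0 x) = _
    rw [he0 x (hsrc x hx).1]
  have hatl' : e' ∈ IsManifold.maximalAtlas (𝓡 n) ∞ Y := IsManifold.chart_mem_maximalAtlas _
  have hatl : e ∈ IsManifold.maximalAtlas (𝓡 n) ∞ (Cover Φ) := by
    rw [IsManifold.mem_maximalAtlas_iff_contMDiffOn]
    constructor
    · refine ((contMDiffOn_of_mem_maximalAtlas hatl').comp (contMDiff_base n Φ).contMDiffOn
        fun x hx => (hsrc x hx).2).congr he
    · refine ContMDiffOn.comp (t := e0.target) ψ.contMDiffOn_invFun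
        ((contMDiffOn_symm_of_mem_maximalAtlas hatl').mono fun x hx => ?_) fun x hx => ?_
      · rw [OpenPartialHomeomorph.trans_target] at hx
        exact hx.1
      · rw [OpenPartialHomeomorph.trans_target] at hx
        exact hx.2
  have hinj : e.source.InjOn base := fun x hx y hy h => by
    apply e0.injOn (hsrc x hx).1 (hsrc y hy).1
    rw [he0 x (hsrc x hx).1, he0 y (hsrc y hy).1, h]
  refine ⟨e.source, e.open_source, ?_, hinj, fun A hA hAm => ?_⟩
  · rw [OpenPartialHomeomorph.trans_source]
    refine ⟨hp, ?_⟩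
    change e0 p ∈ e'.source
    rw [he0 p hp]
    exact mem_chart_source _ _
  have himg : e '' A = e' '' (base '' A) := by
    rw [Set.image_image]
    exact Set.image_congr fun x hx => he x (hA hx)
  have hme : MeasurableEmbedding (e.source.domRestrict e) := e.isOpenEmbedding_restrict.measurableEmbedding
  have hme0 : MeasurableEmbedding (e0.source.domRestrict e0) := e0.isOpenEmbedding_restrict.measurableEmbedding
  have hm : MeasurableSet (e '' A) := by
    have := hme.measurableSet_image.2 (measurable_subtype_coe hAm)
    rwa [Set.image_domRestrict, Set.inter_eq_left.2 hA] at this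
  have hm0 : MeasurableSet (base '' A) := by
    have hA0 : A ⊆ e0.source := fun x hx => (hsrc x (hA hx)).1
    have := hme0.measurableSet_image.2 (measurable_subtype_coe hAm)
    rw [Set.image_domRestrict, Set.inter_eq_left.2 hA0] at this
    rwa [Set.image_congr fun x hx => he0 x (hA0 hx)] at this
  rw [hμ e hatl A hA hAm, hμY e' hatl' (base '' A) (by
    rintro _ ⟨x, hx, rfl⟩
    exact (hsrc x (hA hx)).2) hm0, ← himg]
  refine setLIntegral_congr_fun hm ?_
  rintro x ⟨a, ha, rfl⟩
  have hx : e a ∈ e.target := e.map_source (hA ha)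
  have hev : (base ∘ e.symm) =ᶠ[nhds (e a)] e'.symm := by
    filter_upwards [e.open_target.mem_nhds hx] with z hz
    have h1 := e.map_target hz
    have h2 := he _ h1
    rw [e.right_inv hz] at h2
    have h3 := (hsrc _ h1).2
    exact (e'.left_inv h3).symm.trans (by rw [← h2])
  have hD : mfderiv (𝓡 n) (𝓡 n) (base ∘ e.symm) (e a) =
      (dq (e.symm (e a))).comp (mfderiv (𝓡 n) (𝓡 n) e.symm (e a)) :=
    mfderiv_comp (e a) ((contMDiff_base n Φ).mdifferentiableAt (by simp))
      (((contMDiffOn_symm_of_mem_maximalAtlas hatl).contMDiffAt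
        (e.open_target.mem_nhds hx)).mdifferentiableAt (by simp))
  simp only
  congr 4
  funext v w
  rw [← form_mfderiv_congr g hev v w, hD]
  rfl

/-- Summation over the fibres of `q : 𝒴 → Y`. -/
def fiberSum (f : Cover Φ → ℂ) (y : Y) : ℂ :=
  ∑ᶠ η : Lattice T, f ((Function.surjInv (Cover.base_surjective Φ) y).deck η)

/-- Moving from the chosen point of the fibre to p reindexes the sum by a translation of Π. -/
lemma fiberSum_base (f : Cover Φ → ℂ) (p : Cover Φ) : fiberSum f p.base = ∑ᶠ η : Lattice T, f (p.deck η) := by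
  set p' : Cover Φ := Function.surjInv (Cover.base_surjective Φ) p.base with hp'
  have hb : p'.base = p.base := Function.surjInv_eq (Cover.base_surjective Φ) p.base
  obtain ⟨ζ, hζ⟩ := Cover.exists_deck hb.symm
  change ∑ᶠ η : Lattice T, f (p'.deck η) = _
  rw [hζ]
  simp only [← Cover.deck_mul]
  exact finsum_comp_equiv (Equiv.mulRight ζ) (f := fun η => f (p.deck η))

variable [MeasurableSpace Y] [BorelSpace Y] [MeasurableSpace (Cover Φ)] [BorelSpace (Cover Φ)]
  {μY : Measure Y} {μ : Measure (Cover Φ)}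

/-- For a function supported in one sheet the fibre sum has at most one nonzero term: it is `f`
carried to Y by q restricted to V, and this restriction carries μ on V to μY on q(V). -/
lemma integral_fiberSum_of_sheet (n : ℕ) [ChartedSpace (Eu n) Y] [ChartedSpace (Eu n) (Cover Φ)]
    [IsSmoothCover n Φ] {V : Set (Cover Φ)} (hV : IsOpen V) (hinj : V.InjOn Cover.base)
    (hVμ : ∀ A ⊆ V, MeasurableSet A → μ A = μY (Cover.base '' A)) {f : Cover Φ → ℂ} (hf : Integrable f μ)
    (hf0 : ∀ p ∉ V, f p = 0) :
    Integrable (fiberSum f) μY ∧ ∫ y, fiberSum f y ∂μY = ∫ p, f p ∂μ := by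
  let b : V → Y := fun p => p.1.base
  have hb : Topology.IsOpenEmbedding b :=
    Topology.IsOpenEmbedding.of_continuous_injective_isOpenMap
      (Cover.continuous_base.comp continuous_subtype_val) (fun a b h => Subtype.ext (hinj a.2 b.2 h))
      ((Cover.isOpenMap_base n).comp hV.isOpenMap_subtype_val)
  have hbm : MeasurableEmbedding b := hb.measurableEmbedding
  have hvm : MeasurableEmbedding (Subtype.val : V → Cover Φ) := MeasurableEmbedding.subtype_coe hV.measurableSet
  have hrange : Set.range b = Cover.base '' V := by
    rw [show b = Cover.base ∘ Subtype.val from rfl, Set.range_comp, Subtype.range_val]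
  have hmap : μY.restrict (Cover.base '' V) = (μ.comap Subtype.val).map b := by
    ext A hA
    rw [Measure.restrict_apply hA, hbm.map_apply, hvm.comap_apply, hVμ]
    · congr 1
      ext y
      constructor
      · rintro ⟨h1, p, hp, rfl⟩
        exact ⟨p, ⟨⟨p, hp⟩, h1, rfl⟩, rfl⟩
      · rintro ⟨_, ⟨p, hp, rfl⟩, rfl⟩
        exact ⟨hp, p, p.2, rfl⟩
    · rintro _ ⟨p, -, rfl⟩
      exact p.2
    · exact hvm.measurableSet_image.2 (hbm.measurable hA)
  have hval : ∀ p : V, fiberSum f p.1.base = f p := fun p => by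
    rw [fiberSum_base, finsum_eq_single _ (1 : Lattice T), Cover.deck_one]
    intro η hη
    refine hf0 _ fun h => hη ?_
    have := hinj h p.2 (Cover.base_deck η p.1)
    exact Cover.deck_injective p.1 (this.trans (Cover.deck_one _).symm)
  have hzero : ∀ y ∉ Cover.base '' V, fiberSum f y = 0 := fun y hy => by
    obtain ⟨p, rfl⟩ := Cover.base_surjective Φ y
    rw [fiberSum_base]
    refine (finsum_congr fun η => ?_).trans finsum_zero
    exact hf0 _ fun h => hy ⟨_, h, Cover.base_deck η p⟩
  have hmeas : MeasurableSet (Cover.base '' V) := hrange ▸ hbm.measurableSet_range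
  have hcomp : (fiberSum f ∘ b) = f ∘ Subtype.val := funext hval
  constructor
  · have h1 : IntegrableOn (fiberSum f) (Cover.base '' V) μY := by
      rw [IntegrableOn, hmap, hbm.integrable_map_iff, hcomp, ← hvm.integrable_map_iff,
        hvm.map_comap, Subtype.range_val]
      exact hf.integrableOn
    exact h1.integrable_of_forall_notMem_eq_zero hzero
  · rw [← setIntegral_eq_integral_of_forall_compl_eq_zero hzero, hmap, hbm.integral_map,
      ← setIntegral_eq_integral_of_forall_compl_eq_zero hf0,
      ← integral_subtype_comap hV.measurableSet]
    exact integral_congr_ae (Filter.Eventually.of_forall hval)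

lemma finite_support_deck {f : Cover Φ → ℂ} {K : Set (Cover Φ)} (hK : IsCompact K) (hf : ∀ p ∉ K, f p = 0)
    (p : Cover Φ) : (Function.support fun η : Lattice T => f (p.deck η)).Finite := by
  refine (Cover.finite_deck isCompact_singleton hK (K := {p})).subset fun η hη => ⟨p, rfl, ?_⟩
  by_contra h
  exact hη (hf _ h)

/-- Integration over `𝒴` is summation over the fibres followed by integration over `Y`. -/
lemma integral_fiberSum [T2Space Y] [IsManifold (𝓡 n) ∞ Y] [IsManifold (𝓡 n) ∞ (Cover Φ)]
    [IsFiniteMeasureOnCompacts μ] {g : Metric n Y}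
    (hμY : IsRiemannianVolume g.form μY) (hμ : IsRiemannianVolume (g.lift Φ) μ) {f : Cover Φ → ℂ}
    (hf : Continuous f) {K : Set (Cover Φ)} (hK : IsCompact K) (hf0 : ∀ p ∉ K, f p = 0) :
    ∫ y, fiberSum f y ∂μY = ∫ p, f p ∂μ := by
  have : LocallyCompactSpace (Cover Φ) := ChartedSpace.locallyCompactSpace (Eu n) _
  choose V hVo hVp hVi hVμ using Cover.exists_sheet_measure (n := n) (Φ := Φ) hμY hμ
  obtain ⟨t, htK, ht⟩ := hK.elim_nhds_subcover V fun p _ => (hVo p).mem_nhds (hVp p)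
  let enum := t.equivFin.symm
  -- A continuous partition of unity on 𝒴 cuts f into finitely many pieces, each supported in a
  -- measure preserving sheet.
  obtain ⟨ρ, hρ1, hρ2, hρ3, hρ4⟩ := exists_continuous_sum_one_of_isOpen_isCompact
    (s := fun i => V (enum i)) (fun i => hVo _) hK (ht.trans (by
      intro x hx
      simp only [Set.mem_iUnion] at hx ⊢
      obtain ⟨i, hi, hx⟩ := hx
      exact ⟨t.equivFin ⟨i, hi⟩, by simpa [enum] using hx⟩))
  have hsum : ∀ p, f p = ∑ i, (ρ i p : ℂ) * f p := fun p => by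
    by_cases hp : p ∈ K
    · have := hρ2 hp
      simp only [Finset.sum_apply, Pi.one_apply] at this
      rw [← Finset.sum_mul, ← Complex.ofReal_sum, this, Complex.ofReal_one, one_mul]
    · simp [hf0 p hp]
  have hc : ∀ i, Continuous fun p => (ρ i p : ℂ) * f p := fun i =>
    (Complex.continuous_ofReal.comp (ρ i).continuous).mul hf
  have h0 : ∀ i, ∀ p ∉ K, (ρ i p : ℂ) * f p = 0 := fun i p hp => by rw [hf0 p hp, mul_zero]
  have hint : ∀ i, Integrable (fun p => (ρ i p : ℂ) * f p) μ := fun i =>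
    (hc i).integrable_of_hasCompactSupport (HasCompactSupport.intro hK (h0 i))
  have hi : ∀ i, _ := fun i => integral_fiberSum_of_sheet n (hVo (enum i)) (hVi _) (hVμ _) (hint i)
    (fun p hp => by
      rw [image_eq_zero_of_notMem_tsupport (fun h => hp (hρ1 i h)), Complex.ofReal_zero, zero_mul])
  have hfs : ∀ y, fiberSum f y = ∑ i, fiberSum (fun p => (ρ i p : ℂ) * f p) y := fun y => by
    obtain ⟨p, rfl⟩ := Cover.base_surjective Φ y
    simp only [fiberSum_base]
    -- The fibre sum is additive because every orbit meets the compact set K only finitely often.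
    rw [← finsum_sum_comm _ _ fun i _ => finite_support_deck hK (h0 i) p]
    exact finsum_congr fun η => hsum _
  simp only [hfs]
  rw [integral_finsetSum _ fun i _ => (hi i).1]
  simp only [(hi _).2]
  rw [← integral_finsetSum _ fun i _ => hint i]
  exact integral_congr_ae (Filter.Eventually.of_forall fun p => (hsum p).symm)

end Integration

end PiCover

end

noncomputable section

namespace PiCover

/-! ### Sections over `𝒴` and invariant sections of `L²_τ(Π) ⊗ W` -/

section Twisted

open MeasureTheory

variable {G : Type*} [Group G] [TopologicalSpace G] [IsTopologicalGroup G] {T : Subgroup G} [IsTorus T]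
  {P : Type*} [Group P] {τ : CentralExtension T P}
  {n : ℕ} {Y : Type*} [TopologicalSpace Y] {Φ : Y → T} [ChartedSpace (Eu n) (Cover Φ)]
  {W : Cover Φ → Type*} [∀ p, NormedAddCommGroup (W p)] [∀ p, InnerProductSpace ℂ (W p)]
  {act : ∀ (g : P) (p : Cover Φ), W p →ₗᵢ[ℂ] W (p.deck (τ.proj g))}

/-- The group laws relate vectors in fibres over points that agree only propositionally, so they are
stated in the total space. When one side is a value of a section, such an equation becomes one in a
single fibre. -/
lemma eq_of_sigma_eq {B : Type*} {W : B → Type*} (σ : ∀ b, W b) {b b' : B} {w : W b}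
    (h : (⟨b, w⟩ : Σ b, W b) = ⟨b', σ b'⟩) : w = σ b := by
  obtain ⟨rfl, h⟩ := Sigma.mk.inj_iff.1 h
  exact eq_of_heq h

variable (act) in
/-- The translate `p ↦ g⁻¹ σ(gp)` of a section. -/
def pull (g : P) (σ : ∀ p, W p) (p : Cover Φ) : W p :=
  Function.invFun (act g p) (σ (p.deck (τ.proj g)))

variable (act) in
/-- The isometries `act` define an action of `Π^τ`, of weight `1` for the central circle. -/
structure IsTwistedAction : Prop where
  mul : ∀ g h p w, (⟨_, act (g * h) p w⟩ : Σ p, W p) = ⟨_, act g _ (act h p w)⟩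
  weight : ∀ (z : Circle) p w, (⟨_, act (τ.incl z) p w⟩ : Σ p, W p) = ⟨p, (z : ℂ) • w⟩

lemma pull_eq {g : P} {σ : ∀ p, W p} {p : Cover Φ} {w : W p} (h : act g p w = σ (p.deck (τ.proj g))) :
    pull act g σ p = w := by
  rw [pull, ← h]
  exact Function.leftInverse_invFun (act g p).injective w

namespace IsTwistedAction

variable (hact : IsTwistedAction act)
include hact

/-- A preimage of `w` is found by acting with `g⁻¹`: the identity of Π^τ is the image of 1 ∈ U(1),
so by the weight condition it acts trivially. -/
lemma surjective (g : P) (p : Cover Φ) : Function.Surjective (act g p) := fun w => by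
  have h0 := hact.weight 1 (p.deck (τ.proj g)) w
  have h1 := hact.mul g g⁻¹ (p.deck (τ.proj g)) w
  rw [mul_inv_cancel, ← map_one τ.incl, h0] at h1
  -- Here q stands for `(p.deck (τ.proj g)).deck (τ.proj g⁻¹)`, which equals p; it is generalised so
  -- that this equality can be substituted.
  have key : ∀ q : Cover Φ, q = p → ∀ w' : W q,
      (⟨p.deck (τ.proj g), ((1 : Circle) : ℂ) • w⟩ : Σ p, W p) = ⟨_, act g q w'⟩ → ∃ u, act g p u = w := by
    rintro q rfl w' h
    refine ⟨w', ?_⟩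
    have := eq_of_heq (Sigma.mk.inj_iff.1 h).2
    rw [← this, Circle.coe_one, one_smul]
  refine key _ ?_ _ h1
  rw [map_inv, Cover.deck_inv_deck]

lemma act_pull (g : P) (σ : ∀ p, W p) (p : Cover Φ) : act g p (pull act g σ p) = σ (p.deck (τ.proj g)) :=
  Function.invFun_eq (hact.surjective g p _)

lemma pull_smul (g : P) (c : ℂ) (σ : ∀ p, W p) : pull act g (c • σ) = c • pull act g σ :=
  funext fun p => pull_eq (by simp only [Pi.smul_apply, map_smul, hact.act_pull])

lemma pull_mul (g h : P) (σ : ∀ p, W p) : pull act (g * h) σ = pull act h (pull act g σ) :=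
  funext fun p => pull_eq (by
    refine eq_of_sigma_eq (b' := (p.deck (τ.proj h)).deck (τ.proj g)) σ ?_
    rw [hact.mul, hact.act_pull, hact.act_pull])

/-- The inverse of z matches φ(zx) = z⁻¹φ(x) in L²_τ(Π): as a function of the group element, the
pull-back has the equivariance required there. -/
lemma pull_incl (z : Circle) (σ : ∀ p, W p) : pull act (τ.incl z) σ = (z⁻¹ : ℂ) • σ :=
  funext fun p => pull_eq (by
    refine eq_of_sigma_eq (b' := p) σ ?_
    rw [hact.weight, Pi.smul_apply, smul_smul, mul_inv_cancel₀ (Circle.coe_ne_zero z), one_smul])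

lemma pull_one (σ : ∀ p, W p) : pull act 1 σ = σ := by
  rw [← map_one τ.incl, hact.pull_incl]; simp

lemma pull_eq_phase (g : P) (σ : ∀ p, W p) :
    pull act g σ = (((τ.phase g)⁻¹ : Circle) : ℂ) • pull act (τ.lift (τ.proj g)) σ := by
  nth_rewrite 1 [← τ.incl_phase_mul g]
  rw [hact.pull_mul, hact.pull_incl, hact.pull_smul, Circle.coe_inv]

lemma inner_pull_lift (η : Lattice T) (σ σ' : ∀ p, W p) (p : Cover Φ) :
    ⟪pull act (τ.lift η) σ p, pull act (τ.lift η) σ' p⟫_ℂ = ⟪σ (p.deck η), σ' (p.deck η)⟫_ℂ := by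
  rw [← (act (τ.lift η) p).inner_map_map, hact.act_pull, hact.act_pull, τ.proj_lift]

lemma pull_lift_eq_zero (η : Lattice T) (σ : ∀ p, W p) (p : Cover Φ) :
    pull act (τ.lift η) σ p = 0 ↔ σ (p.deck η) = 0 := by
  rw [← inner_self_eq_zero (𝕜 := ℂ), hact.inner_pull_lift, inner_self_eq_zero]

end IsTwistedAction

/-- The section of `W` over `𝒴` corresponding to a section `v` of `(L²_τ(Π) ⊗ W)/Π` over `Y`: the value at
`1 ∈ Π^τ` of the invariant section `upstairs v`. -/
def sec (v : ∀ y, QFib τ act y) (p : Cover Φ) : W p := ev τ 1 (upstairs v p)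

/-- Invariance trades evaluation at g over p for evaluation at 1 over gp. So `sec v` determines v,
and statements about v can be read on 𝒴. -/
lemma ev_upstairs (v : ∀ y, QFib τ act y) (g : P) (p : Cover Φ) :
    ev τ g (upstairs v p) = pull act g (sec v) p := by
  refine (pull_eq ?_).symm
  rw [sec, upstairs_deck, ev_mapIsometry_rho, one_mul]

lemma eq_of_upstairs_eq {v v' : ∀ y, QFib τ act y} (h : ∀ p, upstairs v p = upstairs v' p) : v = v' := by
  funext y
  apply Subtype.ext
  funext ⟨p, hp⟩
  subst hp
  exact h p

lemma eq_of_sec_eq {v v' : ∀ y, QFib τ act y} (h : ∀ p, sec v p = sec v' p) : v = v' :=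
  eq_of_upstairs_eq fun p => ev_ext τ fun g => by
    rw [ev_upstairs, ev_upstairs, show sec v = sec v' from funext h]

lemma upstairs_add (v v' : ∀ y, QFib τ act y) (p : Cover Φ) :
    upstairs (v + v') p = upstairs v p + upstairs v' p := rfl

lemma upstairs_smul (c : ℂ) (v : ∀ y, QFib τ act y) (p : Cover Φ) :
    upstairs (c • v) p = c • upstairs v p := rfl

lemma sec_add (v v' : ∀ y, QFib τ act y) (p : Cover Φ) : sec (v + v') p = sec v p + sec v' p := by
  rw [sec, upstairs_add, map_add]; rfl

lemma sec_sub (v v' : ∀ y, QFib τ act y) (p : Cover Φ) : sec (v - v') p = sec v p - sec v' p := by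
  have : upstairs (v - v') p = upstairs v p - upstairs v' p := rfl
  rw [sec, this, map_sub]; rfl

lemma sec_smul (c : ℂ) (v : ∀ y, QFib τ act y) (p : Cover Φ) : sec (c • v) p = c • sec v p := by
  rw [sec, upstairs_smul, map_smul]; rfl

lemma upstairs_eq_zero {v : ∀ y, QFib τ act y} {p : Cover Φ} (h : v p.base = 0) : upstairs v p = 0 := by
  rw [upstairs, h]; rfl

lemma sec_eq_zero {v : ∀ y, QFib τ act y} {p : Cover Φ} (h : v p.base = 0) : sec v p = 0 := by
  rw [sec, upstairs_eq_zero h, map_zero]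

/-- By `ev_upstairs` all values of v at y are translates of values of `sec v` on the orbit over y.
-/
lemma eq_zero_of_sec {v : ∀ y, QFib τ act y} (hact : IsTwistedAction act) {y : Y}
    (h : ∀ p : Cover Φ, p.base = y → sec v p = 0) : v y = 0 := by
  obtain ⟨p, rfl⟩ := Cover.base_surjective Φ y
  have h1 : ∀ q : Cover Φ, q.base = p.base → upstairs v q = 0 := fun q hq => ev_ext τ fun g => by
    rw [ev_upstairs, map_zero]
    refine pull_eq ?_
    rw [map_zero, h _ (by rw [Cover.base_deck, hq])]
  apply Subtype.ext
  funext ⟨q, hq⟩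
  have : ∀ y (hy : q.base = y), upstairs v q = 0 → (v y).1 ⟨q, hy⟩ = 0 := by
    rintro y rfl h; exact h
  exact this _ hq (h1 q hq)

/-- The coefficient in `L²_τ(Π)` as a real-linear evaluation. -/
lemma contMDiff_evalL (g : P) : ContMDiff 𝓘(ℝ, L2tau τ) 𝓘(ℝ, ℂ) ∞ (evalL τ g) :=
  ((evalL τ g).restrictScalars ℝ).contDiff.contMDiff

/-- Evaluation is a bounded functional, so it preserves smoothness. The support of `sec v` is in
general compact only modulo Π. -/
lemma smoothOn_sec {H : HermitianBundle n W} {v : ∀ y, QFib τ act y} (hv : QSmooth H v) :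
    H.SmoothOn (sec v) Set.univ := fun p i => by
  refine ((contMDiff_evalL (1 : P)).comp_contMDiffOn ((hv p i).mono Set.inter_subset_left)).congr fun x _ => ?_
  rw [sec, inner_ev]
  rfl

variable (act) in
/-- The invariant section of `L²_τ(Π) ⊗ W` with value `σ` at `1 ∈ Π^τ`. -/
def upLift (σ : ∀ p, W p) (p : Cover Φ) : L2tau τ ⊗[ℂ] W p :=
  ∑ᶠ η : Lattice T, delta τ η ⊗ₜ[ℂ] pull act (τ.lift η) σ p

lemma upLift_eq_sum (hact : IsTwistedAction act) {σ : ∀ p, W p} {p : Cover Φ} {F : Finset (Lattice T)}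
    (hF : ∀ η ∉ F, σ (p.deck η) = 0) :
    upLift act σ p = ∑ η ∈ F, delta τ η ⊗ₜ[ℂ] pull act (τ.lift η) σ p := by
  refine finsum_eq_sum_of_support_subset _ fun η hη => ?_
  by_contra h
  refine hη ?_
  dsimp only
  rw [(hact.pull_lift_eq_zero η σ p).2 (hF η h), TensorProduct.tmul_zero]

/-- The section `σ` has finite support on every orbit of `Π`. -/
def OrbitFinite (σ : ∀ p, W p) : Prop := ∀ p : Cover Φ, {η : Lattice T | σ (p.deck η) ≠ 0}.Finite

lemma OrbitFinite.of_isCompact {σ : ∀ p, W p} {K : Set (Cover Φ)} (hK : IsCompact K)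
    (hσ : ∀ p ∉ K, σ p = 0) : OrbitFinite σ := fun p => by
  refine (Cover.finite_deck isCompact_singleton hK (K := {p})).subset fun η hη => ⟨p, rfl, ?_⟩
  by_contra h
  exact hη (hσ _ h)

lemma ev_upLift (hact : IsTwistedAction act) {σ : ∀ p, W p} (hσ : OrbitFinite σ) (g : P) (p : Cover Φ) :
    ev τ g (upLift act σ p) = pull act g σ p := by
  classical
  have h1 : ∀ ζ : Lattice T, ev τ (τ.lift ζ) (upLift act σ p) = pull act (τ.lift ζ) σ p := fun ζ => by
    -- Adding ζ to the index set provides a ζ-term whether or not σ vanishes at ζp.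
    rw [upLift_eq_sum hact (F := (hσ p).toFinset ∪ {ζ}) (fun η hη => by
      simp only [Finset.mem_union, Set.Finite.mem_toFinset, not_or] at hη
      exact not_not.1 hη.1), map_sum, Finset.sum_eq_single ζ]
    · rw [ev_tmul, delta_apply, if_pos (τ.proj_lift ζ), τ.phase_lift]
      simp
    · intro η _ hη
      rw [ev_tmul, delta_apply, if_neg (by rw [τ.proj_lift]; exact hη.symm), zero_smul]
    · simp
  -- Both sides have the same equivariance under U(1), so comparing them at the chosen lifts was
  -- enough.
  rw [ev_eq_phase, h1, hact.pull_eq_phase g, Pi.smul_apply]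

/-- Evaluated at x, both sides are x⁻¹ applied to the value of σ at xgp. -/
lemma upLift_deck (hact : IsTwistedAction act) {σ : ∀ p, W p} (hσ : OrbitFinite σ) (g : P) (p : Cover Φ) :
    upLift act σ (p.deck (τ.proj g)) = TensorProduct.mapIsometry (rho τ g) (act g p) (upLift act σ p) :=
  ev_ext τ fun x => by
    rw [ev_mapIsometry_rho, ev_upLift hact hσ, ev_upLift hact hσ, hact.pull_mul, hact.act_pull]

/-- The section over `Y` of `(L²_τ(Π) ⊗ W)/Π` corresponding to the section `σ` of `W` over `𝒴`. -/
def descend (hact : IsTwistedAction act) {σ : ∀ p, W p} (hσ : OrbitFinite σ) (y : Y) : QFib τ act y :=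
  ⟨fun p => upLift act σ p.1, fun g p => upLift_deck hact hσ g p.1⟩

lemma upstairs_descend (hact : IsTwistedAction act) {σ : ∀ p, W p} (hσ : OrbitFinite σ) (p : Cover Φ) :
    upstairs (descend hact hσ) p = upLift act σ p := rfl

lemma sec_descend (hact : IsTwistedAction act) {σ : ∀ p, W p} (hσ : OrbitFinite σ) (p : Cover Φ) :
    sec (descend hact hσ) p = σ p := by
  rw [sec, upstairs_descend, ev_upLift hact hσ, hact.pull_one]

lemma contMDiffOn_smul_const {M F : Type*} [TopologicalSpace M] [ChartedSpace (Eu n) M] [NormedAddCommGroup F]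
    [NormedSpace ℂ F] {f : M → ℂ} {u : Set M} (hf : ContMDiffOn (𝓡 n) 𝓘(ℝ, ℂ) ∞ f u) (w : F) :
    ContMDiffOn (𝓡 n) 𝓘(ℝ, F) ∞ (fun x => f x • w) u := by
  have h : ContMDiff 𝓘(ℝ, ℂ) 𝓘(ℝ, F) ∞ fun c : ℂ => c • w :=
    (contDiff_id.smul contDiff_const).contMDiff
  exact h.comp_contMDiffOn hf

/-- One finite set of η moves a compact neighbourhood of a point into the support of σ. On that
neighbourhood the coefficients are finite sums of smooth scalar functions times fixed vectors `delta
τ η`. -/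
lemma qSmooth_descend (hact : IsTwistedAction act) {H : HermitianBundle n W}
    (hsm : ∀ g σ, H.SmoothOn σ Set.univ → H.SmoothOn (pull act g σ) Set.univ)
    {σ : ∀ p, W p} (hσ : OrbitFinite σ) {K : Set (Cover Φ)} (hK : IsCompact K) (hσK : ∀ p ∉ K, σ p = 0)
    (hσs : H.SmoothOn σ Set.univ) : QSmooth H (descend hact hσ) := by
  have : LocallyCompactSpace (Cover Φ) := ChartedSpace.locallyCompactSpace (Eu n) _
  intro p i x hx
  obtain ⟨N, hN, hxN⟩ := exists_compact_mem_nhds x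
  have hfin := Cover.finite_deck hN hK
  have hF : ∀ z ∈ N, ∀ η ∉ hfin.toFinset, σ (z.deck η) = 0 := fun z hz η hη => by
    rw [Set.Finite.mem_toFinset] at hη
    exact hσK _ fun h => hη ⟨z, hz, h⟩
  have h1 : ContMDiffOn (𝓡 n) 𝓘(ℝ, L2tau τ) ∞ (fun z => ∑ η ∈ hfin.toFinset,
      ⟪H.frame p i z, pull act (τ.lift η) σ z⟫_ℂ • delta τ η) (H.baseSet p) := by
    refine contMDiffOn_finsetSum fun η _ => contMDiffOn_smul_const ?_ _
    have := hsm (τ.lift η) σ hσs p i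
    rwa [Set.inter_univ] at this
  have h2 : (fun z => coeff (H.frame p i z) (upstairs (descend hact hσ) z)) =ᶠ[nhds x]
      fun z => ∑ η ∈ hfin.toFinset, ⟪H.frame p i z, pull act (τ.lift η) σ z⟫_ℂ • delta τ η := by
    filter_upwards [hxN] with z hz
    rw [upstairs_descend, upLift_eq_sum hact (hF z hz), map_sum]
    exact Finset.sum_congr rfl fun η _ => coeff_tmul _ _ _
  exact (h1 x hx).congr_of_eventuallyEq (h2.filter_mono nhdsWithin_le_nhds) h2.eq_of_nhds

variable [ChartedSpace (Eu n) Y] [IsSmoothCover n Φ] [T2Space Y] [MeasurableSpace Y] [BorelSpace Y]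
  [MeasurableSpace (Cover Φ)] [BorelSpace (Cover Φ)]
  {μY : Measure Y} [IsFiniteMeasureOnCompacts μY] {μ : Measure (Cover Φ)} [IsFiniteMeasureOnCompacts μ]
  {H : HermitianBundle n W}

lemma orbitFinite_cc (σ : H.Cc μ) : OrbitFinite (σ : ∀ p, W p) := by
  obtain ⟨K, hK, h⟩ := σ.2.2
  exact OrbitFinite.of_isCompact hK h

variable (μY μ) in
/-- The inverse of the unitary isomorphism `U` on smooth compactly supported sections. -/
def descendCc (hact : IsTwistedAction act)
    (hsm : ∀ g σ, H.SmoothOn σ Set.univ → H.SmoothOn (pull act g σ) Set.univ) :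
    H.Cc μ →ₗ[ℂ] QCc H τ act μY where
  toFun σ := ⟨descend hact (orbitFinite_cc σ), by
    obtain ⟨K, hK, h⟩ := σ.2.2
    refine ⟨qSmooth_descend hact hsm _ hK h σ.2.1, Cover.base '' K,
      hK.image Cover.continuous_base, fun y hy => eq_zero_of_sec hact fun p hp => ?_⟩
    rw [sec_descend]
    exact h p fun hpK => hy ⟨p, hpK, hp⟩⟩
  map_add' σ σ' := Subtype.ext (eq_of_sec_eq fun p => by
    refine (sec_descend hact (orbitFinite_cc (σ + σ')) p).trans ((sec_add (descend hact (orbitFinite_cc σ))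
      (descend hact (orbitFinite_cc σ')) p).trans ?_).symm
    rw [sec_descend, sec_descend]
    rfl)
  map_smul' c σ := Subtype.ext (eq_of_sec_eq fun p => by
    refine (sec_descend hact (orbitFinite_cc (c • σ)) p).trans
      ((sec_smul c (descend hact (orbitFinite_cc σ)) p).trans ?_).symm
    rw [sec_descend]
    rfl)

lemma sec_descendCc (hact : IsTwistedAction act)
    (hsm : ∀ g σ, H.SmoothOn σ Set.univ → H.SmoothOn (pull act g σ) Set.univ) (σ : H.Cc μ) (p : Cover Φ) :
    sec (descendCc μY μ hact hsm σ : ∀ y, QFib τ act y) p = σ p := sec_descend hact (orbitFinite_cc σ) p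

/-- By Parseval the pointwise inner product over Y is the fibre sum of the one over 𝒴, and
`integral_fiberSum` integrates it. -/
lemma inner_descendCc [IsManifold (𝓡 n) ∞ Y] [IsManifold (𝓡 n) ∞ (Cover Φ)] {g : Metric n Y}
    (hμY : IsRiemannianVolume g.form μY) (hμ : IsRiemannianVolume (g.lift Φ) μ)
    (hact : IsTwistedAction act)
    (hsm : ∀ g σ, H.SmoothOn σ Set.univ → H.SmoothOn (pull act g σ) Set.univ) (σ σ' : H.Cc μ) :
    ⟪descendCc μY μ hact hsm σ, descendCc μY μ hact hsm σ'⟫_ℂ = ⟪σ, σ'⟫_ℂ := by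
  obtain ⟨K, hK, hK'⟩ := σ.2.2
  refine Eq.trans ?_ (integral_fiberSum (n := n) hμY hμ (f := fun p => ⟪σ p, σ' p⟫_ℂ)
    (H.continuous_inner σ.2.1 σ'.2.1) hK fun p hp => by rw [hK' p hp, inner_zero_left])
  refine integral_congr_ae (Filter.Eventually.of_forall fun y => ?_)
  obtain ⟨p, rfl⟩ := Cover.base_surjective Φ y
  rw [qInner_base, fiberSum_base]
  have h1 := hasSum_inner_ev τ (upstairs (descendCc μY μ hact hsm σ : ∀ y, QFib τ act y) p)
    (upstairs (descendCc μY μ hact hsm σ' : ∀ y, QFib τ act y) p)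
  have h2 : ∀ η : Lattice T, ⟪ev τ (τ.lift η) (upstairs (descendCc μY μ hact hsm σ : ∀ y, QFib τ act y) p),
      ev τ (τ.lift η) (upstairs (descendCc μY μ hact hsm σ' : ∀ y, QFib τ act y) p)⟫_ℂ =
      ⟪σ (p.deck η), σ' (p.deck η)⟫_ℂ := fun η => by
    rw [ev_upstairs, ev_upstairs, hact.inner_pull_lift, sec_descendCc, sec_descendCc]
  simp only [h2] at h1
  have hfin := finite_support_deck hK (f := fun p => ⟪σ p, σ' p⟫_ℂ)
    (fun p hp => by rw [hK' p hp, inner_zero_left]) p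
  refine h1.unique ?_
  rw [finsum_eq_sum_of_support_subset _ (s := hfin.toFinset) (by simp)]
  exact hasSum_sum_of_ne_finset_zero fun η hη => by simpa using hη

lemma norm_descendCc [IsManifold (𝓡 n) ∞ Y] [IsManifold (𝓡 n) ∞ (Cover Φ)] {g : Metric n Y}
    (hμY : IsRiemannianVolume g.form μY) (hμ : IsRiemannianVolume (g.lift Φ) μ)
    (hact : IsTwistedAction act)
    (hsm : ∀ g σ, H.SmoothOn σ Set.univ → H.SmoothOn (pull act g σ) Set.univ) (σ : H.Cc μ) :
    ‖descendCc μY μ hact hsm σ‖ = ‖σ‖ := by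
  rw [norm_eq_sqrt_re_inner (𝕜 := ℂ), norm_eq_sqrt_re_inner (𝕜 := ℂ) σ,
    inner_descendCc hμY hμ hact hsm]

end Twisted

end PiCover

end

noncomputable section

namespace PiCover

/-! ### Truncation of sections over evenly covered sets -/

section Truncation

open MeasureTheory Filter Topology

variable {G : Type*} [Group G] [TopologicalSpace G] [IsTopologicalGroup G] {T : Subgroup G} [IsTorus T]
  {P : Type*} [Group P] {τ : CentralExtension T P}
  {n : ℕ} {Y : Type*} [TopologicalSpace Y] {Φ : Y → T} [ChartedSpace (Eu n) (Cover Φ)]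
  {W : Cover Φ → Type*} [∀ p, NormedAddCommGroup (W p)] [∀ p, InnerProductSpace ℂ (W p)]
  {act : ∀ (g : P) (p : Cover Φ), W p →ₗᵢ[ℂ] W (p.deck (τ.proj g))}

lemma HermitianBundle.smoothOn_univ_of_eventually {n : ℕ} {B : Type*} [TopologicalSpace B]
    [ChartedSpace (Eu n) B] {W : B → Type*} [∀ b, NormedAddCommGroup (W b)]
    [∀ b, InnerProductSpace ℂ (W b)] {H : HermitianBundle n W} {σ : ∀ b, W b}
    (h : ∀ x, ∃ σ', H.SmoothOn σ' Set.univ ∧ ∀ᶠ z in 𝓝 x, σ z = σ' z) : H.SmoothOn σ Set.univ := by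
  intro b i x hx
  obtain ⟨σ', hσ', he⟩ := h x
  have h1 : (fun z => ⟪H.frame b i z, σ z⟫_ℂ) =ᶠ[𝓝 x] fun z => ⟪H.frame b i z, σ' z⟫_ℂ := by
    filter_upwards [he] with z hz
    rw [hz]
  exact (hσ' b i x hx).congr_of_eventuallyEq (h1.filter_mono nhdsWithin_le_nhds) h1.eq_of_nhds

/-- The open set `V` is mapped injectively onto a neighbourhood of the compact set `K`. -/
structure IsSheetOver (V : Set (Cover Φ)) (K : Set Y) : Prop where
  isOpen : IsOpen V
  injOn : V.InjOn Cover.base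
  isCompact : IsCompact K
  subset : K ⊆ Cover.base '' V

open Classical in
/-- The restriction of the section `σ` to the translates `ηV`, `η ∈ F`. -/
def trunc (V : Set (Cover Φ)) (F : Finset (Lattice T)) (σ : ∀ p, W p) (p : Cover Φ) : W p :=
  if ∃ η ∈ F, p.deck η⁻¹ ∈ V then σ p else 0

/-- The translates of V are disjoint, as q is injective on V and Π acts freely; so the only
translate containing ηp is ηV. -/
lemma trunc_apply_deck {V : Set (Cover Φ)} (hV : V.InjOn Cover.base) (F : Finset (Lattice T)) (σ : ∀ p, W p)
    {p : Cover Φ} (hp : p ∈ V) (η : Lattice T) [Decidable (η ∈ F)] :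
    trunc V F σ (p.deck η) = if η ∈ F then σ (p.deck η) else 0 := by
  classical
  have : (∃ ζ ∈ F, (p.deck η).deck ζ⁻¹ ∈ V) ↔ η ∈ F := by
    constructor
    · rintro ⟨ζ, hζ, h⟩
      rw [← Cover.deck_mul] at h
      have h1 := hV h hp (Cover.base_deck _ _)
      have h2 := Cover.deck_injective p (h1.trans (Cover.deck_one p).symm)
      rw [inv_mul_eq_one] at h2
      rwa [← h2]
    · exact fun h => ⟨η, h, by rwa [Cover.deck_inv_deck]⟩
  rw [trunc]
  simp only [this]

lemma trunc_of_base_notMem {V : Set (Cover Φ)} {F : Finset (Lattice T)} {σ : ∀ p, W p} {K : Set Y}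
    (hσ : ∀ p : Cover Φ, p.base ∉ K → σ p = 0) {p : Cover Φ} (hp : p.base ∉ K) : trunc V F σ p = 0 := by
  rw [trunc, hσ p hp, ite_self]

/-- Locally, the truncation of a section over `K` is either the section or zero. -/
lemma trunc_eventually [T2Space Y] {V : Set (Cover Φ)} {K : Set Y} (h : IsSheetOver V K)
    (F : Finset (Lattice T)) (p : Cover Φ) :
    (∀ᶠ q in 𝓝 p, ∀ σ : ∀ p, W p, (∀ p : Cover Φ, p.base ∉ K → σ p = 0) → trunc V F σ q = σ q) ∨
    (∀ᶠ q in 𝓝 p, ∀ σ : ∀ p, W p, (∀ p : Cover Φ, p.base ∉ K → σ p = 0) → trunc V F σ q = 0) := by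
  classical
  -- The alternative and the neighbourhood depend on p, V, K and F but not on σ, so they serve a
  -- section and its image under an operator simultaneously.
  by_cases hp : p.base ∈ K
  · obtain ⟨p', hp', hb⟩ := h.subset hp
    obtain ⟨η, rfl⟩ := Cover.exists_deck hb
    have hnb : ∀ᶠ q in 𝓝 (p'.deck η), q.deck η⁻¹ ∈ V :=
      (Cover.continuous_deck η⁻¹).continuousAt.eventually
        (h.isOpen.mem_nhds (by
          change (p'.deck η).deck η⁻¹ ∈ V
          rwa [Cover.deck_inv_deck]))
    by_cases hη : η ∈ F
    · left
      filter_upwards [hnb] with q hq σ _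
      have := trunc_apply_deck h.injOn F σ hq η
      rwa [if_pos hη, Cover.deck_deck_inv] at this
    · right
      filter_upwards [hnb] with q hq σ _
      have := trunc_apply_deck h.injOn F σ hq η
      rwa [if_neg hη, Cover.deck_deck_inv] at this
  · right
    have hnb : ∀ᶠ q : Cover Φ in 𝓝 p, q.base ∉ K :=
      Cover.continuous_base.continuousAt.eventually (h.isCompact.isClosed.isOpen_compl.mem_nhds hp)
    filter_upwards [hnb] with q hq σ hσ
    exact trunc_of_base_notMem hσ hq

lemma trunc_smooth [T2Space Y] {H : HermitianBundle n W} {V : Set (Cover Φ)} {K : Set Y} (h : IsSheetOver V K)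
    (F : Finset (Lattice T)) {σ : ∀ p, W p} (hs : H.SmoothOn σ Set.univ)
    (hσ : ∀ p : Cover Φ, p.base ∉ K → σ p = 0) : H.SmoothOn (trunc V F σ) Set.univ := by
  refine HermitianBundle.smoothOn_univ_of_eventually fun x => ?_
  rcases trunc_eventually (W := W) h F x with h' | h'
  · exact ⟨σ, hs, h'.mono fun z hz => hz σ hσ⟩
  · exact ⟨0, H.ccSubmodule.zero_mem.1, h'.mono fun z hz => hz σ hσ⟩

/-- The support lies in finitely many translates of the compact set V ∩ q⁻¹(K). -/
lemma trunc_compact (n : ℕ) [ChartedSpace (Eu n) Y] [ChartedSpace (Eu n) (Cover Φ)] [IsSmoothCover n Φ]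
    {V : Set (Cover Φ)} {K : Set Y} (h : IsSheetOver V K)
    (F : Finset (Lattice T)) {σ : ∀ p, W p}
    (hσ : ∀ p : Cover Φ, p.base ∉ K → σ p = 0) : ∃ C : Set (Cover Φ), IsCompact C ∧ ∀ p ∉ C, trunc V F σ p = 0 := by
  classical
  refine ⟨⋃ η ∈ F, (fun p : Cover Φ => p.deck η) '' (V ∩ Cover.base ⁻¹' K),
    F.isCompact_biUnion fun η _ => (Cover.isCompact_sheet_inter n h.isOpen h.injOn h.isCompact h.subset).image
      (Cover.continuous_deck η), fun p hp => ?_⟩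
  by_cases hK : p.base ∈ K
  · rw [trunc, if_neg]
    rintro ⟨η, hη, hV⟩
    refine hp (Set.mem_biUnion hη ⟨p.deck η⁻¹, ⟨hV, hK⟩, Cover.deck_deck_inv η p⟩)
  · exact trunc_of_base_notMem hσ hK

variable [ChartedSpace (Eu n) Y] [IsSmoothCover n Φ] [T2Space Y]

section

variable [MeasurableSpace (Cover Φ)]

/-- The truncation as a smooth compactly supported section. -/
def truncCc (μ : Measure (Cover Φ)) {H : HermitianBundle n W} {V : Set (Cover Φ)} {K : Set Y}
    (h : IsSheetOver V K) (F : Finset (Lattice T)) {σ : ∀ p, W p} (hs : H.SmoothOn σ Set.univ)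
    (hσ : ∀ p : Cover Φ, p.base ∉ K → σ p = 0) : H.Cc μ :=
  ⟨trunc V F σ, trunc_smooth h F hs hσ, trunc_compact n h F hσ⟩

end

lemma hasSum_qInner (hact : IsTwistedAction act) (v w : ∀ y, QFib τ act y) (p : Cover Φ) :
    HasSum (fun η : Lattice T => ⟪sec v (p.deck η), sec w (p.deck η)⟫_ℂ) (qInner v w p.base) := by
  rw [qInner_base]
  refine Eq.mp (congrArg (fun f => HasSum f _) (funext fun η => ?_))
    (hasSum_inner_ev τ (upstairs v p) (upstairs w p))
  rw [ev_upstairs, ev_upstairs, hact.inner_pull_lift]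

/-- The truncations converge uniformly. -/
lemma eventually_qInner_le (hact : IsTwistedAction act) {H : HermitianBundle n W} {V : Set (Cover Φ)}
    {K : Set Y} (h : IsSheetOver V K) {w : ∀ y, QFib τ act y} (hw : QSmooth H w) {ε : ℝ} (hε : 0 < ε) :
    ∀ᶠ F in atTop, ∀ d : ∀ y, QFib τ act y, (∀ p, sec d p = trunc V F (sec w) p - sec w p) →
      ∀ y ∈ K, ‖qInner d d y‖ ≤ ε := by
  classical
  -- The part of the orbit sum of |sec w|² that lies outside F.
  let f : Finset (Lattice T) → Cover Φ → ℝ := fun F p =>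
    (qInner w w p.base).re - ∑ η ∈ F, ‖sec w (p.deck η)‖ ^ 2
  have hsq : ∀ {p : Cover Φ} (x : W p), ⟪x, x⟫_ℂ = ((‖x‖ ^ 2 : ℝ) : ℂ) := fun x => by
    rw [inner_self_eq_norm_sq_to_K]; norm_cast
  have hC : IsCompact (V ∩ Cover.base ⁻¹' K) :=
    Cover.isCompact_sheet_inter n h.isOpen h.injOn h.isCompact h.subset
  have hs : ∀ p : Cover Φ, HasSum (fun η : Lattice T => ‖sec w (p.deck η)‖ ^ 2) (qInner w w p.base).re := fun p => by
    have := Complex.reCLM.hasSum (hasSum_qInner hact w w p)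
    refine Eq.mp (congrArg (fun f => HasSum f _) (funext fun η => ?_)) this
    simp only [hsq, Complex.reCLM_apply, Complex.ofReal_re]
  have hcont : ∀ F, Continuous (f F) := fun F => by
    refine ((Complex.continuous_re.comp (continuous_qInner H hw hw)).comp Cover.continuous_base).sub
      (continuous_finsetSum _ fun η _ => ?_)
    have h1 := (H.continuous_inner (smoothOn_sec hw) (smoothOn_sec hw)).comp (Cover.continuous_deck η)
    refine (Complex.continuous_re.comp h1).congr fun p => ?_
    simp only [Function.comp_apply, hsq, Complex.ofReal_re]
  have hlim : ∀ p, Tendsto (fun F => f F p) atTop (𝓝 0) := fun p => by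
    have := (tendsto_const_nhds (x := (qInner w w p.base).re)).sub (hs p)
    rwa [sub_self] at this
  have hanti : ∀ p, Antitone fun F => f F p := fun p F F' hF =>
    sub_le_sub_left (Finset.sum_le_sum_of_subset_of_nonneg hF fun _ _ _ => sq_nonneg _) _
  -- Dini: on a compact set these tails are continuous, decrease with F and tend to zero pointwise.
  -- Their continuity rests on `continuous_qInner`.
  have hunif := Antitone.tendstoUniformlyOn_of_forall_tendsto hC (fun F => (hcont F).continuousOn)
    (fun p _ => hanti p) (continuousOn_const (c := (0 : ℝ))) fun p _ => hlim p
  filter_upwards [Metric.tendstoUniformlyOn_iff.1 hunif ε hε] with F hF d hd y hy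
  obtain ⟨p, hp, rfl⟩ := h.subset hy
  have h1 := hF p ⟨hp, hy⟩
  have h2 : HasSum (fun η : Lattice T => ⟪sec d (p.deck η), sec d (p.deck η)⟫_ℂ) ((f F p : ℝ) : ℂ) := by
    have h3 : HasSum (fun η : Lattice T => if η ∈ F then ‖sec w (p.deck η)‖ ^ 2 else 0)
        (∑ η ∈ F, ‖sec w (p.deck η)‖ ^ 2) := by
      have : HasSum (fun η : Lattice T => if η ∈ F then ‖sec w (p.deck η)‖ ^ 2 else 0)
          (∑ η ∈ F, if η ∈ F then ‖sec w (p.deck η)‖ ^ 2 else 0) :=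
        hasSum_sum_of_ne_finset_zero fun η hη => if_neg hη
      rwa [Finset.sum_congr rfl fun η hη => if_pos hη] at this
    refine Eq.mp (congrArg (fun f => HasSum f _) (funext fun η => ?_)) (Complex.ofRealCLM.hasSum ((hs p).sub h3))
    simp only [Complex.ofRealCLM_apply, hsq]
    congr 1
    rw [hd, trunc_apply_deck h.injOn F _ hp]
    split_ifs <;> simp
  rw [(hasSum_qInner hact d d p).unique h2, Complex.norm_real]
  rw [dist_zero_left] at h1
  exact h1.le

variable [MeasurableSpace Y] [BorelSpace Y] [MeasurableSpace (Cover Φ)] [BorelSpace (Cover Φ)]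
  {μY : Measure Y} [IsFiniteMeasureOnCompacts μY] {μ : Measure (Cover Φ)} [IsFiniteMeasureOnCompacts μ]
  {H : HermitianBundle n W}

/-- The uniform estimate over K becomes an L² estimate because K has finite measure. -/
lemma tendsto_descendCc_truncCc (hact : IsTwistedAction act)
    (hsm : ∀ g σ, H.SmoothOn σ Set.univ → H.SmoothOn (pull act g σ) Set.univ)
    {V : Set (Cover Φ)} {K : Set Y} (h : IsSheetOver V K) (w : QCc H τ act μY)
    (hw : ∀ p : Cover Φ, p.base ∉ K → sec (w : ∀ y, QFib τ act y) p = 0) :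
    Tendsto (fun F => descendCc μY μ hact hsm (truncCc μ h F (smoothOn_sec w.2.1) hw)) atTop (𝓝 w) := by
  rw [Metric.tendsto_nhds]
  intro ε hε
  -- This bound times μY(K) is less than ε²; the summand 1 keeps the denominator positive when K is
  -- a null set.
  have hδ : 0 < ε ^ 2 / (2 * (μY.real K + 1)) := by positivity
  filter_upwards [eventually_qInner_le hact h w.2.1 hδ] with F hF
  set d : QCc H τ act μY := descendCc μY μ hact hsm (truncCc μ h F (smoothOn_sec w.2.1) hw) - w with hd
  have hsec : ∀ p, sec (d : ∀ y, QFib τ act y) p = trunc V F (sec (w : ∀ y, QFib τ act y)) p - sec (w : ∀ y, QFib τ act y) p := fun p => by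
    refine (sec_sub _ _ p).trans ?_
    rw [sec_descendCc]
    rfl
  have h0 : ∀ y ∉ K, qInner (d : ∀ y, QFib τ act y) d y = 0 := fun y hy => by
    have : (d : ∀ y, QFib τ act y) y = 0 := eq_zero_of_sec hact fun p hp => by
      subst hp
      rw [hsec, hw p hy, trunc_of_base_notMem hw hy, sub_zero]
    rw [qInner, this]
    exact inner_zero_left _
  have hn : ‖d‖ ^ 2 ≤ ε ^ 2 / (2 * (μY.real K + 1)) * μY.real K := by
    rw [norm_sq_eq_re_inner (𝕜 := ℂ)]
    refine (Complex.re_le_norm _).trans ?_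
    change ‖∫ y, qInner (d : ∀ y, QFib τ act y) d y ∂μY‖ ≤ _
    rw [← setIntegral_eq_integral_of_forall_compl_eq_zero h0]
    exact norm_setIntegral_le_of_norm_le_const h.isCompact.measure_lt_top (hF d hsec)
  rw [dist_eq_norm]
  refine lt_of_pow_lt_pow_left₀ 2 hε.le (hn.trans_lt ?_)
  have hK : 0 ≤ μY.real K := measureReal_nonneg
  rw [div_mul_eq_mul_div, div_lt_iff₀ (by positivity)]
  nlinarith [pow_pos hε 2]

/-- If a pair of sections over `Y` is supported over sheets, and the truncations are related, then the pair
is a limit of pairs of related compactly supported sections over `𝒴`. -/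
lemma mem_closure_of_trunc (hact : IsTwistedAction act)
    (hsm : ∀ g σ, H.SmoothOn σ Set.univ → H.SmoothOn (pull act g σ) Set.univ)
    {R : (∀ p, W p) → (∀ p, W p) → Prop} {V V' : Set (Cover Φ)} {K K' : Set Y} (h : IsSheetOver V K)
    (h' : IsSheetOver V' K') {w w' : QCc H τ act μY}
    (hw : ∀ p : Cover Φ, p.base ∉ K → sec (w : ∀ y, QFib τ act y) p = 0)
    (hw' : ∀ p : Cover Φ, p.base ∉ K' → sec (w' : ∀ y, QFib τ act y) p = 0) (e : Lattice T ≃ Lattice T)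
    (hR : ∀ F : Finset (Lattice T), R (trunc V F (sec (w : ∀ y, QFib τ act y)))
      (trunc V' (F.map e.toEmbedding) (sec (w' : ∀ y, QFib τ act y)))) :
    (w, w') ∈ closure {x : QCc H τ act μY × QCc H τ act μY | ∃ σ σ' : H.Cc μ, R σ σ' ∧
      x = (descendCc μY μ hact hsm σ, descendCc μY μ hact hsm σ')} := by
  have h1 := tendsto_descendCc_truncCc (μ := μ) hact hsm h w hw
  have h2 := tendsto_descendCc_truncCc (μ := μ) hact hsm h' w' hw'
  -- A bijection of Π carries the filter of growing finite sets to itself, so the second section may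
  -- be truncated to the indices e(F). Translations by N(T) move the sheets in this way.
  have he : Tendsto (fun F : Finset (Lattice T) => F.map e.toEmbedding) atTop atTop :=
    (Finset.mapEmbedding e.toEmbedding).monotone.tendsto_atTop_atTop fun F => ⟨F.map e.symm.toEmbedding, by
      change F ≤ (F.map e.symm.toEmbedding).map e.toEmbedding
      rw [Finset.map_map]
      simp⟩
  refine mem_closure_of_tendsto (h1.prodMk_nhds (h2.comp he)) (Eventually.of_forall fun F => ?_)
  exact ⟨_, _, hR F, rfl⟩

end Truncation

end PiCover

end

noncomputable section

namespace PiCover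

/-! ### The unitary isomorphism -/

section Unitary

open MeasureTheory Filter Topology

variable {G : Type*} [Group G] [TopologicalSpace G] [IsTopologicalGroup G] {T : Subgroup G} [IsTorus T]
  {P : Type*} [Group P] {τ : CentralExtension T P}
  {n : ℕ} {Y : Type*} [TopologicalSpace Y] {Φ : Y → T} [ChartedSpace (Eu n) (Cover Φ)]
  {W : Cover Φ → Type*} [∀ p, NormedAddCommGroup (W p)] [∀ p, InnerProductSpace ℂ (W p)]
  {act : ∀ (g : P) (p : Cover Φ), W p →ₗᵢ[ℂ] W (p.deck (τ.proj g))}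
  [ChartedSpace (Eu n) Y] [IsSmoothCover n Φ] [T2Space Y]

variable (n) in
/-- A smooth partition of unity near a compact set, subordinate to a cover by evenly covered sets. -/
lemma exists_partition [SecondCountableTopology Y] [IsManifold (𝓡 n) ∞ Y] {K : Set Y} (hK : IsCompact K) :
    ∃ (m : ℕ) (V : Fin m → Set (Cover Φ)) (ψ : Fin m → Y → ℝ),
      (∀ i, IsSheetOver (V i) (K ∩ tsupport (ψ i))) ∧
      (∀ i, ContMDiff (𝓡 n) 𝓘(ℝ, ℝ) ∞ (ψ i)) ∧
      ∀ y ∈ K, ∀ᶠ z in 𝓝 y, ∑ i, ψ i z = 1 := by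
  have : LocallyCompactSpace Y := ChartedSpace.locallyCompactSpace (Eu n) _
  -- The functions must have sum 1 on a neighbourhood of K, so that their differentials cancel on K;
  -- hence the larger compact set.
  obtain ⟨K', hK', hKK'⟩ := exists_compact_superset hK
  choose p hp using Cover.base_surjective Φ
  choose V hVo hVp hVi using fun y => Cover.exists_sheet n (p y)
  have hbV : ∀ y, IsOpen (Cover.base '' V y) := fun y => Cover.isOpenMap_base n _ (hVo y)
  obtain ⟨t, -, ht⟩ := hK'.elim_nhds_subcover (fun y => Cover.base '' V y)
    fun y _ => (hbV y).mem_nhds ⟨p y, hVp y, hp y⟩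
  let enum := t.equivFin.symm
  obtain ⟨ρ, hρ⟩ := SmoothPartitionOfUnity.exists_isSubordinate (𝓡 n) hK'.isClosed
    (fun i => Cover.base '' V (enum i)) (fun i => hbV _) (ht.trans (by
      intro x hx
      simp only [Set.mem_iUnion] at hx ⊢
      obtain ⟨i, hi, hx⟩ := hx
      exact ⟨t.equivFin ⟨i, hi⟩, by simpa [enum] using hx⟩))
  refine ⟨_, fun i => V (enum i), fun i => ρ i, fun i => ⟨hVo _, hVi _,
    hK.inter_right (isClosed_tsupport _), Set.inter_subset_right.trans (hρ i)⟩, fun i => (ρ i).contMDiff,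
    fun y hy => ?_⟩
  filter_upwards [mem_interior_iff_mem_nhds.1 (hKK' hy)] with z hz
  have := ρ.sum_eq_one hz
  rwa [finsum_eq_sum_of_fintype] at this

variable [MeasurableSpace Y] [BorelSpace Y] [MeasurableSpace (Cover Φ)] [BorelSpace (Cover Φ)]
  {μY : Measure Y} [IsFiniteMeasureOnCompacts μY] {μ : Measure (Cover Φ)} [IsFiniteMeasureOnCompacts μ]
  {H : HermitianBundle n W}

/-- The product of a section over `Y` with a smooth real function. -/
def QCc.mul {ψ : Y → ℝ} (hψ : ContMDiff (𝓡 n) 𝓘(ℝ, ℝ) ∞ ψ) (v : QCc H τ act μY) : QCc H τ act μY :=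
  ⟨fun y => (ψ y : ℂ) • v y, by
    obtain ⟨K, hK, h⟩ := v.2.2
    refine ⟨fun p i => ?_, K, hK, fun y hy => by simp only [h y hy, smul_zero]⟩
    have h1 := (v.2.1 p i)
    have h2 : ContMDiffOn (𝓡 n) 𝓘(ℝ, ℝ) ∞ (fun x : Cover Φ => ψ x.base) (H.baseSet p) :=
      (hψ.comp (contMDiff_base n Φ)).contMDiffOn
    refine (h2.smul h1).congr fun x _ => ?_
    change coeff _ ((ψ x.base : ℂ) • upstairs (v : ∀ y, QFib τ act y) x) = _
    rw [map_smul]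
    rfl⟩

lemma QCc.upstairs_mul {ψ : Y → ℝ} (hψ : ContMDiff (𝓡 n) 𝓘(ℝ, ℝ) ∞ ψ) (v : QCc H τ act μY) (p : Cover Φ) :
    upstairs (QCc.mul hψ v : ∀ y, QFib τ act y) p = (ψ p.base : ℂ) • upstairs (v : ∀ y, QFib τ act y) p := rfl

lemma QCc.sec_mul {ψ : Y → ℝ} (hψ : ContMDiff (𝓡 n) 𝓘(ℝ, ℝ) ∞ ψ) (v : QCc H τ act μY) (p : Cover Φ) :
    sec (QCc.mul hψ v : ∀ y, QFib τ act y) p = (ψ p.base : ℂ) • sec (v : ∀ y, QFib τ act y) p := by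
  rw [sec, QCc.upstairs_mul, map_smul]; rfl

lemma QCc.sec_sum {ι : Type*} (s : Finset ι) (v : ι → QCc H τ act μY) (p : Cover Φ) :
    sec ((∑ i ∈ s, v i : QCc H τ act μY) : ∀ y, QFib τ act y) p = ∑ i ∈ s, sec (v i : ∀ y, QFib τ act y) p := by
  let f : QCc H τ act μY →+ W p := AddMonoidHom.mk' (fun v => sec (v : ∀ y, QFib τ act y) p)
    fun v w => sec_add _ _ p
  exact map_sum f v s

lemma QCc.ext {v w : QCc H τ act μY}
    (h : ∀ p, sec (v : ∀ y, QFib τ act y) p = sec (w : ∀ y, QFib τ act y) p) : v = w :=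
  Subtype.ext (eq_of_sec_eq h)

variable (μY μ) in
/-- The closure of the graph of an operator on compactly supported sections over `𝒴`, as pairs of
sections over `Y`. -/
def graphClosure (hact : IsTwistedAction act)
    (hsm : ∀ g σ, H.SmoothOn σ Set.univ → H.SmoothOn (pull act g σ) Set.univ)
    (R : (∀ p, W p) → (∀ p, W p) → Prop) : Set (QCc H τ act μY × QCc H τ act μY) :=
  closure {x | ∃ σ σ' : H.Cc μ, R σ σ' ∧ x = (descendCc μY μ hact hsm σ, descendCc μY μ hact hsm σ')}

/-- By `h0` and `hadd` the graph is an additive submonoid of the product, and the closure of a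
submonoid is one too. -/
lemma sum_mem_graphClosure (hact : IsTwistedAction act)
    (hsm : ∀ g σ, H.SmoothOn σ Set.univ → H.SmoothOn (pull act g σ) Set.univ)
    {R : (∀ p, W p) → (∀ p, W p) → Prop} (h0 : R 0 0)
    (hadd : ∀ σ₁ σ₁' σ₂ σ₂' : H.Cc μ, R σ₁ σ₁' → R σ₂ σ₂' → R (σ₁ + σ₂ : H.Cc μ) (σ₁' + σ₂' : H.Cc μ)) {ι : Type*} {s : Finset ι}
    {w w' : ι → QCc H τ act μY} (h : ∀ i ∈ s, (w i, w' i) ∈ graphClosure μY μ hact hsm R) :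
    (∑ i ∈ s, w i, ∑ i ∈ s, w' i) ∈ graphClosure μY μ hact hsm R := by
  let A : AddSubmonoid (QCc H τ act μY × QCc H τ act μY) :=
    { carrier := {x | ∃ σ σ' : H.Cc μ, R σ σ' ∧
        x = (descendCc μY μ hact hsm σ, descendCc μY μ hact hsm σ')}
      zero_mem' := ⟨0, 0, h0, by rw [map_zero]; rfl⟩
      add_mem' := by
        rintro _ _ ⟨σ₁, σ₁', h1, rfl⟩ ⟨σ₂, σ₂', h2, rfl⟩
        exact ⟨_, _, hadd _ _ _ _ h1 h2, by rw [map_add, map_add]; rfl⟩ }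
  have := sum_mem (S := A.topologicalClosure) (t := s) (f := fun i => (w i, w' i)) h
  have h2 : ∑ i ∈ s, (w i, w' i) = (∑ i ∈ s, w i, ∑ i ∈ s, w' i) :=
    Prod.ext (Prod.fst_sum ..) (Prod.snd_sum ..)
  rwa [h2] at this

/-- Density is the case in which the relation is equality: approximating (v, v) by pairs of
descended sections approximates v. -/
lemma denseRange_descendCc [SecondCountableTopology Y] [IsManifold (𝓡 n) ∞ Y] (hact : IsTwistedAction act)
    (hsm : ∀ g σ, H.SmoothOn σ Set.univ → H.SmoothOn (pull act g σ) Set.univ) :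
    DenseRange (descendCc μY μ hact hsm) := by
  intro v
  obtain ⟨K, hK, hv⟩ := v.2.2
  obtain ⟨m, V, ψ, hV, hψ, h1⟩ := exists_partition n (Φ := Φ) hK
  have hsum : v = ∑ i, QCc.mul (hψ i) v := QCc.ext fun p => by
    rw [QCc.sec_sum]
    simp only [QCc.sec_mul]
    rw [← Finset.sum_smul]
    by_cases hp : p.base ∈ K
    · rw [← Complex.ofReal_sum, (h1 _ hp).self_of_nhds, Complex.ofReal_one, one_smul]
    · rw [sec_eq_zero (hv _ hp), smul_zero]
  have hz : ∀ i, ∀ p : Cover Φ, p.base ∉ K ∩ tsupport (ψ i) →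
      sec (QCc.mul (hψ i) v : ∀ y, QFib τ act y) p = 0 := fun i p hp => by
    rw [QCc.sec_mul]
    by_cases hpK : p.base ∈ K
    · rw [image_eq_zero_of_notMem_tsupport fun h => hp ⟨hpK, h⟩, Complex.ofReal_zero, zero_smul]
    · rw [sec_eq_zero (hv _ hpK), smul_zero]
  have h2 : (v, v) ∈ graphClosure μY μ hact hsm Eq := by
    rw [hsum]
    refine sum_mem_graphClosure (μ := μ) hact hsm rfl ?_ fun i _ => mem_closure_of_trunc (μ := μ) hact hsm (hV i) (hV i) (hz i) (hz i) (Equiv.refl _) ?_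
    · intro σ₁ σ₁' σ₂ σ₂' h1 h2
      rw [Subtype.ext h1, Subtype.ext h2]
    · intro F
      simp
  refine closure_mono ?_ (image_closure_subset_closure_image continuous_fst ⟨_, h2, rfl⟩)
  rintro _ ⟨_, ⟨σ, σ', -, rfl⟩, rfl⟩
  exact ⟨σ, rfl⟩

/-- The unitary isomorphism, together with a criterion for the correspondence of operators. -/
lemma exists_unitary [SecondCountableTopology Y] [IsManifold (𝓡 n) ∞ Y] [IsManifold (𝓡 n) ∞ (Cover Φ)]
    {g : Metric n Y} (hμY : IsRiemannianVolume g.form μY) (hμ : IsRiemannianVolume (g.lift Φ) μ)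
    (hact : IsTwistedAction act)
    (hsm : ∀ g σ, H.SmoothOn σ Set.univ → H.SmoothOn (pull act g σ) Set.univ) :
    ∃ U : QL2 τ act H μY ≃ₗᵢ[ℂ] H.L2 μ, (∀ σ : H.Cc μ, U ↑(descendCc μY μ hact hsm σ) = ↑σ) ∧
      ∀ (R₁ : (∀ y, QFib τ act y) → (∀ y, QFib τ act y) → Prop) (R₂ : (∀ p, W p) → (∀ p, W p) → Prop),
        (∀ v v' : QCc H τ act μY, R₂ (sec (v : ∀ y, QFib τ act y)) (sec (v' : ∀ y, QFib τ act y)) → R₁ v v') →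
        (∀ v v' : QCc H τ act μY, R₁ v v' → (v, v') ∈ graphClosure μY μ hact hsm R₂) →
        Corresponds U R₁ R₂ := by
  let e₁ : H.Cc μ →ₗ[ℂ] QL2 τ act H μY :=
    (UniformSpace.Completion.toComplₗᵢ (𝕜 := ℂ) (E := QCc H τ act μY)).toLinearMap ∘ₗ descendCc μY μ hact hsm
  let e₂ : H.Cc μ →ₗ[ℂ] H.L2 μ := (UniformSpace.Completion.toComplₗᵢ (𝕜 := ℂ) (E := H.Cc μ)).toLinearMap
  have hd₁ : DenseRange e₁ :=
    UniformSpace.Completion.denseRange_coe.comp (denseRange_descendCc hact hsm)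
      (UniformSpace.Completion.continuous_coe _)
  have hd₂ : DenseRange e₂ := UniformSpace.Completion.denseRange_coe
  have hn : ∀ x, ‖e₂ (LinearEquiv.refl ℂ (H.Cc μ) x)‖ = ‖e₁ x‖ := fun x => by
    change ‖(x : H.L2 μ)‖ = ‖((descendCc μY μ hact hsm x : QCc H τ act μY) : QL2 τ act H μY)‖
    rw [UniformSpace.Completion.norm_coe, UniformSpace.Completion.norm_coe, norm_descendCc hμY hμ]
  -- The compactly supported sections over 𝒴 are dense in both completions, in the first through
  -- `descendCc`, and have the same norm in both. U extends the identity on them.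
  let U := (LinearEquiv.refl ℂ (H.Cc μ)).extendOfIsometry e₁ e₂ hd₁ hd₂ hn
  have hU : ∀ σ : H.Cc μ, U ↑(descendCc μY μ hact hsm σ) = ↑σ := fun σ =>
    LinearEquiv.extendOfIsometry_eq _ _ _ hd₁ hd₂ hn σ
  refine ⟨U, hU, fun R₁ R₂ h1 h2 => ?_⟩
  let Θ : QL2 τ act H μY × QL2 τ act H μY ≃ₜ H.L2 μ × H.L2 μ :=
    U.toHomeomorph.prodCongr U.toHomeomorph
  change Θ '' closure _ = _
  rw [Θ.image_closure]
  apply subset_antisymm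
  -- The harder inclusion: v and v' need not descend from compactly supported sections over 𝒴, so by
  -- `h2` the pair is only a limit of such pairs; continuity of U × U then suffices.
  · refine closure_minimal ?_ isClosed_closure
    rintro _ ⟨_, ⟨v, v', hv, rfl⟩, rfl⟩
    have hc : Continuous fun x : QCc H τ act μY × QCc H τ act μY =>
        Θ ((x.1 : QL2 τ act H μY), (x.2 : QL2 τ act H μY)) :=
      Θ.continuous.comp (((UniformSpace.Completion.continuous_coe _).comp continuous_fst).prodMk
        ((UniformSpace.Completion.continuous_coe _).comp continuous_snd))
    refine map_mem_closure (f := fun x : QCc H τ act μY × QCc H τ act μY =>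
      Θ ((x.1 : QL2 τ act H μY), (x.2 : QL2 τ act H μY))) hc (h2 v v' hv) ?_
    rintro _ ⟨σ, σ', hσ, rfl⟩
    exact ⟨σ, σ', hσ, Prod.ext (hU σ) (hU σ')⟩
  -- Here the graphs themselves are contained in one another, since `descendCc` produces compactly
  -- supported sections over Y.
  · refine closure_mono ?_
    rintro _ ⟨σ, σ', hσ, rfl⟩
    refine ⟨_, ⟨descendCc μY μ hact hsm σ, descendCc μY μ hact hsm σ', h1 _ _ ?_, rfl⟩,
      Prod.ext (hU σ) (hU σ')⟩
    rwa [funext (sec_descendCc hact hsm σ), funext (sec_descendCc hact hsm σ')]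

end Unitary

end PiCover

end

noncomputable section

namespace PiCover

/-! ### Derivatives of vector valued functions -/

section Derivative

open Filter Topology

variable {n : ℕ} {B : Type*} [TopologicalSpace B] [ChartedSpace (Eu n) B]
  {B' : Type*} [TopologicalSpace B'] [ChartedSpace (Eu n) B']
  {F : Type*} [NormedAddCommGroup F] [NormedSpace ℝ F] {F' : Type*} [NormedAddCommGroup F'] [NormedSpace ℝ F']

/-- The derivative of a vector valued function at `x` in the direction `v`. -/
def dAt (f : B → F) (x : B) (v : TangentSpace (𝓡 n) x) : F := mfderiv (𝓡 n) 𝓘(ℝ, F) f x v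

lemma dAt_congr {f f' : B → F} {x : B} (h : f =ᶠ[𝓝 x] f') (v : TangentSpace (𝓡 n) x) :
    dAt f x v = dAt f' x v := by
  have h1 : (mfderiv (𝓡 n) 𝓘(ℝ, F) f x : Eu n →L[ℝ] F) = mfderiv (𝓡 n) 𝓘(ℝ, F) f' x := h.mfderiv_eq
  exact DFunLike.congr_fun h1 v

lemma dAt_const (c : F) (x : B) (v : TangentSpace (𝓡 n) x) : dAt (fun _ : B => c) x v = 0 := by
  have h1 : (mfderiv (𝓡 n) 𝓘(ℝ, F) (fun _ : B => c) x : Eu n →L[ℝ] F) = 0 := mfderiv_const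
  exact DFunLike.congr_fun h1 v

lemma dAt_map_add (f : B → F) (x : B) (v w : TangentSpace (𝓡 n) x) : dAt f x (v + w) = dAt f x v + dAt f x w :=
  map_add (mfderiv (𝓡 n) 𝓘(ℝ, F) f x) v w

lemma dAt_map_smul (f : B → F) (x : B) (r : ℝ) (v : TangentSpace (𝓡 n) x) :
    dAt f x (r • v) = r • dAt f x v :=
  map_smul (mfderiv (𝓡 n) 𝓘(ℝ, F) f x) r v

lemma dAt_add {f f' : B → F} {x : B} (hf : MDifferentiableAt (𝓡 n) 𝓘(ℝ, F) f x)
    (hf' : MDifferentiableAt (𝓡 n) 𝓘(ℝ, F) f' x) (v : TangentSpace (𝓡 n) x) :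
    dAt (fun y => f y + f' y) x v = dAt f x v + dAt f' x v :=
  DFunLike.congr_fun (mfderiv_add hf hf') v

lemma dAt_sum {ι : Type} {s : Finset ι} {f : ι → B → F} {x : B}
    (hf : ∀ i ∈ s, MDifferentiableAt (𝓡 n) 𝓘(ℝ, F) (f i) x) (v : TangentSpace (𝓡 n) x) :
    dAt (fun y => ∑ i ∈ s, f i y) x v = ∑ i ∈ s, dAt (f i) x v := by
  classical
  have h : HasMFDerivAt (𝓡 n) 𝓘(ℝ, F) (∑ i ∈ s, f i) x
      (∑ i ∈ s, (mfderiv (𝓡 n) 𝓘(ℝ, F) (f i) x : TangentSpace (𝓡 n) x →L[ℝ] F)) :=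
    HasMFDerivAt.sum fun i hi => (hf i hi).hasMFDerivAt
  have h3 : (fun y => ∑ i ∈ s, f i y) = ∑ i ∈ s, f i := by
    funext y
    simp
  have h2 := h.mfderiv
  rw [← h3] at h2
  refine (DFunLike.congr_fun h2 v).trans ?_
  exact _root_.sum_apply _ _ _

lemma dAt_mul {f f' : B → ℂ} {x : B} (hf : MDifferentiableAt (𝓡 n) 𝓘(ℝ, ℂ) f x)
    (hf' : MDifferentiableAt (𝓡 n) 𝓘(ℝ, ℂ) f' x) (v : TangentSpace (𝓡 n) x) :
    dAt (fun y => f y * f' y) x v = dAt f x v * f' x + f x * dAt f' x v := by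
  have h := (hf.hasMFDerivAt.mul hf'.hasMFDerivAt).mfderiv
  refine (DFunLike.congr_fun h v).trans ?_
  change f x * dAt f' x v + f' x * dAt f x v = _
  ring

lemma dAt_clm (L : F →L[ℝ] F') {f : B → F} {x : B} (hf : MDifferentiableAt (𝓡 n) 𝓘(ℝ, F) f x)
    (v : TangentSpace (𝓡 n) x) : dAt (fun y => L (f y)) x v = L (dAt f x v) := by
  have h := mfderiv_comp x (L.mdifferentiableAt (x := f x)) hf
  refine (DFunLike.congr_fun h v).trans ?_
  have h2 : (mfderiv 𝓘(ℝ, F) 𝓘(ℝ, F') L (f x) : F →L[ℝ] F') = L := by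
    rw [mfderiv_eq_fderiv]; exact L.fderiv
  exact DFunLike.congr_fun h2 _

lemma dAt_comp {f : B → F} {q : B' → B} {x : B'} (hf : MDifferentiableAt (𝓡 n) 𝓘(ℝ, F) f (q x))
    (hq : MDifferentiableAt (𝓡 n) (𝓡 n) q x) (v : TangentSpace (𝓡 n) x) :
    dAt (fun y => f (q y)) x v = dAt f (q x) (mfderiv (𝓡 n) (𝓡 n) q x v) :=
  DFunLike.congr_fun (mfderiv_comp x hf hq) v

lemma contMDiffOn_mul {f f' : B → ℂ} {u : Set B} (hf : ContMDiffOn (𝓡 n) 𝓘(ℝ, ℂ) ∞ f u)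
    (hf' : ContMDiffOn (𝓡 n) 𝓘(ℝ, ℂ) ∞ f' u) : ContMDiffOn (𝓡 n) 𝓘(ℝ, ℂ) ∞ (fun x => f x * f' x) u := by
  have h3 : ContMDiff 𝓘(ℝ, ℂ × ℂ) 𝓘(ℝ, ℂ) ∞ fun w : ℂ × ℂ => w.1 * w.2 := contDiff_mul.contMDiff
  exact h3.comp_contMDiffOn (hf.prodMk_space hf')

lemma contMDiff_ofReal : ContMDiff 𝓘(ℝ, ℝ) 𝓘(ℝ, ℂ) ∞ (fun r : ℝ => (r : ℂ)) :=
  Complex.ofRealCLM.contDiff.contMDiff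

end Derivative

/-! ### Smooth sections and connections -/

section Sections

open Filter Topology

variable {n : ℕ} {B : Type*} [TopologicalSpace B] [ChartedSpace (Eu n) B]
  {W : B → Type*} [∀ b, NormedAddCommGroup (W b)] [∀ b, InnerProductSpace ℂ (W b)]

namespace HermitianBundle

variable {H : HermitianBundle n W}

lemma SmoothOn.mono {σ : ∀ b, W b} {u u' : Set B} (h : H.SmoothOn σ u) (hu : u' ⊆ u) : H.SmoothOn σ u' :=
  fun b i => (h b i).mono (Set.inter_subset_inter_right _ hu)

lemma SmoothOn.congr {σ σ' : ∀ b, W b} {u : Set B} (h : H.SmoothOn σ u) (hu : ∀ x ∈ u, σ' x = σ x) :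
    H.SmoothOn σ' u :=
  fun b i => (h b i).congr fun x hx => by rw [hu x hx.2]

lemma SmoothOn.sum {ι : Type*} {s : Finset ι} {σ : ι → ∀ b, W b} {u : Set B}
    (h : ∀ i ∈ s, H.SmoothOn (σ i) u) : H.SmoothOn (fun x => ∑ i ∈ s, σ i x) u :=
  fun b i => (contMDiffOn_finsetSum fun k hk => h k hk b i).congr fun x _ => inner_sum _ _ _

lemma SmoothOn.smul {f : B → ℂ} {σ : ∀ b, W b} {u : Set B} (hf : ContMDiffOn (𝓡 n) 𝓘(ℝ, ℂ) ∞ f u)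
    (h : H.SmoothOn σ u) : H.SmoothOn (fun x => f x • σ x) u :=
  fun b i => (contMDiffOn_mul (hf.mono Set.inter_subset_right) (h b i)).congr fun x _ => inner_smul_right _ _ _

lemma smoothOn_frame (b : B) (i : H.idx b) : H.SmoothOn (H.frame b i) (H.baseSet b) :=
  fun b' j => H.smooth b' b j i

lemma sum_inner_smul_frame (σ : ∀ b, W b) {b x : B} (hx : x ∈ H.baseSet b) :
    ∑ i, ⟪H.frame b i x, σ x⟫_ℂ • H.frame b i x = σ x := by
  have := (H.onb b x hx).sum_repr' (σ x)
  simpa only [onb_apply] using this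

lemma SmoothOn.contMDiffAt {σ : ∀ b, W b} {u : Set B} (h : H.SmoothOn σ u) (hu : IsOpen u) {b x : B}
    (hx : x ∈ H.baseSet b) (hxu : x ∈ u) (i : H.idx b) :
    ContMDiffAt (𝓡 n) 𝓘(ℝ, ℂ) ∞ (fun y => ⟪H.frame b i y, σ y⟫_ℂ) x :=
  (h b i).contMDiffAt (((H.isOpen_baseSet b).inter hu).mem_nhds ⟨hx, hxu⟩)

/-- A family of local smoothness statements: the product of a section that is smooth on `u` with a function
supported in `u` is smooth. -/
lemma smoothOn_bump_smul {χ : B → ℝ} (hχ : ContMDiff (𝓡 n) 𝓘(ℝ, ℝ) ∞ χ) {σ : ∀ b, W b} {u : Set B}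
    (hu : IsOpen u) (h : H.SmoothOn σ u) (hs : tsupport χ ⊆ u) :
    H.SmoothOn (fun x => (χ x : ℂ) • σ x) Set.univ := by
  intro b i x hx
  by_cases hxs : x ∈ tsupport χ
  · have h1 := SmoothOn.smul (f := fun x => (χ x : ℂ)) (contMDiff_ofReal.comp hχ).contMDiffOn h
    exact (h1.contMDiffAt hu hx.1 (hs hxs) i).contMDiffWithinAt
  · have h1 : (fun y => ⟪H.frame b i y, (χ y : ℂ) • σ y⟫_ℂ) =ᶠ[𝓝 x] fun _ => 0 := by
      filter_upwards [(isClosed_tsupport χ).isOpen_compl.mem_nhds hxs] with y hy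
      rw [image_eq_zero_of_notMem_tsupport hy, Complex.ofReal_zero, zero_smul, inner_zero_right]
    exact (contMDiffAt_const.congr_of_eventuallyEq h1).contMDiffWithinAt

end HermitianBundle

lemma contMDiff_bump_mul {χ : B → ℝ} (hχ : ContMDiff (𝓡 n) 𝓘(ℝ, ℝ) ∞ χ) {f : B → ℂ} {u : Set B}
    (hu : IsOpen u) (h : ContMDiffOn (𝓡 n) 𝓘(ℝ, ℂ) ∞ f u) (hs : tsupport χ ⊆ u) :
    ContMDiff (𝓡 n) 𝓘(ℝ, ℂ) ∞ (fun x => (χ x : ℂ) * f x) := by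
  intro x
  by_cases hxs : x ∈ tsupport χ
  · exact (contMDiffOn_mul (contMDiff_ofReal.comp hχ).contMDiffOn h).contMDiffAt (hu.mem_nhds (hs hxs))
  · have h1 : (fun y => (χ y : ℂ) * f y) =ᶠ[𝓝 x] fun _ => 0 := by
      filter_upwards [(isClosed_tsupport χ).isOpen_compl.mem_nhds hxs] with y hy
      rw [image_eq_zero_of_notMem_tsupport hy, Complex.ofReal_zero, zero_mul]
    exact contMDiffAt_const.congr_of_eventuallyEq h1

lemma exists_bump [T2Space B] [IsManifold (𝓡 n) ∞ B] {u : Set B} (hu : IsOpen u) {x : B} (hx : x ∈ u) :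
    ∃ χ : B → ℝ, ContMDiff (𝓡 n) 𝓘(ℝ, ℝ) ∞ χ ∧ tsupport χ ⊆ u ∧ ∀ᶠ y in 𝓝 x, χ y = 1 := by
  obtain ⟨f, -, hf⟩ := (SmoothBumpFunction.nhds_basis_tsupport (I := 𝓡 n) x).mem_iff.1 (hu.mem_nhds hx)
  exact ⟨f, f.contMDiff, hf, f.eventuallyEq_one⟩

namespace HermitianConnection

variable [IsManifold (𝓡 n) ∞ B] {H : HermitianBundle n W} (D : HermitianConnection H)

lemma nabla_leibniz {u : Set B} (hu : IsOpen u) {f : B → ℂ} {σ : ∀ b, W b}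
    (hf : ContMDiffOn (𝓡 n) 𝓘(ℝ, ℂ) ∞ f u) (hσ : H.SmoothOn σ u) {x : B} (hx : x ∈ u)
    (v : TangentSpace (𝓡 n) x) :
    D.nabla (fun y => f y • σ y) x v = dAt f x v • σ x + f x • D.nabla σ x v :=
  D.leibniz u hu f σ hf hσ x hx v

/-- Locality is not an axiom of `HermitianConnection`; it follows from the Leibniz rule. After
multiplication by a bump function equal to 1 near x, whose differential vanishes at x, the two
sections coincide everywhere. -/
lemma nabla_congr [T2Space B] {σ σ' : ∀ b, W b} {x : B} (h : ∀ᶠ y in 𝓝 x, σ y = σ' y) {u : Set B}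
    (hu : IsOpen u) (hx : x ∈ u) (hσ : H.SmoothOn σ u) (v : TangentSpace (𝓡 n) x) :
    D.nabla σ x v = D.nabla σ' x v := by
  obtain ⟨u', hu', hu'o, hxu'⟩ := eventually_nhds_iff.1 h
  obtain ⟨χ, hχ, hχs, hχ1⟩ := exists_bump (n := n) (hu'o.inter hu) ⟨hxu', hx⟩
  have hχc : ContMDiff (𝓡 n) 𝓘(ℝ, ℂ) ∞ fun x => (χ x : ℂ) := contMDiff_ofReal.comp hχ
  have hd : dAt (fun y => (χ y : ℂ)) x v = 0 := by
    rw [dAt_congr (f' := fun _ => (1 : ℂ)) (hχ1.mono fun y hy => by simp [hy]), dAt_const]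
  have key : ∀ s : ∀ b, W b, H.SmoothOn s (u' ∩ u) →
      D.nabla (fun y => (χ y : ℂ) • s y) x v = D.nabla s x v := fun s hs => by
    rw [D.nabla_leibniz (hu'o.inter hu) hχc.contMDiffOn hs ⟨hxu', hx⟩, hd, hχ1.self_of_nhds]
    simp
  have h1 : H.SmoothOn σ (u' ∩ u) := hσ.mono Set.inter_subset_right
  rw [← key σ h1, ← key σ' (h1.congr fun y hy => (hu' y hy.1).symm)]
  congr 1
  funext y
  by_cases hy : y ∈ tsupport χ
  · rw [hu' y (hχs hy).1]
  · rw [image_eq_zero_of_notMem_tsupport hy]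
    simp

lemma nabla_zero (x : B) (v : TangentSpace (𝓡 n) x) : D.nabla (fun _ => 0) x v = 0 := by
  have h0 : H.SmoothOn (fun _ => 0) Set.univ := H.ccSubmodule.zero_mem.1
  have := D.add Set.univ isOpen_univ _ _ h0 h0 x trivial v
  simp only [add_zero] at this
  exact left_eq_add.1 this

lemma nabla_sum {ι : Type*} (s : Finset ι) {σ : ι → ∀ b, W b} {u : Set B} (hu : IsOpen u)
    (hσ : ∀ i ∈ s, H.SmoothOn (σ i) u) {x : B} (hx : x ∈ u) (v : TangentSpace (𝓡 n) x) :
    D.nabla (fun y => ∑ i ∈ s, σ i y) x v = ∑ i ∈ s, D.nabla (σ i) x v := by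
  classical
  induction s using Finset.induction_on with
  | empty => simp only [Finset.sum_empty]; exact D.nabla_zero x v
  | insert a s ha ih =>
    simp only [Finset.sum_insert ha]
    rw [D.add u hu _ _ (hσ a (Finset.mem_insert_self _ _))
      (HermitianBundle.SmoothOn.sum fun i hi => hσ i (Finset.mem_insert_of_mem hi)) x hx,
      ih fun i hi => hσ i (Finset.mem_insert_of_mem hi)]

/-- A connection in a local frame. -/
lemma nabla_eq_sum [T2Space B] {σ : ∀ b, W b} {u : Set B} (hu : IsOpen u) (hσ : H.SmoothOn σ u) {b x : B}
    (hx : x ∈ u) (hb : x ∈ H.baseSet b) (v : TangentSpace (𝓡 n) x) :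
    D.nabla σ x v = ∑ i, (dAt (fun y => ⟪H.frame b i y, σ y⟫_ℂ) x v • H.frame b i x +
      ⟪H.frame b i x, σ x⟫_ℂ • D.nabla (H.frame b i) x v) := by
  have hub : IsOpen (H.baseSet b ∩ u) := (H.isOpen_baseSet b).inter hu
  have h1 : ∀ᶠ y in 𝓝 x, σ y = ∑ i, ⟪H.frame b i y, σ y⟫_ℂ • H.frame b i y := by
    filter_upwards [(H.isOpen_baseSet b).mem_nhds hb] with y hy
    exact (H.sum_inner_smul_frame σ hy).symm
  rw [D.nabla_congr h1 hu hx hσ, D.nabla_sum _ hub (fun i _ => HermitianBundle.SmoothOn.smul (hσ b i)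
    ((H.smoothOn_frame b i).mono Set.inter_subset_left)) ⟨hb, hx⟩]
  exact Finset.sum_congr rfl fun i _ => D.nabla_leibniz hub (hσ b i)
    ((H.smoothOn_frame b i).mono Set.inter_subset_left) ⟨hb, hx⟩ v

end HermitianConnection

end Sections

end PiCover

end

noncomputable section

namespace PiCover

/-! ### The tensor product connection -/

section TensorCalculus

open Filter Topology

variable {n : ℕ} {B : Type*} [TopologicalSpace B] [ChartedSpace (Eu n) B] [IsManifold (𝓡 n) ∞ B]
  {B' : Type*} [TopologicalSpace B'] [ChartedSpace (Eu n) B'] [IsManifold (𝓡 n) ∞ B']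
  {S : B' → Type*} [∀ b, NormedAddCommGroup (S b)] [∀ b, InnerProductSpace ℂ (S b)]
  {E : B → Type*} [∀ b, NormedAddCommGroup (E b)] [∀ b, InnerProductSpace ℂ (E b)]
  {HS : HermitianBundle n S} {HE : HermitianBundle n E} {q : B' → B} (hq : ContMDiff (𝓡 n) (𝓡 n) ∞ q)

lemma smoothOn_tmul {s : ∀ p, S p} {t : ∀ y, E y} {u : Set B'} {u' : Set B} (hs : HS.SmoothOn s u)
    (ht : HE.SmoothOn t u') (hu : u ⊆ q ⁻¹' u') :
    (tensorBundle HS HE q hq).SmoothOn (fun p => s p ⊗ₜ[ℂ] t (q p)) u := fun p i => by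
  have h1 : ContMDiffOn (𝓡 n) 𝓘(ℝ, ℂ) ∞ (fun x => ⟪HS.frame p i.1 x, s x⟫_ℂ)
      ((tensorBundle HS HE q hq).baseSet p ∩ u) := (hs p i.1).mono fun x hx => ⟨hx.1.1, hx.2⟩
  have h2 : ContMDiffOn (𝓡 n) 𝓘(ℝ, ℂ) ∞ (fun x => ⟪HE.frame (q p) i.2 (q x), t (q x)⟫_ℂ)
      ((tensorBundle HS HE q hq).baseSet p ∩ u) :=
    (ht (q p) i.2).comp hq.contMDiffOn fun x hx => ⟨hx.1.2, hu hx.2⟩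
  exact (contMDiffOn_mul h1 h2).congr fun x _ => TensorProduct.inner_tmul _ _ _ _ _

/-- Locally, every smooth section of `S ⊗ q^*E` is a combination of products of global sections. -/
lemma exists_local_sum [T2Space B] [T2Space B'] {σ : ∀ p, S p ⊗[ℂ] E (q p)} {u : Set B'} (hu : IsOpen u)
    (hσ : (tensorBundle HS HE q hq).SmoothOn σ u) {x₀ : B'} (hx₀ : x₀ ∈ u) :
    ∃ (f : HS.idx x₀ × HE.idx (q x₀) → B' → ℂ) (s : HS.idx x₀ × HE.idx (q x₀) → ∀ p, S p)
      (t : HS.idx x₀ × HE.idx (q x₀) → ∀ y, E y), (∀ k, ContMDiff (𝓡 n) 𝓘(ℝ, ℂ) ∞ (f k)) ∧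
      (∀ k, HS.SmoothOn (s k) Set.univ) ∧ (∀ k, HE.SmoothOn (t k) Set.univ) ∧
      ∀ᶠ x in 𝓝 x₀, σ x = ∑ k, f k x • (s k x ⊗ₜ[ℂ] t k (q x)) := by
  -- Three cut-offs: one for the coefficients of σ, two that extend the frames of S and E to global
  -- sections. The smoothness of a `BundleAction` concerns global sections only.
  obtain ⟨χ, hχ, hχs, hχ1⟩ := exists_bump (n := n)
    (((tensorBundle HS HE q hq).isOpen_baseSet x₀).inter hu) ⟨(tensorBundle HS HE q hq).mem_baseSet x₀, hx₀⟩
  obtain ⟨χ₁, hχ₁, hχs₁, hχ₁1⟩ := exists_bump (n := n) (HS.isOpen_baseSet x₀) (HS.mem_baseSet x₀)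
  obtain ⟨χ₂, hχ₂, hχs₂, hχ₂1⟩ := exists_bump (n := n) (HE.isOpen_baseSet (q x₀)) (HE.mem_baseSet (q x₀))
  refine ⟨fun k x => (χ x : ℂ) * ⟪(tensorBundle HS HE q hq).frame x₀ k x, σ x⟫_ℂ,
    fun k x => (χ₁ x : ℂ) • HS.frame x₀ k.1 x, fun k y => (χ₂ y : ℂ) • HE.frame (q x₀) k.2 y,
    fun k => contMDiff_bump_mul hχ (((tensorBundle HS HE q hq).isOpen_baseSet x₀).inter hu) (hσ x₀ k) hχs,
    fun k => HermitianBundle.smoothOn_bump_smul hχ₁ (HS.isOpen_baseSet x₀) (HS.smoothOn_frame x₀ k.1) hχs₁,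
    fun k => HermitianBundle.smoothOn_bump_smul hχ₂ (HE.isOpen_baseSet (q x₀)) (HE.smoothOn_frame (q x₀) k.2) hχs₂, ?_⟩
  filter_upwards [hχ1, hχ₁1, hq.continuous.continuousAt.eventually hχ₂1,
    ((tensorBundle HS HE q hq).isOpen_baseSet x₀).mem_nhds ((tensorBundle HS HE q hq).mem_baseSet x₀)] with x h1 h2 h3 hx
  have := (tensorBundle HS HE q hq).sum_inner_smul_frame σ hx
  simp only [h1, h2, h3, Complex.ofReal_one, one_smul, one_mul]
  exact this.symm

variable (DS : HermitianConnection HS) (DE : HermitianConnection HE)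

/-- Written with `dAt`, the derivatives are plain vectors instead of tangent vectors, so the rules
of calculus apply by rewriting. -/
lemma tensorNabla_eq (σ : ∀ p, S p ⊗[ℂ] E (q p)) (p : B') (v : TangentSpace (𝓡 n) p) :
    tensorNabla DS DE q σ p v = ∑ i : HS.idx p, ∑ a : HE.idx (q p),
      (dAt (fun x => ⟪HS.frame p i x ⊗ₜ[ℂ] HE.frame (q p) a (q x), σ x⟫_ℂ) p v •
        (HS.frame p i p ⊗ₜ[ℂ] HE.frame (q p) a (q p)) +
      ⟪HS.frame p i p ⊗ₜ[ℂ] HE.frame (q p) a (q p), σ p⟫_ℂ •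
        (DS.nabla (HS.frame p i) p v ⊗ₜ[ℂ] HE.frame (q p) a (q p) +
          HS.frame p i p ⊗ₜ[ℂ] DE.nabla (HE.frame (q p) a) (q p) (mfderiv (𝓡 n) (𝓡 n) q p v))) := rfl

lemma tensorNabla_congr {σ σ' : ∀ p, S p ⊗[ℂ] E (q p)} {p : B'} (h : ∀ᶠ x in 𝓝 p, σ x = σ' x)
    (v : TangentSpace (𝓡 n) p) : tensorNabla DS DE q σ p v = tensorNabla DS DE q σ' p v := by
  rw [tensorNabla_eq, tensorNabla_eq]
  refine Finset.sum_congr rfl fun i _ => Finset.sum_congr rfl fun a _ => ?_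
  have h1 : (fun x => ⟪HS.frame p i x ⊗ₜ[ℂ] HE.frame (q p) a (q x), σ x⟫_ℂ) =ᶠ[𝓝 p]
      fun x => ⟪HS.frame p i x ⊗ₜ[ℂ] HE.frame (q p) a (q x), σ' x⟫_ℂ :=
    h.mono fun x hx => by simp only [hx]
  rw [dAt_congr h1, h.self_of_nhds]

lemma tensorNabla_zero (p : B') (v : TangentSpace (𝓡 n) p) : tensorNabla DS DE q (fun _ => 0) p v = 0 := by
  rw [tensorNabla_eq]
  simp only [inner_zero_right, zero_smul, dAt_const, add_zero, Finset.sum_const_zero]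

lemma tensorNabla_map_add (σ : ∀ p, S p ⊗[ℂ] E (q p)) (p : B') (v w : TangentSpace (𝓡 n) p) :
    tensorNabla DS DE q σ p (v + w) = tensorNabla DS DE q σ p v + tensorNabla DS DE q σ p w := by
  simp only [tensorNabla_eq, ← Finset.sum_add_distrib]
  refine Finset.sum_congr rfl fun i _ => Finset.sum_congr rfl fun a _ => ?_
  rw [dAt_map_add, DS.map_add, map_add, DE.map_add, TensorProduct.add_tmul, TensorProduct.tmul_add]
  module

lemma tensorNabla_map_smul (σ : ∀ p, S p ⊗[ℂ] E (q p)) (p : B') (r : ℝ) (v : TangentSpace (𝓡 n) p) :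
    tensorNabla DS DE q σ p (r • v) = (r : ℂ) • tensorNabla DS DE q σ p v := by
  simp only [tensorNabla_eq, Finset.smul_sum]
  refine Finset.sum_congr rfl fun i _ => Finset.sum_congr rfl fun a _ => ?_
  rw [dAt_map_smul, DS.map_smul, map_smul, DE.map_smul, ← TensorProduct.smul_tmul', TensorProduct.tmul_smul,
    Complex.real_smul]
  module

lemma HermitianBundle.SmoothOn.mdifferentiableAt {B : Type*} [TopologicalSpace B] [ChartedSpace (Eu n) B]
    {W : B → Type*} [∀ b, NormedAddCommGroup (W b)] [∀ b, InnerProductSpace ℂ (W b)]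
    {H : HermitianBundle n W} {σ : ∀ b, W b} {u : Set B} (h : H.SmoothOn σ u) (hu : IsOpen u) {b : B}
    (hb : b ∈ u) (i : H.idx b) :
    MDifferentiableAt (𝓡 n) 𝓘(ℝ, ℂ) (fun y => ⟪H.frame b i y, σ y⟫_ℂ) b :=
  (h.contMDiffAt hu (H.mem_baseSet b) hb i).mdifferentiableAt (by simp)

lemma mdifferentiableAt_inner_tmul {u : Set B'} (hu : IsOpen u) {σ : ∀ p, S p ⊗[ℂ] E (q p)}
    (hσ : (tensorBundle HS HE q hq).SmoothOn σ u) {p : B'} (hp : p ∈ u) (i : HS.idx p) (a : HE.idx (q p)) :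
    MDifferentiableAt (𝓡 n) 𝓘(ℝ, ℂ) (fun x => ⟪HS.frame p i x ⊗ₜ[ℂ] HE.frame (q p) a (q x), σ x⟫_ℂ) p :=
  hσ.mdifferentiableAt hu hp (i, a)

lemma tensorNabla_add {u : Set B'} (hu : IsOpen u) {σ σ' : ∀ p, S p ⊗[ℂ] E (q p)}
    (hσ : (tensorBundle HS HE q hq).SmoothOn σ u) (hσ' : (tensorBundle HS HE q hq).SmoothOn σ' u) {p : B'}
    (hp : p ∈ u) (v : TangentSpace (𝓡 n) p) :
    tensorNabla DS DE q (fun x => σ x + σ' x) p v = tensorNabla DS DE q σ p v + tensorNabla DS DE q σ' p v := by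
  simp only [tensorNabla_eq, ← Finset.sum_add_distrib]
  refine Finset.sum_congr rfl fun i _ => Finset.sum_congr rfl fun a _ => ?_
  simp only [inner_add_right]
  rw [dAt_add (mdifferentiableAt_inner_tmul hq hu hσ hp i a) (mdifferentiableAt_inner_tmul hq hu hσ' hp i a)]
  module

lemma tensorNabla_sum {ι : Type*} (s : Finset ι) {u : Set B'} (hu : IsOpen u)
    {σ : ι → ∀ p, S p ⊗[ℂ] E (q p)} (hσ : ∀ i ∈ s, (tensorBundle HS HE q hq).SmoothOn (σ i) u) {p : B'}
    (hp : p ∈ u) (v : TangentSpace (𝓡 n) p) :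
    tensorNabla DS DE q (fun x => ∑ i ∈ s, σ i x) p v = ∑ i ∈ s, tensorNabla DS DE q (σ i) p v := by
  classical
  induction s using Finset.induction_on with
  | empty => simp only [Finset.sum_empty]; exact tensorNabla_zero DS DE p v
  | insert a s ha ih =>
    simp only [Finset.sum_insert ha]
    rw [tensorNabla_add hq DS DE hu (hσ a (Finset.mem_insert_self _ _))
      (HermitianBundle.SmoothOn.sum fun i hi => hσ i (Finset.mem_insert_of_mem hi)) hp,
      ih fun i hi => hσ i (Finset.mem_insert_of_mem hi)]

lemma tensorNabla_smul {u : Set B'} (hu : IsOpen u) {f : B' → ℂ} {σ : ∀ p, S p ⊗[ℂ] E (q p)}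
    (hf : ContMDiffOn (𝓡 n) 𝓘(ℝ, ℂ) ∞ f u) (hσ : (tensorBundle HS HE q hq).SmoothOn σ u) {p : B'}
    (hp : p ∈ u) (v : TangentSpace (𝓡 n) p) :
    tensorNabla DS DE q (fun x => f x • σ x) p v = dAt f p v • σ p + f p • tensorNabla DS DE q σ p v := by
  -- The undifferentiated σ(p) of the Leibniz term is expanded in the frame as well, so that both
  -- sides can be compared coefficient by coefficient.
  have h1 := (tensorBundle HS HE q hq).sum_inner_smul_frame σ ((tensorBundle HS HE q hq).mem_baseSet p)
  have h2 : ∑ i : HS.idx p, ∑ a : HE.idx (q p), ⟪HS.frame p i p ⊗ₜ[ℂ] HE.frame (q p) a (q p), σ p⟫_ℂ •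
      (HS.frame p i p ⊗ₜ[ℂ] HE.frame (q p) a (q p)) = σ p := by
    rw [← Fintype.sum_prod_type' (f := fun i a => ⟪HS.frame p i p ⊗ₜ[ℂ] HE.frame (q p) a (q p), σ p⟫_ℂ •
      (HS.frame p i p ⊗ₜ[ℂ] HE.frame (q p) a (q p)))]
    exact h1
  nth_rewrite 1 [← h2]
  simp only [tensorNabla_eq, Finset.smul_sum, ← Finset.sum_add_distrib]
  refine Finset.sum_congr rfl fun i _ => Finset.sum_congr rfl fun a _ => ?_
  have h3 : ∀ x, ⟪HS.frame p i x ⊗ₜ[ℂ] HE.frame (q p) a (q x), f x • σ x⟫_ℂ =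
      f x * ⟪HS.frame p i x ⊗ₜ[ℂ] HE.frame (q p) a (q x), σ x⟫_ℂ := fun x => inner_smul_right _ (σ x) (f x)
  simp only [h3]
  rw [dAt_mul ((hf.contMDiffAt (hu.mem_nhds hp)).mdifferentiableAt (by simp))
    (mdifferentiableAt_inner_tmul hq hu hσ hp i a)]
  module

/-- Together with `tensorNabla_sum` and `tensorNabla_smul` this computes the connection without the
frame attached to p. Invariance needs that, since the frames attached to p and to ηp are unrelated.
-/
lemma tensorNabla_tmul [T2Space B] [T2Space B'] (hq : ContMDiff (𝓡 n) (𝓡 n) ∞ q) {u : Set B'} (hu : IsOpen u) {u' : Set B} (hu' : IsOpen u')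
    {s : ∀ p, S p} {t : ∀ y, E y} (hs : HS.SmoothOn s u) (ht : HE.SmoothOn t u') {p : B'}
    (hp : p ∈ u) (hp' : q p ∈ u') (v : TangentSpace (𝓡 n) p) :
    tensorNabla DS DE q (fun x => s x ⊗ₜ[ℂ] t (q x)) p v =
      DS.nabla s p v ⊗ₜ[ℂ] t (q p) + s p ⊗ₜ[ℂ] DE.nabla t (q p) (mfderiv (𝓡 n) (𝓡 n) q p v) := by
  rw [tensorNabla_eq]
  conv_rhs => rw [← HS.sum_inner_smul_frame s (HS.mem_baseSet p),
    ← HE.sum_inner_smul_frame t (HE.mem_baseSet (q p)), DS.nabla_eq_sum hu hs hp (HS.mem_baseSet p),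
    DE.nabla_eq_sum hu' ht hp' (HE.mem_baseSet (q p))]
  simp only [TensorProduct.sum_tmul]
  simp only [TensorProduct.tmul_sum, ← Finset.sum_add_distrib]
  refine Finset.sum_congr rfl fun i _ => Finset.sum_congr rfl fun a _ => ?_
  simp only [TensorProduct.inner_tmul]
  have h1 : MDifferentiableAt (𝓡 n) 𝓘(ℝ, ℂ) (fun x => ⟪HE.frame (q p) a (q x), t (q x)⟫_ℂ) p :=
    ((ht.contMDiffAt hu' (HE.mem_baseSet (q p)) hp' a).comp p hq.contMDiffAt).mdifferentiableAt (by simp)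
  rw [dAt_mul (hs.mdifferentiableAt hu hp i) h1,
    dAt_comp (f := fun y => ⟪HE.frame (q p) a y, t y⟫_ℂ) (ht.mdifferentiableAt hu' hp' a)
      (hq.mdifferentiableAt (by simp))]
  simp only [TensorProduct.add_tmul, TensorProduct.tmul_add, ← TensorProduct.smul_tmul', TensorProduct.tmul_smul]
  module

end TensorCalculus

end PiCover

end

noncomputable section

namespace PiCover

/-! ### The action of `Π^τ` on `S ⊗ q^*E` -/

section TensorAction

open Filter Topology

variable {G : Type*} [Group G] [TopologicalSpace G] [IsTopologicalGroup G] {T : Subgroup G} [IsTorus T]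
  {P : Type*} [Group P] {τ : CentralExtension T P}
  {n : ℕ} {Y : Type*} [TopologicalSpace Y] [ChartedSpace (Eu n) Y] [IsManifold (𝓡 n) ∞ Y] {Φ : Y → T}
  [ChartedSpace (Eu n) (Cover Φ)] [IsManifold (𝓡 n) ∞ (Cover Φ)] [IsSmoothCover n Φ]
  {S : Cover Φ → Type*} [∀ p, NormedAddCommGroup (S p)] [∀ p, InnerProductSpace ℂ (S p)]
  {E : Y → Type*} [∀ y, NormedAddCommGroup (E y)] [∀ y, InnerProductSpace ℂ (E y)]
  {HS : HermitianBundle n S} {HE : HermitianBundle n E}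
  {AS : BundleAction HS fun (x : P) (p : Cover Φ) => p.deck (τ.proj x)}

lemma BundleAction.isTwistedAction
    (hweight : ∀ (z : Circle) p (s : S p), (⟨_, AS.map (τ.incl z) p s⟩ : Σ p, S p) = ⟨p, (z : ℂ) • s⟩) :
    IsTwistedAction (W := S) AS.map := ⟨AS.map_mul, hweight⟩

/-- Pulling back by x is acting by x⁻¹, so the smoothness built into `BundleAction` applies to it.
-/
lemma BundleAction.map_pull_inv (x : P) (σ : ∀ p, S p) (p : Cover Φ) :
    pull (W := S) AS.map x σ (p.deck (τ.proj x⁻¹)) = AS.map x⁻¹ p (σ p) :=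
  pull_eq (by
    refine eq_of_sigma_eq (b' := p) σ ?_
    have h := AS.map_mul x x⁻¹ p (σ p)
    rw [mul_inv_cancel, AS.map_one] at h
    exact h.symm)

lemma BundleAction.smoothOn_pull (x : P) {σ : ∀ p, S p} (hσ : HS.SmoothOn σ Set.univ) :
    HS.SmoothOn (pull (W := S) AS.map x σ) Set.univ :=
  AS.smooth x⁻¹ σ _ (AS.map_pull_inv x σ) hσ

/-- The point of `𝒴` given by `ξ ∈ 𝔱` and `y ∈ Y`. -/
def Cover.mk (ξ : LieT T) (y : Y) (h : ξ.exp = Φ y) : Cover Φ := ⟨(ξ, y), h⟩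

/-- The two points have the same y, hence literally the same fibre `E y`; only the equality of
𝔱-coordinates has to be substituted to tensor an identity of actions on S with E. -/
lemma sigma_rTensor_eq {y : Y} {ξ₁ ξ₂ : LieT T} (h₁ : ξ₁.exp = Φ y) (h₂ : ξ₂.exp = Φ y) {V : Type*}
    [NormedAddCommGroup V] [InnerProductSpace ℂ V] (A₁ : V →ₗ[ℂ] S (Cover.mk ξ₁ y h₁))
    (A₂ : V →ₗ[ℂ] S (Cover.mk ξ₂ y h₂))
    (h : ∀ v, (⟨Cover.mk ξ₁ y h₁, A₁ v⟩ : Σ p, S p) = ⟨Cover.mk ξ₂ y h₂, A₂ v⟩) (t : V ⊗[ℂ] E y) :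
    (⟨Cover.mk ξ₁ y h₁, A₁.rTensor (E y) t⟩ : Σ p : Cover Φ, S p ⊗[ℂ] E p.base) =
      ⟨Cover.mk ξ₂ y h₂, A₂.rTensor (E y) t⟩ := by
  have h0 : ξ₁ = ξ₂ := congrArg (fun p : Cover Φ => p.1.1) (Sigma.mk.inj_iff.1 (h 0)).1
  subst h0
  have : A₁ = A₂ := LinearMap.ext fun v => eq_of_heq (Sigma.mk.inj_iff.1 (h v)).2
  rw [this]

lemma rTensor_lsmul {V V' : Type*} [AddCommGroup V] [Module ℂ V] [AddCommGroup V'] [Module ℂ V'] (c : ℂ)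
    (t : V ⊗[ℂ] V') : (LinearMap.lsmul ℂ V c).rTensor V' t = c • t := by
  induction t with
  | zero => simp
  | add t t' h h' => rw [map_add, smul_add, h, h']
  | tmul s e => exact TensorProduct.smul_tmul' _ _ _

lemma actSE_tmul (x : P) (p : Cover Φ) (s : S p) (t : E p.base) :
    actSE E AS x p (s ⊗ₜ[ℂ] t) = (AS.map x p s) ⊗ₜ[ℂ] t := rfl

lemma isTwistedAction_actSE
    (hweight : ∀ (z : Circle) p (s : S p), (⟨_, AS.map (τ.incl z) p s⟩ : Σ p, S p) = ⟨p, (z : ℂ) • s⟩) :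
    IsTwistedAction (W := fun p : Cover Φ => S p ⊗[ℂ] E p.base) (actSE E AS) where
  mul x x' p t := by
    have h := sigma_rTensor_eq (E := E) (p.deck (τ.proj (x * x'))).2 ((p.deck (τ.proj x')).deck (τ.proj x)).2
      (AS.map (x * x') p).toLinearMap ((AS.map x _).toLinearMap ∘ₗ (AS.map x' p).toLinearMap)
      (AS.map_mul x x' p) t
    exact h.trans (congrArg (Sigma.mk (β := fun p : Cover Φ => S p ⊗[ℂ] E p.base)
      ((p.deck (τ.proj x')).deck (τ.proj x))) (LinearMap.rTensor_comp_apply (E p.base)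
        (AS.map x _).toLinearMap (AS.map x' p).toLinearMap t))
  weight z p t := by
    have h := sigma_rTensor_eq (E := E) (S := S) (p.deck (τ.proj (τ.incl z))).2 p.2
      (V := S p) (AS.map (τ.incl z) p).toLinearMap (LinearMap.lsmul ℂ (S p) (z : ℂ))
      (fun s => hweight z p s) t
    exact h.trans (congrArg (Sigma.mk (β := fun p : Cover Φ => S p ⊗[ℂ] E p.base) p) (rTensor_lsmul _ t))

variable (hw : IsTwistedAction (W := S) AS.map)
include hw

/-- A local description of the translate of a section. -/
lemma pull_actSE_eq {σ : ∀ p : Cover Φ, S p ⊗[ℂ] E p.base} {ι : Type*} [Fintype ι] {f : ι → Cover Φ → ℂ}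
    {s : ι → ∀ p, S p} {t : ι → ∀ y, E y} (x : P) {p : Cover Φ}
    (h : σ (p.deck (τ.proj x)) = ∑ k, f k (p.deck (τ.proj x)) • (s k (p.deck (τ.proj x)) ⊗ₜ[ℂ] t k p.base)) :
    pull (W := fun p : Cover Φ => S p ⊗[ℂ] E p.base) (actSE E AS) x σ p =
      ∑ k, f k (p.deck (τ.proj x)) • (pull (W := S) AS.map x (s k) p ⊗ₜ[ℂ] t k p.base) := by
  refine pull_eq (W := fun p : Cover Φ => S p ⊗[ℂ] E p.base) ?_
  rw [h, map_sum]
  refine Finset.sum_congr rfl fun k _ => ?_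
  rw [map_smul, actSE_tmul, hw.act_pull]
  rfl

variable [T2Space Y]

/-- Near each point the section is a sum of terms f (s ⊗ t) with global factors, and pulling back
only affects f and s. -/
lemma smoothOn_pull_actSE (x : P) (σ : ∀ p : Cover Φ, S p ⊗[ℂ] E p.base)
    (hσ : (bundleSE HS HE).SmoothOn σ Set.univ) :
    (bundleSE HS HE).SmoothOn (pull (W := fun p : Cover Φ => S p ⊗[ℂ] E p.base) (actSE E AS) x σ) Set.univ := by
  refine HermitianBundle.smoothOn_univ_of_eventually fun p => ?_
  obtain ⟨f, s, t, hf, hs, ht, h⟩ := exists_local_sum (contMDiff_base n Φ) isOpen_univ hσ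
    (x₀ := p.deck (τ.proj x)) trivial
  refine ⟨fun p => ∑ k, f k (p.deck (τ.proj x)) • (pull (W := S) AS.map x (s k) p ⊗ₜ[ℂ] t k p.base), ?_, ?_⟩
  · refine HermitianBundle.SmoothOn.sum fun k _ => HermitianBundle.SmoothOn.smul
      ((hf k).comp (Cover.contMDiff_deck n _)).contMDiffOn ?_
    exact smoothOn_tmul (contMDiff_base n Φ) (AS.smoothOn_pull x (hs k)) (ht k) (fun _ _ => trivial)
  · filter_upwards [(Cover.continuous_deck (τ.proj x)).continuousAt.eventually h] with z hz
    exact pull_actSE_eq hw x hz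

variable (DS : HermitianConnection HS) (DE : HermitianConnection HE)

/-- The tensor product connection is invariant. -/
lemma actSE_tensorNabla_pull (hDA : DS.IsInvariant AS) (x : P) {σ : ∀ p : Cover Φ, S p ⊗[ℂ] E p.base}
    (hσ : (bundleSE HS HE).SmoothOn σ Set.univ) (p : Cover Φ) (v : TangentSpace (𝓡 n) p) :
    actSE E AS x p (tensorNabla DS DE Cover.base
      (pull (W := fun p : Cover Φ => S p ⊗[ℂ] E p.base) (actSE E AS) x σ) p v) =
      tensorNabla DS DE Cover.base σ (p.deck (τ.proj x))
        (mfderiv (𝓡 n) (𝓡 n) (fun p : Cover Φ => p.deck (τ.proj x)) p v) := by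
  obtain ⟨f, s, t, hf, hs, ht, h⟩ := exists_local_sum (contMDiff_base n Φ) isOpen_univ hσ
    (x₀ := p.deck (τ.proj x)) trivial
  have h' : ∀ᶠ z in 𝓝 p, pull (W := fun p : Cover Φ => S p ⊗[ℂ] E p.base) (actSE E AS) x σ z =
      ∑ k, f k (z.deck (τ.proj x)) • (pull (W := S) AS.map x (s k) z ⊗ₜ[ℂ] t k z.base) := by
    filter_upwards [(Cover.continuous_deck (τ.proj x)).continuousAt.eventually h] with z hz
    exact pull_actSE_eq hw x hz
  have hd := Cover.contMDiff_deck (Φ := Φ) n (τ.proj x)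
  have hps : ∀ k, HS.SmoothOn (pull (W := S) AS.map x (s k)) Set.univ := fun k => AS.smoothOn_pull x (hs k)
  have hu : ∀ s : ∀ p, S p, HS.SmoothOn s Set.univ → ∀ k, (bundleSE HS HE).SmoothOn
      (fun p => s p ⊗ₜ[ℂ] t k p.base) Set.univ := fun s hs k =>
    smoothOn_tmul (contMDiff_base n Φ) hs (ht k) (fun _ _ => trivial)
  -- On terms f (s ⊗ t) the claim splits into the chain rule for f, the invariance of the connection
  -- on S, and the derivative of t.
  rw [tensorNabla_congr DS DE h, tensorNabla_congr DS DE h',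
    tensorNabla_sum (contMDiff_base n Φ) DS DE _ isOpen_univ
      (fun k _ => HermitianBundle.SmoothOn.smul (hf k).contMDiffOn (hu _ (hs k) k)) trivial,
    tensorNabla_sum (contMDiff_base n Φ) DS DE _ isOpen_univ
      (σ := fun k z => f k (z.deck (τ.proj x)) • (pull (W := S) AS.map x (s k) z ⊗ₜ[ℂ] t k z.base))
      (fun k _ => HermitianBundle.SmoothOn.smul ((hf k).comp hd).contMDiffOn (hu _ (hps k) k)) trivial, map_sum]
  refine Finset.sum_congr rfl fun k _ => ?_
  rw [tensorNabla_smul (contMDiff_base n Φ) DS DE isOpen_univ (hf k).contMDiffOn (hu _ (hs k) k) trivial,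
    tensorNabla_tmul DS DE (contMDiff_base n Φ) isOpen_univ isOpen_univ (hs k) (ht k) trivial trivial]
  rw [tensorNabla_smul (f := fun z => f k (z.deck (τ.proj x))) (contMDiff_base n Φ) DS DE isOpen_univ
      ((hf k).comp hd).contMDiffOn (hu _ (hps k) k) trivial,
    tensorNabla_tmul DS DE (contMDiff_base n Φ) isOpen_univ isOpen_univ (hps k) (ht k) trivial trivial,
    dAt_comp (q := fun z : Cover Φ => z.deck (τ.proj x)) ((hf k).mdifferentiableAt (by simp))
      (hd.mdifferentiableAt (by simp))]
  rw [map_add, map_smul, map_smul, map_add, actSE_tmul, actSE_tmul, actSE_tmul, hw.act_pull]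
  rw [← hDA x (pull (W := S) AS.map x (s k)) (s k) (fun b => (hw.act_pull x (s k) b).symm) Set.univ isOpen_univ
    (hps k) p trivial v]
  -- Deck transformations cover the identity of Y, so the derivative of t is taken along the same
  -- tangent vector.
  have hdq := dq_mfderiv_deck (τ.proj x) p v
  have e : DE.nabla (t k) (p.deck (τ.proj x)).base
      (mfderiv (𝓡 n) (𝓡 n) (Cover.base : Cover Φ → Y) (p.deck (τ.proj x)) (mfderiv (𝓡 n) (𝓡 n) (fun p : Cover Φ => p.deck (τ.proj x)) p v)) =
      DE.nabla (t k) p.base (mfderiv (𝓡 n) (𝓡 n) (Cover.base : Cover Φ → Y) p v) := congrArg _ hdq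
  rw [e]
  rfl

omit hw in
/-- The connection on `L²_τ(Π) ⊗ (S ⊗ E)`, evaluated at an element of `Π^τ`. -/
lemma ev_hilbertNabla (x : P) {f : ∀ p : Cover Φ, L2tau τ ⊗[ℂ] (S p ⊗[ℂ] E p.base)}
    (hf : ∀ p i, ContMDiffOn (𝓡 n) 𝓘(ℝ, L2tau τ) ∞ (fun y => coeff ((bundleSE HS HE).frame p i y) (f y))
      ((bundleSE HS HE).baseSet p)) (p : Cover Φ) (v : TangentSpace (𝓡 n) p) :
    ev τ x (hilbertNabla (L2tau τ) (bundleSE HS HE) (tensorNabla DS DE Cover.base) f p v) =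
      tensorNabla DS DE Cover.base (fun p => ev τ x (f p)) p v := by
  have hb := (bundleSE HS HE).mem_baseSet p
  have hbo := (bundleSE HS HE).isOpen_baseSet p
  have hc : ∀ i, ContMDiffOn (𝓡 n) 𝓘(ℝ, ℂ) ∞ (fun y => evalL τ x (coeff ((bundleSE HS HE).frame p i y) (f y)))
      ((bundleSE HS HE).baseSet p) := fun i => (contMDiff_evalL x).comp_contMDiffOn (hf p i)
  -- The coefficients of the evaluated section are `evalL τ x` of the L²-valued ones, and a
  -- continuous linear functional commutes with d.
  have h1 : ∀ᶠ y in 𝓝 p, ev τ x (f y) = ∑ i, evalL τ x (coeff ((bundleSE HS HE).frame p i y) (f y)) •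
      (bundleSE HS HE).frame p i y := by
    filter_upwards [hbo.mem_nhds hb] with y hy
    have := (bundleSE HS HE).sum_inner_smul_frame (fun y => ev τ x (f y)) hy
    simp only [inner_ev] at this
    exact this.symm
  have hfr : ∀ i, (bundleSE HS HE).SmoothOn ((bundleSE HS HE).frame p i) ((bundleSE HS HE).baseSet p) :=
    fun i => (bundleSE HS HE).smoothOn_frame p i
  rw [tensorNabla_congr DS DE h1, tensorNabla_sum (contMDiff_base n Φ) DS DE _ hbo
    (fun i _ => HermitianBundle.SmoothOn.smul (hc i) (hfr i)) hb, hilbertNabla, map_sum]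
  refine Finset.sum_congr rfl fun i _ => ?_
  rw [map_add, ev_tmul, ev_tmul, tensorNabla_smul (contMDiff_base n Φ) DS DE hbo (hc i) (hfr i) hb]
  congr 2
  exact (dAt_clm ((evalL τ x).restrictScalars ℝ) (((hf p i).contMDiffAt (hbo.mem_nhds hb)).mdifferentiableAt
    (by simp)) v).symm

end TensorAction

end PiCover

end

noncomputable section

namespace PiCover

/-! ### Endomorphisms and translations -/

section Relations

open MeasureTheory Filter Topology

section Partition

variable {G : Type*} [Group G] [TopologicalSpace G] [IsTopologicalGroup G] {T : Subgroup G} [IsTorus T]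
  {P : Type*} [Group P] {τ : CentralExtension T P}
  {n : ℕ} {Y : Type*} [TopologicalSpace Y] {Φ : Y → T} [ChartedSpace (Eu n) (Cover Φ)]
  {W : Cover Φ → Type*} [∀ p, NormedAddCommGroup (W p)] [∀ p, InnerProductSpace ℂ (W p)]
  {act : ∀ (g : P) (p : Cover Φ), W p →ₗᵢ[ℂ] W (p.deck (τ.proj g))}
  [ChartedSpace (Eu n) Y] [IsSmoothCover n Φ] [T2Space Y] [SecondCountableTopology Y] [IsManifold (𝓡 n) ∞ Y]
  [MeasurableSpace Y] [BorelSpace Y] [MeasurableSpace (Cover Φ)] [BorelSpace (Cover Φ)]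
  {μY : Measure Y} [IsFiniteMeasureOnCompacts μY] {μ : Measure (Cover Φ)} [IsFiniteMeasureOnCompacts μ]
  {H : HermitianBundle n W}

/-- Membership in the closure of a graph can be checked after multiplication with the functions of a
partition of unity. -/
lemma mem_graphClosure_of_partition (hact : IsTwistedAction act)
    (hsm : ∀ g σ, H.SmoothOn σ Set.univ → H.SmoothOn (pull act g σ) Set.univ)
    {R : (∀ p, W p) → (∀ p, W p) → Prop} (h0 : R 0 0)
    (hadd : ∀ σ₁ σ₁' σ₂ σ₂' : H.Cc μ, R σ₁ σ₁' → R σ₂ σ₂' → R (σ₁ + σ₂ : H.Cc μ) (σ₁' + σ₂' : H.Cc μ))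
    {v v' : QCc H τ act μY} {K : Set Y} (hK : IsCompact K) (hv : ∀ y ∉ K, (v : ∀ y, QFib τ act y) y = 0)
    (w' : ∀ ψ : Y → ℝ, ContMDiff (𝓡 n) 𝓘(ℝ, ℝ) ∞ ψ → QCc H τ act μY)
    (hsum : ∀ (m : ℕ) (ψ : Fin m → Y → ℝ) (hψ : ∀ i, ContMDiff (𝓡 n) 𝓘(ℝ, ℝ) ∞ (ψ i)),
      (∀ y ∈ K, ∀ᶠ z in 𝓝 y, ∑ i, ψ i z = 1) → ∑ i, w' (ψ i) (hψ i) = v')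
    (hloc : ∀ (ψ : Y → ℝ) (hψ : ContMDiff (𝓡 n) 𝓘(ℝ, ℝ) ∞ ψ) (V : Set (Cover Φ)),
      IsSheetOver V (K ∩ tsupport ψ) →
      (∀ p : Cover Φ, p.base ∉ K ∩ tsupport ψ → sec (QCc.mul hψ v : ∀ y, QFib τ act y) p = 0) →
      (QCc.mul hψ v, w' ψ hψ) ∈ graphClosure μY μ hact hsm R) :
    (v, v') ∈ graphClosure μY μ hact hsm R := by
  obtain ⟨m, V, ψ, hV, hψ, h1⟩ := exists_partition n (Φ := Φ) hK
  have hv1 : v = ∑ i, QCc.mul (hψ i) v := QCc.ext fun p => by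
    rw [QCc.sec_sum]
    simp only [QCc.sec_mul]
    rw [← Finset.sum_smul]
    by_cases hp : p.base ∈ K
    · rw [← Complex.ofReal_sum, (h1 _ hp).self_of_nhds, Complex.ofReal_one, one_smul]
    · rw [sec_eq_zero (hv _ hp), smul_zero]
  have hz : ∀ i, ∀ p : Cover Φ, p.base ∉ K ∩ tsupport (ψ i) →
      sec (QCc.mul (hψ i) v : ∀ y, QFib τ act y) p = 0 := fun i p hp => by
    rw [QCc.sec_mul]
    by_cases hpK : p.base ∈ K
    · rw [image_eq_zero_of_notMem_tsupport fun h => hp ⟨hpK, h⟩, Complex.ofReal_zero, zero_smul]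
    · rw [sec_eq_zero (hv _ hpK), smul_zero]
  -- The partner `w'` of ψv is left free: for a differential operator it is not ψv', and only the
  -- sum over a partition of unity has to be v'.
  rw [hv1, ← hsum m ψ hψ h1]
  exact sum_mem_graphClosure (μ := μ) hact hsm h0 hadd fun i _ => hloc _ _ _ (hV i) (hz i)

end Partition

variable {G : Type*} [Group G] [TopologicalSpace G] [IsTopologicalGroup G] {T : Subgroup G} [IsTorus T]
  {P : Type*} [Group P] {τ : CentralExtension T P}
  {n : ℕ} {Y : Type*} [TopologicalSpace Y] [ChartedSpace (Eu n) Y] [IsManifold (𝓡 n) ∞ Y] {Φ : Y → T}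
  [ChartedSpace (Eu n) (Cover Φ)] [IsManifold (𝓡 n) ∞ (Cover Φ)] [IsSmoothCover n Φ]
  {S : Cover Φ → Type*} [∀ p, NormedAddCommGroup (S p)] [∀ p, InnerProductSpace ℂ (S p)]
  {E : Y → Type*} [∀ y, NormedAddCommGroup (E y)] [∀ y, InnerProductSpace ℂ (E y)]
  {HS : HermitianBundle n S} {HE : HermitianBundle n E}
  {AS : BundleAction HS fun (x : P) (p : Cover Φ) => p.deck (τ.proj x)}

variable (S E) in
/-- The fibre `S_p ⊗ E_{q(p)}` of the bundle `S ⊗ q^*E`. -/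
abbrev TensorFib (p : Cover Φ) : Type _ := S p ⊗[ℂ] E p.base

/-! ### Equivariant bundle endomorphisms -/

section Endo

lemma actSE_rTensor {A : ∀ p, S p →ₗ[ℂ] S p} (hA : ∀ x p s, AS.map x p (A p s) = A _ (AS.map x p s)) (x : P)
    (p : Cover Φ) (t : S p ⊗[ℂ] E p.base) : actSE E AS x p ((A p).rTensor (E p.base) t) =
      (A (p.deck (τ.proj x))).rTensor (E p.base) (actSE E AS x p t) := by
  induction t with
  | zero => rw [map_zero, map_zero]; exact (map_zero _).symm
  | add t t' h h' => rw [map_add, map_add, h, h', map_add]; exact (map_add _ _ _).symm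
  | tmul s e =>
    rw [LinearMap.rTensor_tmul, actSE_tmul, actSE_tmul, hA]
    exact (LinearMap.rTensor_tmul _ _ _ _).symm

/-- An endomorphism commuting with Π^τ commutes with evaluations and pull-backs, so comparing values
at 1 suffices. -/
lemma isEndoDown_iff (hw : IsTwistedAction (W := TensorFib S E) (actSE E AS))
    {A : ∀ p, S p →ₗ[ℂ] S p} (hA : ∀ x p s, AS.map x p (A p s) = A _ (AS.map x p s))
    (v v' : ∀ y, QFib (W := TensorFib S E) τ (actSE E AS) y) :
    IsEndoDown A v v' ↔ IsEndoUp A (sec (W := TensorFib S E) v)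
      (sec (W := TensorFib S E) v') := by
  refine ⟨fun h p => ?_, fun h p => ev_ext τ fun x => ?_⟩
  · rw [sec, h p, ev_lTensor]; rfl
  · rw [ev_lTensor, ev_upstairs (W := TensorFib S E), ev_upstairs (W := TensorFib S E)]
    refine pull_eq (W := TensorFib S E) ?_
    rw [actSE_rTensor hA, hw.act_pull, h]
    rfl

lemma isEndoUp_zero (A : ∀ p, S p →ₗ[ℂ] S p) : IsEndoUp (E := E) A 0 0 := fun p => (map_zero _).symm

lemma IsEndoUp.add {A : ∀ p, S p →ₗ[ℂ] S p} {σ₁ σ₁' σ₂ σ₂' : ∀ p : Cover Φ, S p ⊗[ℂ] E p.base}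
    (h₁ : IsEndoUp A σ₁ σ₁') (h₂ : IsEndoUp A σ₂ σ₂') : IsEndoUp A (σ₁ + σ₂) (σ₁' + σ₂') := fun p => by
  rw [Pi.add_apply, Pi.add_apply, h₁ p, h₂ p, map_add]

lemma IsEndoUp.smul {A : ∀ p, S p →ₗ[ℂ] S p} {σ σ' : ∀ p : Cover Φ, S p ⊗[ℂ] E p.base}
    (h : IsEndoUp A σ σ') (f : Cover Φ → ℂ) : IsEndoUp A (fun p => f p • σ p) (fun p => f p • σ' p) := fun p => by
  change f p • σ' p = _
  rw [h p, map_smul]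

lemma IsEndoUp.trunc {A : ∀ p, S p →ₗ[ℂ] S p} {σ σ' : ∀ p : Cover Φ, S p ⊗[ℂ] E p.base}
    (h : IsEndoUp A σ σ') (V : Set (Cover Φ)) (F : Finset (Lattice T)) :
    IsEndoUp A (trunc (W := TensorFib S E) V F σ)
      (trunc (W := TensorFib S E) V F σ') := fun p => by
  rw [PiCover.trunc, PiCover.trunc]
  split_ifs
  · exact h p
  · exact (map_zero _).symm

variable [T2Space Y] [SecondCountableTopology Y]
  [MeasurableSpace Y] [BorelSpace Y] [MeasurableSpace (Cover Φ)] [BorelSpace (Cover Φ)]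
  {μY : Measure Y} [IsFiniteMeasureOnCompacts μY] {μ : Measure (Cover Φ)} [IsFiniteMeasureOnCompacts μ]

/-- A fibrewise linear operator commutes with multiplication by functions and with truncation, so
both members of the pair can be cut off in the same way. -/
lemma mem_graphClosure_endo (hact : IsTwistedAction (W := TensorFib S E) (actSE E AS))
    (hsm : ∀ g σ, (bundleSE HS HE).SmoothOn σ Set.univ →
      (bundleSE HS HE).SmoothOn (pull (W := TensorFib S E) (actSE E AS) g σ) Set.univ)
    {A : ∀ p, S p →ₗ[ℂ] S p} (hA : ∀ x p s, AS.map x p (A p s) = A _ (AS.map x p s))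
    {v v' : QCc (bundleSE HS HE) τ (actSE E AS) μY} (h : IsEndoDown A v.1 v'.1) :
    (v, v') ∈ graphClosure μY μ hact hsm (IsEndoUp A) := by
  obtain ⟨K, hK, hv⟩ := v.2.2
  have h' := (isEndoDown_iff hact hA _ _).1 h
  have hv0 : ∀ p : Cover Φ, p.base ∉ K → sec (W := TensorFib S E) v'.1 p = 0 := fun p hp => by
    rw [h' p, sec_eq_zero (W := TensorFib S E) (hv _ hp), map_zero]
  refine mem_graphClosure_of_partition (μ := μ) hact hsm (isEndoUp_zero A)
    (fun _ _ _ _ h₁ h₂ => IsEndoUp.add h₁ h₂) hK hv (fun ψ hψ => QCc.mul hψ v') ?_ ?_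
  · intro m ψ hψ h1
    refine QCc.ext fun p => ?_
    rw [QCc.sec_sum]
    simp only [QCc.sec_mul]
    rw [← Finset.sum_smul]
    by_cases hp : p.base ∈ K
    · rw [← Complex.ofReal_sum, (h1 _ hp).self_of_nhds, Complex.ofReal_one, one_smul]
    · exact (congrArg _ (hv0 p hp)).trans ((smul_zero _).trans (hv0 p hp).symm)
  · intro ψ hψ V hV hz
    have hup : IsEndoUp A (sec (W := TensorFib S E) (QCc.mul hψ v).1)
        (sec (W := TensorFib S E) (QCc.mul hψ v').1) := by
      rw [funext (QCc.sec_mul hψ v), funext (QCc.sec_mul hψ v')]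
      exact h'.smul _
    refine mem_closure_of_trunc (μ := μ) hact hsm hV hV hz (fun p hp => ?_) (Equiv.refl _) fun F => ?_
    · rw [hup p, hz p hp, map_zero]
    · have he : F.map (Equiv.refl (Lattice T)).toEmbedding = F := by simp
      rw [he]
      exact hup.trunc V F

end Endo

end Relations

end PiCover

end

noncomputable section

namespace PiCover

/-! ### Translations by elements of `N(T)` -/

section Translations

open MeasureTheory Filter Topology

variable {G : Type*} [Group G] [TopologicalSpace G] [IsTopologicalGroup G] {T : Subgroup G} [IsTorus T]
  {P : Type*} [Group P] {τ : CentralExtension T P}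
  {n : ℕ} {Y : Type*} [TopologicalSpace Y] [ChartedSpace (Eu n) Y] [IsManifold (𝓡 n) ∞ Y] {Φ : Y → T}
  [ChartedSpace (Eu n) (Cover Φ)] [IsManifold (𝓡 n) ∞ (Cover Φ)] [IsSmoothCover n Φ]
  {S : Cover Φ → Type*} [∀ p, NormedAddCommGroup (S p)] [∀ p, InnerProductSpace ℂ (S p)]
  {E : Y → Type*} [∀ y, NormedAddCommGroup (E y)] [∀ y, InnerProductSpace ℂ (E y)]
  {HS : HermitianBundle n S} {HE : HermitianBundle n E}
  {AS : BundleAction HS fun (x : P) (p : Cover Φ) => p.deck (τ.proj x)}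
  [MulAction (Nrm T) Y] {hΦ : ∀ (m : Nrm T) y, Φ (m • y) = m • Φ y}
  {NS : BundleAction HS (Cover.conj hΦ)} {NE : BundleAction HE fun (m : Nrm T) y => m • y}

/-- With the E-factor treated first, what remains is a map of S tensored with a fixed fibre, as
required by `sigma_rTensor_eq`. -/
lemma normSE_apply (m : Nrm T) (p : Cover Φ) (t : S p ⊗[ℂ] E p.base) : normSE NS NE m p t =
    (NS.map m p).toLinearMap.rTensor (E (m • p.base)) ((NE.map m p.base).toLinearMap.lTensor (S p) t) := by
  induction t with
  | zero => rw [map_zero, map_zero]; exact (map_zero _).symm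
  | add t t' h h' => rw [map_add, map_add, h, h']; exact (map_add _ _ _).symm
  | tmul s e => rfl

lemma lTensor_actSE (m : Nrm T) (x : P) (p : Cover Φ) (t : S p ⊗[ℂ] E p.base) :
    (NE.map m p.base).toLinearMap.lTensor (S (p.deck (τ.proj x))) (actSE E AS x p t) =
      (AS.map x p).toLinearMap.rTensor (E (m • p.base)) ((NE.map m p.base).toLinearMap.lTensor (S p) t) := by
  induction t with
  | zero => rw [map_zero, map_zero, map_zero]; exact map_zero _
  | add t t' h h' => rw [map_add, map_add, map_add, ← h, ← h']; exact map_add _ _ _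
  | tmul s e => rfl

/-- The actions of `N(T)` and `Π^τ` on `S ⊗ q^*E` combine to an action of `N(T) ⋉ Π^τ`. -/
lemma sigma_normSE_actSE
    (hNA : ∀ (m : Nrm T) (x : P) p (s : S p), (⟨_, NS.map m _ (AS.map x p s)⟩ : Σ p, S p) =
      ⟨_, AS.map (τ.conj m x) _ (NS.map m p s)⟩) (m : Nrm T) (x : P) (p : Cover Φ) (t : S p ⊗[ℂ] E p.base) :
    (⟨_, normSE NS NE m _ (actSE E AS x p t)⟩ : Σ p, TensorFib S E p) =
      ⟨_, actSE E AS (τ.conj m x) _ (normSE NS NE m p t)⟩ := by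
  have h := sigma_rTensor_eq (E := E) ((p.deck (τ.proj x)).conj hΦ m).2
    ((p.conj hΦ m).deck (τ.proj (τ.conj m x))).2
    ((NS.map m _).toLinearMap ∘ₗ (AS.map x p).toLinearMap)
    ((AS.map (τ.conj m x) _).toLinearMap ∘ₗ (NS.map m p).toLinearMap) (hNA m x p)
    ((NE.map m p.base).toLinearMap.lTensor (S p) t)
  have h1 : normSE NS NE m _ (actSE E AS x p t) = ((NS.map m (p.deck (τ.proj x))).toLinearMap ∘ₗ
      (AS.map x p).toLinearMap).rTensor (E (m • p.base)) ((NE.map m p.base).toLinearMap.lTensor (S p) t) := by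
    refine (normSE_apply m (p.deck (τ.proj x)) (actSE E AS x p t)).trans ?_
    refine (congrArg _ (lTensor_actSE m x p t)).trans ?_
    exact (LinearMap.rTensor_comp_apply (E (m • p.base)) (NS.map m (p.deck (τ.proj x))).toLinearMap
      (AS.map x p).toLinearMap _).symm
  have h2 : actSE E AS (τ.conj m x) _ (normSE NS NE m p t) = ((AS.map (τ.conj m x) (p.conj hΦ m)).toLinearMap ∘ₗ
      (NS.map m p).toLinearMap).rTensor (E (m • p.base)) ((NE.map m p.base).toLinearMap.lTensor (S p) t) := by
    rw [normSE_apply]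
    exact (LinearMap.rTensor_comp_apply (E (m • p.base)) (AS.map (τ.conj m x) (p.conj hΦ m)).toLinearMap
      (NS.map m p).toLinearMap _).symm
  rw [h2]
  exact (congrArg _ h1).trans h

/-- Conjugation fixes 1 ∈ Π^τ, so evaluation at 1 is N(T)-equivariant. Conversely, the translate at
x involves the value at m⁻¹xm, which the semidirect product relation turns back into a value at x.
-/
lemma isTranslateDown_iff (hw : IsTwistedAction (W := TensorFib S E) (actSE E AS))
    (hNA : ∀ (m : Nrm T) (x : P) p (s : S p), (⟨_, NS.map m _ (AS.map x p s)⟩ : Σ p, S p) =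
      ⟨_, AS.map (τ.conj m x) _ (NS.map m p s)⟩) (m : Nrm T)
    (v v' : ∀ y, QFib (W := TensorFib S E) τ (actSE E AS) y) :
    IsTranslateDown NS NE m v v' ↔ IsTranslateUp NS NE m (sec (W := TensorFib S E) v)
      (sec (W := TensorFib S E) v') := by
  refine ⟨fun h p => ?_, fun h p => ev_ext τ fun x => ?_⟩
  · rw [sec, h p, ev_mapIsometry_conjRep, map_one]; rfl
  · rw [ev_mapIsometry_conjRep, ev_upstairs (W := TensorFib S E), ev_upstairs (W := TensorFib S E)]
    refine pull_eq (W := TensorFib S E) ?_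
    refine eq_of_sigma_eq (W := TensorFib S E) (b' := (p.deck (τ.proj (τ.conj m⁻¹ x))).conj hΦ m) _ ?_
    rw [h, ← hw.act_pull (τ.conj m⁻¹ x) (sec (W := TensorFib S E) v) p, sigma_normSE_actSE hNA]
    have : τ.conj m (τ.conj m⁻¹ x) = x := by
      rw [← MulAut.mul_apply, ← map_mul, mul_inv_cancel, map_one, MulAut.one_apply]
    rw [this]

lemma isTranslateUp_zero (m : Nrm T) : IsTranslateUp NS NE m 0 0 := fun p => (map_zero (normSE NS NE m p)).symm

lemma IsTranslateUp.add {m : Nrm T} {σ₁ σ₁' σ₂ σ₂' : ∀ p : Cover Φ, S p ⊗[ℂ] E p.base}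
    (h₁ : IsTranslateUp NS NE m σ₁ σ₁') (h₂ : IsTranslateUp NS NE m σ₂ σ₂') :
    IsTranslateUp NS NE m (σ₁ + σ₂) (σ₁' + σ₂') := fun p => by
  rw [Pi.add_apply, Pi.add_apply, h₁ p, h₂ p, map_add]

/-- The element m carries ηV to (m·η)(mV). So truncating along V and F before the translation is
truncating along mV and m·F after it. -/
lemma IsTranslateUp.trunc {m : Nrm T} {σ σ' : ∀ p : Cover Φ, S p ⊗[ℂ] E p.base}
    (h : IsTranslateUp NS NE m σ σ') (V : Set (Cover Φ)) (F : Finset (Lattice T)) :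
    IsTranslateUp NS NE m (trunc (W := TensorFib S E) V F σ)
      (trunc (W := TensorFib S E) ((fun p : Cover Φ => p.conj hΦ m) '' V) (F.map (latticeConj τ m).toEmbedding) σ') := fun p => by
  have hd : ∀ η : Lattice T, (p.conj hΦ m).deck (latticeConj τ m η)⁻¹ = (p.deck η⁻¹).conj hΦ m := fun η => by
    have h1 := Cover.deck_conj hΦ τ m (τ.lift η)⁻¹ p
    rw [map_inv, τ.proj_lift, map_inv, map_inv] at h1
    exact h1.symm
  have hinj : Function.Injective fun p : Cover Φ => p.conj hΦ m :=
    Function.LeftInverse.injective (g := fun p : Cover Φ => p.conj hΦ m⁻¹) fun p => Cover.conj_inv_conj hΦ m p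
  have key : (∃ ζ ∈ F.map (latticeConj τ m).toEmbedding,
      (p.conj hΦ m).deck ζ⁻¹ ∈ (fun p : Cover Φ => p.conj hΦ m) '' V) ↔ ∃ η ∈ F, p.deck η⁻¹ ∈ V := by
    simp only [Finset.mem_map_equiv]
    constructor
    · rintro ⟨ζ, hζ, hV⟩
      refine ⟨_, hζ, ?_⟩
      obtain ⟨η, rfl⟩ := (latticeConj τ m).surjective ζ
      rw [hd, hinj.mem_set_image] at hV
      rwa [Equiv.symm_apply_apply]
    · rintro ⟨η, hη, hV⟩
      exact ⟨latticeConj τ m η, by rwa [Equiv.symm_apply_apply], by rw [hd, hinj.mem_set_image]; exact hV⟩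
  by_cases hc : ∃ η ∈ F, p.deck η⁻¹ ∈ V
  · have h1 : PiCover.trunc (W := TensorFib S E) V F σ p = σ p := if_pos hc
    have h2 : PiCover.trunc (W := TensorFib S E) ((fun p : Cover Φ => p.conj hΦ m) '' V)
      (F.map (latticeConj τ m).toEmbedding) σ' (p.conj hΦ m) = σ' (p.conj hΦ m) := if_pos (key.2 hc)
    rw [h1, h2, h p]
  · have h1 : PiCover.trunc (W := TensorFib S E) V F σ p = 0 := if_neg hc
    have h2 : PiCover.trunc (W := TensorFib S E) ((fun p : Cover Φ => p.conj hΦ m) '' V)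
      (F.map (latticeConj τ m).toEmbedding) σ' (p.conj hΦ m) = 0 := if_neg fun h => hc (key.1 h)
    rw [h1, h2, map_zero]

variable [T2Space Y] [SecondCountableTopology Y]
  [MeasurableSpace Y] [BorelSpace Y] [MeasurableSpace (Cover Φ)] [BorelSpace (Cover Φ)]
  {μY : Measure Y} [IsFiniteMeasureOnCompacts μY] {μ : Measure (Cover Φ)} [IsFiniteMeasureOnCompacts μ]

lemma IsSheetOver.conj {m : Nrm T} (hm : Continuous fun y : Y => m • y) (hm' : Continuous fun y : Y => m⁻¹ • y)
    {V : Set (Cover Φ)} {K : Set Y} (h : IsSheetOver V K) :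
    IsSheetOver ((fun p : Cover Φ => p.conj hΦ m) '' V) ((fun y => m • y) '' K) where
  isOpen := by
    have : (fun p : Cover Φ => p.conj hΦ m) '' V = (fun p : Cover Φ => p.conj hΦ m⁻¹) ⁻¹' V :=
      congrFun (Set.image_eq_preimage_of_inverse (Cover.conj_inv_conj hΦ m) (Cover.conj_conj_inv hΦ m)) V
    rw [this]
    exact h.isOpen.preimage (Cover.continuous_conj hΦ hm')
  injOn := by
    rintro _ ⟨p, hp, rfl⟩ _ ⟨p', hp', rfl⟩ hpp
    have h1 : m • p.base = m • p'.base := hpp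
    rw [h.injOn hp hp' (smul_left_cancel m h1)]
  isCompact := h.isCompact.image hm
  subset := by
    rintro _ ⟨y, hy, rfl⟩
    obtain ⟨p, hp, rfl⟩ := h.subset hy
    exact ⟨_, ⟨p, hp, rfl⟩, rfl⟩

/-- Translation turns the cut-off ψ of v into the cut-off ψ ∘ m⁻¹ of v'; the sheets and index sets
move along by `IsTranslateUp.trunc`. -/
lemma mem_graphClosure_translate (hact : IsTwistedAction (W := TensorFib S E) (actSE E AS))
    (hsm : ∀ g σ, (bundleSE HS HE).SmoothOn σ Set.univ →
      (bundleSE HS HE).SmoothOn (pull (W := TensorFib S E) (actSE E AS) g σ) Set.univ)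
    (hNA : ∀ (m : Nrm T) (x : P) p (s : S p), (⟨_, NS.map m _ (AS.map x p s)⟩ : Σ p, S p) =
      ⟨_, AS.map (τ.conj m x) _ (NS.map m p s)⟩)
    (hsmul : ∀ m : Nrm T, ContMDiff (𝓡 n) (𝓡 n) ∞ fun y : Y => m • y) {m : Nrm T}
    {v v' : QCc (bundleSE HS HE) τ (actSE E AS) μY} (h : IsTranslateDown NS NE m v.1 v'.1) :
    (v, v') ∈ graphClosure μY μ hact hsm (IsTranslateUp NS NE m) := by
  obtain ⟨K, hK, hv⟩ := v.2.2
  have h' := (isTranslateDown_iff hact hNA m _ _).1 h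
  have hψ' : ∀ ψ : Y → ℝ, ContMDiff (𝓡 n) 𝓘(ℝ, ℝ) ∞ ψ → ContMDiff (𝓡 n) 𝓘(ℝ, ℝ) ∞ fun y => ψ (m⁻¹ • y) :=
    fun ψ hψ => hψ.comp (hsmul m⁻¹)
  refine mem_graphClosure_of_partition (μ := μ) hact hsm (isTranslateUp_zero m)
    (fun _ _ _ _ h₁ h₂ => IsTranslateUp.add h₁ h₂) hK hv (fun ψ hψ => QCc.mul (hψ' ψ hψ) v') ?_ ?_
  · intro k ψ hψ h1
    refine QCc.ext fun p => ?_
    rw [QCc.sec_sum]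
    simp only [QCc.sec_mul]
    rw [← Finset.sum_smul]
    obtain ⟨p, rfl⟩ : ∃ p', p = Cover.conj hΦ m p' := ⟨p.conj hΦ m⁻¹, (Cover.conj_conj_inv hΦ m p).symm⟩
    simp only [Cover.base_conj, inv_smul_smul]
    by_cases hp : p.base ∈ K
    · rw [← Complex.ofReal_sum, (h1 _ hp).self_of_nhds, Complex.ofReal_one, one_smul]
    · have h0 : sec (W := TensorFib S E) v'.1 (p.conj hΦ m) = 0 := by
        rw [h' p, sec_eq_zero (W := TensorFib S E) (hv _ hp), map_zero]
      exact (congrArg _ h0).trans ((smul_zero _).trans h0.symm)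
  · intro ψ hψ V hV hz
    have hup : IsTranslateUp NS NE m (sec (W := TensorFib S E) (QCc.mul hψ v).1)
        (sec (W := TensorFib S E) (QCc.mul (hψ' ψ hψ) v').1) := fun p => by
      have h1 : ψ (m⁻¹ • (p.conj hΦ m).base) = ψ p.base := by rw [Cover.base_conj, inv_smul_smul]
      rw [QCc.sec_mul, QCc.sec_mul, h' p, h1, map_smul]
    refine mem_closure_of_trunc (μ := μ) hact hsm hV (hV.conj (hΦ := hΦ) (hsmul m).continuous (hsmul m⁻¹).continuous)
      hz (fun p hp => ?_) (latticeConj τ m) fun F => hup.trunc V F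
    obtain ⟨p, rfl⟩ : ∃ p', p = Cover.conj hΦ m p' := ⟨p.conj hΦ m⁻¹, (Cover.conj_conj_inv hΦ m p).symm⟩
    rw [hup p, hz p fun h => hp ⟨_, h, rfl⟩, map_zero]

end Translations

end PiCover

end

noncomputable section

namespace PiCover

/-! ### The Dirac operator -/

section Dirac

open MeasureTheory Filter Topology

section Contraction

variable {n : ℕ} {B : Type*} [TopologicalSpace B] [ChartedSpace (Eu n) B] {M : Type*} [AddCommGroup M] [Module ℂ M]
  {M' : Type*} [AddCommGroup M'] [Module ℂ M'] (x : B)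

/-- The metric contraction of a bilinear form on a tangent space. -/
def contractionAt (β : TangentSpace (𝓡 n) x → TangentSpace (𝓡 n) x → ℝ) (cl : TangentSpace (𝓡 n) x → M →ₗ[ℂ] M)
    (α : TangentSpace (𝓡 n) x → M) : M := contraction (n := n) β cl α

variable (β : TangentSpace (𝓡 n) x → TangentSpace (𝓡 n) x → ℝ) (cl : TangentSpace (𝓡 n) x → M →ₗ[ℂ] M)

lemma contractionAt_map (f : M →ₗ[ℂ] M') {cl : TangentSpace (𝓡 n) x → M →ₗ[ℂ] M}
    {cl' : TangentSpace (𝓡 n) x → M' →ₗ[ℂ] M'} {α : TangentSpace (𝓡 n) x → M} {α' : TangentSpace (𝓡 n) x → M'}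
    (hcl : ∀ v m, f (cl v m) = cl' v (f m)) (hα : ∀ v, f (α v) = α' v) :
    f (contractionAt x β cl α) = contractionAt x β cl' α' :=
  contraction_map (n := n) f β hcl hα

lemma contractionAt_add (α α' : TangentSpace (𝓡 n) x → M) : contractionAt x β cl (fun v => α v + α' v) =
    contractionAt x β cl α + contractionAt x β cl α' := contraction_add (n := n) β cl α α'

lemma contractionAt_smul (c : ℂ) (α : TangentSpace (𝓡 n) x → M) : contractionAt x β cl (fun v => c • α v) =
    c • contractionAt x β cl α := contraction_smul (n := n) β cl c α

lemma contractionAt_zero : contractionAt x β cl (fun _ => 0) = 0 := by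
  simp [contractionAt, contraction]

lemma contractionAt_sum {ι : Type*} (s : Finset ι) (α : ι → TangentSpace (𝓡 n) x → M) :
    contractionAt x β cl (fun v => ∑ i ∈ s, α i v) = ∑ i ∈ s, contractionAt x β cl (α i) := by
  classical
  induction s using Finset.induction_on with
  | empty => simpa using contractionAt_zero x β cl
  | insert a s ha ih =>
    simp only [Finset.sum_insert ha]
    rw [contractionAt_add, ih]

end Contraction

variable {G : Type*} [Group G] [TopologicalSpace G] [IsTopologicalGroup G] {T : Subgroup G} [IsTorus T]
  {P : Type*} [Group P] {τ : CentralExtension T P}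
  {n : ℕ} {Y : Type*} [TopologicalSpace Y] [ChartedSpace (Eu n) Y] [IsManifold (𝓡 n) ∞ Y] {Φ : Y → T}
  [ChartedSpace (Eu n) (Cover Φ)] [IsManifold (𝓡 n) ∞ (Cover Φ)] [IsSmoothCover n Φ]
  {S : Cover Φ → Type*} [∀ p, NormedAddCommGroup (S p)] [∀ p, InnerProductSpace ℂ (S p)]
  {E : Y → Type*} [∀ y, NormedAddCommGroup (E y)] [∀ y, InnerProductSpace ℂ (E y)]
  {HS : HermitianBundle n S} {HE : HermitianBundle n E}
  {AS : BundleAction HS fun (x : P) (p : Cover Φ) => p.deck (τ.proj x)}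
  {g : Metric n Y} (CS : CliffordModule HS (g.lift Φ))

lemma Metric.lift_add_left (g : Metric n Y) (p : Cover Φ) (v v' w : TangentSpace (𝓡 n) p) :
    g.lift Φ p (v + v') w = g.lift Φ p v w + g.lift Φ p v' w := by simp [Metric.lift, Metric.form]

lemma Metric.lift_smul_left (g : Metric n Y) (p : Cover Φ) (r : ℝ) (v w : TangentSpace (𝓡 n) p) :
    g.lift Φ p (r • v) w = r • g.lift Φ p v w := by simp [Metric.lift, Metric.form]

lemma Metric.lift_add_right (g : Metric n Y) (p : Cover Φ) (v w w' : TangentSpace (𝓡 n) p) :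
    g.lift Φ p v (w + w') = g.lift Φ p v w + g.lift Φ p v w' := by simp [Metric.lift, Metric.form]

lemma Metric.lift_smul_right (g : Metric n Y) (p : Cover Φ) (r : ℝ) (v w : TangentSpace (𝓡 n) p) :
    g.lift Φ p v (r • w) = r • g.lift Φ p v w := by simp [Metric.lift, Metric.form]

variable (Φ) in
/-- The metric on `𝒴` in the frame `A` of the tangent space. -/
lemma contraction_lift_comp (g : Metric n Y) {M : Type*} [AddCommGroup M] [Module ℂ M] (p : Cover Φ)
    (A : Eu n ≃ₗ[ℝ] TangentSpace (𝓡 n) p)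
    {cl : TangentSpace (𝓡 n) p → M →ₗ[ℂ] M} {α : TangentSpace (𝓡 n) p → M}
    (hcl_add : ∀ v w x, cl (v + w) x = cl v x + cl w x)
    (hcl_smul : ∀ (r : ℝ) v x, cl (r • v) x = (r : ℂ) • cl v x)
    (hα_add : ∀ v w, α (v + w) = α v + α w) (hα_smul : ∀ (r : ℝ) v, α (r • v) = (r : ℂ) • α v) :
    contraction (fun v w => g.lift Φ p (A v) (A w)) (fun v => cl (A v)) (fun v => α (A v)) =
      contractionAt p (g.lift Φ p) cl α :=
  contraction_comp (LinearMap.mk₂ ℝ (g.lift Φ p) (g.lift_add_left p) (g.lift_smul_left p) (g.lift_add_right p)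
    (g.lift_smul_right p)) A hcl_add hcl_smul hα_add hα_smul

lemma CliffordModule.cHat_add (p : Cover Φ) (v w : TangentSpace (𝓡 n) p) :
    CS.cHat p (v + w) = CS.cHat p v + CS.cHat p w := LinearMap.ext fun s => by
  simp only [cHat, LinearMap.comp_apply, CS.map_add, LinearMap.add_apply]

lemma CliffordModule.cHat_smul (p : Cover Φ) (r : ℝ) (v : TangentSpace (𝓡 n) p) :
    CS.cHat p (r • v) = (r : ℂ) • CS.cHat p v := LinearMap.ext fun s => by
  simp only [cHat, LinearMap.comp_apply, CS.map_smul, LinearMap.smul_apply]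

variable (Φ) in
/-- The contraction over `𝒴` as a contraction over `Y`. -/
lemma contraction_lift (g : Metric n Y) {M : Type*} [AddCommGroup M] [Module ℂ M] (p : Cover Φ)
    {cl : TangentSpace (𝓡 n) p → M →ₗ[ℂ] M} {α : TangentSpace (𝓡 n) p → M}
    (hcl_add : ∀ v w x, cl (v + w) x = cl v x + cl w x)
    (hcl_smul : ∀ (r : ℝ) v x, cl (r • v) x = (r : ℂ) • cl v x)
    (hα_add : ∀ v w, α (v + w) = α v + α w) (hα_smul : ∀ (r : ℝ) v, α (r • v) = (r : ℂ) • α v) :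
    contractionAt p (g.lift Φ p) cl α =
      contractionAt p.base (g.form p.base) (fun w => cl (dqInv p w)) (fun w => α (dqInv p w)) := by
  -- A change of basis along dq⁻¹, under which the lifted metric becomes g.
  have h := contraction_lift_comp Φ g p (LinearEquiv.ofLinearMap (dqInv p).toLinearMap (dq p).toLinearMap
    (LinearMap.ext (dqInv_dq p)) (LinearMap.ext (dq_dqInv p))) hcl_add hcl_smul hα_add hα_smul
  have h1 : (fun v w => g.lift Φ p (dqInv p v) (dqInv p w)) = g.form p.base := by
    funext v w
    rw [Metric.lift, dq_dqInv, dq_dqInv]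
  rw [← h1]
  exact h.symm

variable (DS : HermitianConnection HS) (DE : HermitianConnection HE)

/-- The value of `Dσ` at `p`, computed with tangent vectors of `Y`. -/
def diracAt (σ : ∀ p : Cover Φ, S p ⊗[ℂ] E p.base) (p : Cover Φ) : S p ⊗[ℂ] E p.base :=
  contractionAt p.base (g.form p.base) (fun w => (CS.cHat p (dqInv p w)).rTensor (E p.base))
    (fun w => tensorNabla DS DE Cover.base σ p (dqInv p w))

/-- Contracting over the tangent space of Y at q(p) gives all points of an orbit the same summation
indices, so values at p and at ηp can be compared term by term. -/
lemma isDiracUp_iff {σ σ' : ∀ p : Cover Φ, S p ⊗[ℂ] E p.base} :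
    IsDiracUp CS DS DE σ σ' ↔ ∀ p, σ' p = diracAt CS DS DE σ p := by
  have h : ∀ p : Cover Φ, diracAt CS DS DE σ p = contractionAt p (g.lift Φ p)
      (fun v => (CS.cHat p v).rTensor (E p.base)) (tensorNabla DS DE Cover.base σ p) := fun p =>
    (contraction_lift Φ g p (cl := fun v => (CS.cHat p v).rTensor (E p.base))
      (fun v w x => by rw [CS.cHat_add, LinearMap.rTensor_add, LinearMap.add_apply])
      (fun r v x => by rw [CS.cHat_smul, LinearMap.rTensor_smul, LinearMap.smul_apply])
      (tensorNabla_map_add DS DE σ p) (tensorNabla_map_smul DS DE σ p)).symm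
  simp only [h]
  rfl

lemma diracAt_congr {σ σ' : ∀ p : Cover Φ, S p ⊗[ℂ] E p.base} {p : Cover Φ} (h : ∀ᶠ x in 𝓝 p, σ x = σ' x) :
    diracAt CS DS DE σ p = diracAt CS DS DE σ' p := by
  simp only [diracAt, tensorNabla_congr DS DE h]

lemma diracAt_zero (p : Cover Φ) : diracAt CS DS DE (0 : ∀ p : Cover Φ, S p ⊗[ℂ] E p.base) p = 0 := by
  rw [diracAt]
  have h : ∀ w, tensorNabla DS DE Cover.base (0 : ∀ p : Cover Φ, S p ⊗[ℂ] E p.base) p (dqInv p w) = 0 :=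
    fun w => tensorNabla_zero DS DE p _
  simp only [h]
  exact contractionAt_zero _ _ _

lemma diracAt_add {σ σ' : ∀ p : Cover Φ, S p ⊗[ℂ] E p.base} (hσ : (bundleSE HS HE).SmoothOn σ Set.univ)
    (hσ' : (bundleSE HS HE).SmoothOn σ' Set.univ) (p : Cover Φ) :
    diracAt CS DS DE (σ + σ') p = diracAt CS DS DE σ p + diracAt CS DS DE σ' p := by
  rw [diracAt, diracAt, diracAt, ← contractionAt_add]
  congr 1
  funext w
  exact tensorNabla_add (contMDiff_base n Φ) DS DE isOpen_univ hσ hσ' trivial _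

variable {CS} in
lemma map_cHat (hCA : CS.IsEquivariant AS) (x : P) (p : Cover Φ) (w : TangentSpace (𝓡 n) p.base) (s : S p) :
    AS.map x p (CS.cHat p (dqInv p w) s) =
      CS.cHat (p.deck (τ.proj x)) (dqInv (p.deck (τ.proj x)) w) (AS.map x p s) := by
  have h1 := (hCA x p s).1
  have h2 := (hCA x p (CS.grading p s)).2 (dqInv p w)
  have h3 := dqInv_deck (τ.proj x) p w
  change AS.map x p (CS.c p (dqInv p w) (CS.grading p s)) = CS.c (p.deck (τ.proj x)) (dqInv (p.deck (τ.proj x)) w)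
    (CS.grading (p.deck (τ.proj x)) (AS.map x p s))
  rw [h1, ← h2, h3]

variable {CS} in
lemma actSE_cHat (hCA : CS.IsEquivariant AS) (x : P) (p : Cover Φ) (w : TangentSpace (𝓡 n) p.base)
    (t : S p ⊗[ℂ] E p.base) : actSE E AS x p ((CS.cHat p (dqInv p w)).rTensor (E p.base) t) =
      (CS.cHat (p.deck (τ.proj x)) (dqInv (p.deck (τ.proj x)) w)).rTensor (E p.base) (actSE E AS x p t) := by
  induction t with
  | zero => rw [map_zero, map_zero]; exact (map_zero _).symm
  | add t t' h h' => rw [map_add, map_add, h, h', map_add]; exact (map_add _ _ _).symm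
  | tmul s e =>
    rw [LinearMap.rTensor_tmul, actSE_tmul, actSE_tmul, map_cHat hCA]
    exact (LinearMap.rTensor_tmul _ _ _ _).symm

-- Lifted tangent vectors, Clifford action and connection are each compatible with Π^τ, hence so is
-- the Dirac operator.
variable {CS} in
lemma actSE_diracAt_pull [T2Space Y] (hw : IsTwistedAction (W := S) AS.map) (hCA : CS.IsEquivariant AS)
    (hDA : DS.IsInvariant AS) (x : P) {σ : ∀ p : Cover Φ, S p ⊗[ℂ] E p.base}
    (hσ : (bundleSE HS HE).SmoothOn σ Set.univ) (p : Cover Φ) :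
    actSE E AS x p (diracAt CS DS DE (pull (W := TensorFib S E) (actSE E AS) x σ) p) =
      diracAt CS DS DE σ (p.deck (τ.proj x)) := by
  refine contractionAt_map p.base _ (actSE E AS x p).toLinearMap (fun w t => actSE_cHat hCA x p w t) fun w => ?_
  refine (actSE_tensorNabla_pull hw DS DE hDA x hσ p (dqInv p w)).trans ?_
  exact congrArg _ (dqInv_deck (τ.proj x) p w).symm

-- Evaluation at x passes through contraction and connection, so D^E v evaluated at x is D applied
-- to the pull-back of `sec v` by x. Invariance of D identifies this with the pull-back of D(sec v).
variable {CS} in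
lemma isDiracDown_iff [T2Space Y] (hw : IsTwistedAction (W := S) AS.map)
    (hact : IsTwistedAction (W := TensorFib S E) (actSE E AS)) (hCA : CS.IsEquivariant AS)
    (hDA : DS.IsInvariant AS) {v v' : ∀ y, QFib (W := TensorFib S E) τ (actSE E AS) y}
    (hv : QSmooth (bundleSE HS HE) v) :
    IsDiracDown CS DS DE v v' ↔ IsDiracUp CS DS DE (sec (W := TensorFib S E) v) (sec (W := TensorFib S E) v') := by
  have key : ∀ (x : P) (p : Cover Φ), ev τ x (contractionAt p.base (g.form p.base)
      (fun w => ((CS.cHat p (dqInv p w)).rTensor (E p.base)).lTensor (L2tau τ))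
      (fun w => hilbertNabla (L2tau τ) (bundleSE HS HE) (tensorNabla DS DE Cover.base)
        (upstairs (W := TensorFib S E) v) p (dqInv p w))) =
      diracAt CS DS DE (pull (W := TensorFib S E) (actSE E AS) x (sec (W := TensorFib S E) v)) p := fun x p => by
    refine contractionAt_map p.base _ (ev τ x) (fun w t => ev_lTensor τ x _ t) fun w => ?_
    rw [ev_hilbertNabla DS DE x hv]
    congr 1
    exact funext fun p => ev_upstairs (W := TensorFib S E) v x p
  rw [isDiracUp_iff]
  refine ⟨fun h p => ?_, fun h p => ev_ext τ fun x => ?_⟩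
  · rw [sec, h p]
    refine (key 1 p).trans ?_
    rw [hact.pull_one]
  · refine Eq.trans ?_ (key x p).symm
    rw [ev_upstairs (W := TensorFib S E)]
    refine pull_eq (W := TensorFib S E) ?_
    rw [actSE_diracAt_pull DS DE hw hCA hDA x (smoothOn_sec hv), h]

/-- Clifford multiplication (twisted by the grading) with the gradient of a function on `Y`. -/
def gradCliff (ψ : Y → ℝ) (p : Cover Φ) : S p →ₗ[ℂ] S p where
  toFun s := contractionAt p.base (g.form p.base) (fun w => CS.cHat p (dqInv p w)) (fun w => ((dAt ψ p.base w : ℝ) : ℂ) • s)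
  map_add' s s' := by simp only [smul_add]; exact contractionAt_add _ _ _ _ _
  map_smul' c s := by
    simp only [smul_comm _ c s]
    exact contractionAt_smul _ _ _ _ _

lemma gradCliff_apply (ψ : Y → ℝ) (p : Cover Φ) (s : S p) : gradCliff CS ψ p s =
    contractionAt p.base (g.form p.base) (fun w => CS.cHat p (dqInv p w)) (fun w => ((dAt ψ p.base w : ℝ) : ℂ) • s) := rfl

lemma rTensor_gradCliff (ψ : Y → ℝ) (p : Cover Φ) (t : S p ⊗[ℂ] E p.base) :
    (gradCliff CS ψ p).rTensor (E p.base) t = contractionAt p.base (g.form p.base)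
      (fun w => (CS.cHat p (dqInv p w)).rTensor (E p.base)) (fun w => ((dAt ψ p.base w : ℝ) : ℂ) • t) := by
  induction t with
  | zero => simp only [map_zero, smul_zero]; exact (contractionAt_zero _ _ _).symm
  | add t t' h h' =>
    rw [map_add, h, h']
    simp only [smul_add]
    exact (contractionAt_add _ _ _ _ _).symm
  | tmul s e =>
    rw [LinearMap.rTensor_tmul, gradCliff_apply]
    refine contractionAt_map p.base (g.form p.base) ((TensorProduct.mk ℂ (S p) (E p.base)).flip e)
      (cl' := fun w => (CS.cHat p (dqInv p w)).rTensor (E p.base))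
      (α' := fun w => ((dAt ψ p.base w : ℝ) : ℂ) • (s ⊗ₜ[ℂ] e)) (fun w s => ?_) fun w => ?_
    · rw [LinearMap.flip_apply, LinearMap.flip_apply, TensorProduct.mk_apply, TensorProduct.mk_apply,
        LinearMap.rTensor_tmul]
    · rw [LinearMap.flip_apply, TensorProduct.mk_apply]
      exact TensorProduct.smul_tmul' _ _ _

lemma gradCliff_eq_zero {ψ : Y → ℝ} {p : Cover Φ} (h : ψ =ᶠ[𝓝 p.base] fun _ => 0) : gradCliff CS ψ p = 0 :=
  LinearMap.ext fun s => by
    rw [gradCliff_apply]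
    simp only [dAt_congr h, dAt_const, Complex.ofReal_zero, zero_smul]
    exact contractionAt_zero _ _ _

/-- Clifford multiplication by a gradient is additive in the differential, and the differentials add
up to that of a locally constant function. -/
lemma sum_gradCliff_eq_zero {m : ℕ} {ψ : Fin m → Y → ℝ} (hψ : ∀ i, ContMDiff (𝓡 n) 𝓘(ℝ, ℝ) ∞ (ψ i)) {p : Cover Φ}
    (h : ∀ᶠ z in 𝓝 p.base, ∑ i, ψ i z = 1) : ∑ i, gradCliff CS (ψ i) p = 0 := LinearMap.ext fun s => by
  rw [LinearMap.sum_apply]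
  simp only [gradCliff_apply]
  refine (contractionAt_sum _ _ _ Finset.univ fun i w => ((dAt (ψ i) p.base w : ℝ) : ℂ) • s).symm.trans ?_
  have h1 : ∀ w : TangentSpace (𝓡 n) p.base, ∑ i, ((dAt (ψ i) p.base w : ℝ) : ℂ) • s = 0 := fun w => by
    rw [← Finset.sum_smul, ← Complex.ofReal_sum,
      ← dAt_sum (fun i _ => (hψ i).mdifferentiableAt (by simp)), dAt_congr (f' := fun _ => (1 : ℝ)) h, dAt_const,
      Complex.ofReal_zero, zero_smul]
  rw [funext h1]
  exact contractionAt_zero _ _ _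

-- As ψ lives on Y, its gradient is invariant under deck transformations, so this operator also acts
-- on the quotient bundle.
variable {CS} in
lemma map_gradCliff (hCA : CS.IsEquivariant AS) (ψ : Y → ℝ) (x : P) (p : Cover Φ) (s : S p) :
    AS.map x p (gradCliff CS ψ p s) = gradCliff CS ψ (p.deck (τ.proj x)) (AS.map x p s) :=
  contractionAt_map p.base (g.form p.base) (AS.map x p).toLinearMap
    (cl' := fun w => CS.cHat (p.deck (τ.proj x)) (dqInv (p.deck (τ.proj x)) w))
    (α' := fun w => ((dAt ψ p.base w : ℝ) : ℂ) • AS.map x p s) (fun w t => map_cHat hCA x p w t)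
    fun w => (AS.map x p).map_smul ((dAt ψ p.base w : ℝ) : ℂ) s

/-- The Leibniz rule for the Dirac operator. -/
lemma diracAt_mul {ψ : Y → ℝ} (hψ : ContMDiff (𝓡 n) 𝓘(ℝ, ℝ) ∞ ψ) {σ : ∀ p : Cover Φ, S p ⊗[ℂ] E p.base}
    (hσ : (bundleSE HS HE).SmoothOn σ Set.univ) (p : Cover Φ) :
    diracAt CS DS DE (fun p => (ψ p.base : ℂ) • σ p) p =
      (ψ p.base : ℂ) • diracAt CS DS DE σ p + (gradCliff CS ψ p).rTensor (E p.base) (σ p) := by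
  have hf : ContMDiff (𝓡 n) 𝓘(ℝ, ℂ) ∞ fun p : Cover Φ => (ψ p.base : ℂ) :=
    contMDiff_ofReal.comp (hψ.comp (contMDiff_base n Φ))
  have hd : ∀ w : TangentSpace (𝓡 n) p.base,
      dAt (fun p : Cover Φ => (ψ p.base : ℂ)) p (dqInv p w) = ((dAt ψ p.base w : ℝ) : ℂ) := fun w => by
    refine (dAt_clm Complex.ofRealCLM (f := fun p : Cover Φ => ψ p.base)
      ((hψ.comp (contMDiff_base n Φ)).mdifferentiableAt (by simp)) _).trans ?_
    rw [dAt_comp (f := ψ) (q := Cover.base) (hψ.mdifferentiableAt (by simp)) ((contMDiff_base n Φ).mdifferentiableAt (by simp))]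
    have := dq_dqInv p w
    rw [dq] at this
    rw [this]
    rfl
  rw [rTensor_gradCliff, diracAt, diracAt, ← contractionAt_smul, ← contractionAt_add]
  congr 1
  funext w
  rw [tensorNabla_smul (contMDiff_base n Φ) DS DE isOpen_univ hf.contMDiffOn hσ trivial, hd, add_comm]

end Dirac

end PiCover

end

noncomputable section

namespace PiCover

/-! ### Smoothness of the gradient -/

section Gradient

open MeasureTheory Filter Topology

/-! ### Smooth dependence of determinants and inverse matrices -/

section Matrices

variable {n m : ℕ} {B : Type*} [TopologicalSpace B] [ChartedSpace (Eu n) B]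

lemma contMDiffOn_det {M : B → Matrix (Fin m) (Fin m) ℝ} {u : Set B}
    (hM : ∀ i j, ContMDiffOn (𝓡 n) 𝓘(ℝ, ℝ) ∞ (fun x => M x i j) u) :
    ContMDiffOn (𝓡 n) 𝓘(ℝ, ℝ) ∞ (fun x => (M x).det) u := by
  simp only [Matrix.det_apply']
  refine contMDiffOn_finsetSum fun σ _ => contMDiffOn_const.mul ?_
  exact contMDiffOn_finsetProd fun i _ => hM _ _

/-- Cramer's rule: an entry of the inverse is a quotient of determinants, which are polynomials in
the entries. -/
lemma contMDiffOn_matrix_inv {M : B → Matrix (Fin m) (Fin m) ℝ} {u : Set B}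
    (hM : ∀ i j, ContMDiffOn (𝓡 n) 𝓘(ℝ, ℝ) ∞ (fun x => M x i j) u) (h0 : ∀ x ∈ u, (M x).det ≠ 0) (i j : Fin m) :
    ContMDiffOn (𝓡 n) 𝓘(ℝ, ℝ) ∞ (fun x => (M x)⁻¹ i j) u := by
  have h : ∀ x, (M x)⁻¹ i j = (M x).det⁻¹ * ((M x).updateRow j (Pi.single i 1)).det := fun x => by
    rw [Matrix.inv_def, Matrix.smul_apply, Matrix.adjugate_apply, Ring.inverse_eq_inv', smul_eq_mul]
  simp only [h]
  refine ((contMDiffOn_det hM).inv₀ h0).mul (contMDiffOn_det fun k l => ?_)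
  by_cases hk : k = j
  · subst hk
    simp only [Matrix.updateRow_self]
    exact contMDiffOn_const
  · simp only [Matrix.updateRow_ne hk]
    exact hM k l

/-- The Gram matrix of a positive definite form is invertible. -/
lemma det_gram_ne_zero (β : Eu n →ₗ[ℝ] Eu n →ₗ[ℝ] ℝ) (hβ : ∀ v, v ≠ 0 → β v v ≠ 0) :
    (gram fun v w => β v w).det ≠ 0 := by
  intro h
  -- A vector v in the kernel of the Gram matrix satisfies β(v, v) = 0.
  obtain ⟨v, hv, h0⟩ := Matrix.exists_mulVec_eq_zero_iff.2 h
  have hw : ∑ j, v j • stdVec j = (WithLp.toLp 2 v : Eu n) := sum_smul_stdVec (WithLp.toLp 2 v)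
  refine hβ (WithLp.toLp 2 v) (fun h => hv ?_) ?_
  · simpa using h
  · have h1 : ∀ i, ∑ j, v j * β (stdVec i) (stdVec j) = 0 := fun i => by
      refine Eq.trans (Finset.sum_congr rfl fun _ _ => mul_comm _ _) (congrFun h0 i)
    rw [← hw]
    simp only [map_sum, LinearMap.sum_apply, map_smul, LinearMap.smul_apply, smul_eq_mul, Finset.mul_sum]
    rw [Finset.sum_comm]
    refine Finset.sum_eq_zero fun i _ => ?_
    have h2 : ∀ j, v j * (v i * β (stdVec i) (stdVec j)) = v i * (v j * β (stdVec i) (stdVec j)) := fun j => by ring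
    simp only [h2, ← Finset.mul_sum, h1, mul_zero]

end Matrices

lemma contMDiffOn_dAt {n : ℕ} {B : Type*} [TopologicalSpace B] [ChartedSpace (Eu n) B] [IsManifold (𝓡 n) ∞ B]
    {f : B → ℝ} (hf : ContMDiff (𝓡 n) 𝓘(ℝ, ℝ) ∞ f) {X : ∀ b : B, TangentSpace (𝓡 n) b} {u : Set B}
    (hX : SmoothFieldOn X u) : ContMDiffOn (𝓡 n) 𝓘(ℝ, ℝ) ∞ (fun b => dAt f b (X b)) u := by
  have h1 : ContMDiff (𝓡 n).tangent 𝓘(ℝ, ℝ).tangent ∞ (tangentMap (𝓡 n) 𝓘(ℝ, ℝ) f) :=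
    hf.contMDiff_tangentMap (by simp)
  exact ((contMDiff_snd_tangentBundle_modelSpace ℝ 𝓘(ℝ, ℝ)).comp h1).comp_contMDiffOn hX

/-- Smoothness of sections can be checked locally. -/
lemma HermitianBundle.smoothOn_of_locally {n : ℕ} {B : Type*} [TopologicalSpace B] [ChartedSpace (Eu n) B]
    {W : B → Type*} [∀ b, NormedAddCommGroup (W b)] [∀ b, InnerProductSpace ℂ (W b)] {H : HermitianBundle n W}
    {σ : ∀ b, W b} {u : Set B} (h : ∀ x ∈ u, ∃ w, IsOpen w ∧ x ∈ w ∧ H.SmoothOn σ (u ∩ w)) : H.SmoothOn σ u := by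
  intro b i
  refine contMDiffOn_of_locally_contMDiffOn fun x hx => ?_
  obtain ⟨w, hw, hxw, hs⟩ := h x hx.2
  exact ⟨w, hw, hxw, by simpa only [Set.inter_assoc] using hs b i⟩

variable {G : Type*} [Group G] [TopologicalSpace G] [IsTopologicalGroup G] {T : Subgroup G} [IsTorus T]
  {P : Type*} [Group P] {τ : CentralExtension T P}
  {n : ℕ} {Y : Type*} [TopologicalSpace Y] [ChartedSpace (Eu n) Y] [IsManifold (𝓡 n) ∞ Y] {Φ : Y → T}
  [ChartedSpace (Eu n) (Cover Φ)] [IsManifold (𝓡 n) ∞ (Cover Φ)] [IsSmoothCover n Φ]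
  {S : Cover Φ → Type*} [∀ p, NormedAddCommGroup (S p)] [∀ p, InnerProductSpace ℂ (S p)]
  {E : Y → Type*} [∀ y, NormedAddCommGroup (E y)] [∀ y, InnerProductSpace ℂ (E y)]
  {HS : HermitianBundle n S} {HE : HermitianBundle n E}
  {AS : BundleAction HS fun (x : P) (p : Cover Φ) => p.deck (τ.proj x)}

lemma contMDiffOn_lift (g : Metric n Y) {X X' : ∀ p : Cover Φ, TangentSpace (𝓡 n) p} {u : Set (Cover Φ)}
    (hX : SmoothFieldOn X u) (hX' : SmoothFieldOn X' u) :
    ContMDiffOn (𝓡 n) 𝓘(ℝ, ℝ) ∞ (fun p => g.lift Φ p (X p) (X' p)) u := by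
  have h1 := (contMDiff_base n Φ).contMDiff_tangentMap (m := ∞) (by simp)
  have h : ContMDiffOn (𝓡 n) ((𝓡 n).prod 𝓘(ℝ, ℝ)) ∞ (fun p : Cover Φ =>
      Bundle.TotalSpace.mk' ℝ (E := Bundle.Trivial Y ℝ) p.base (g.inner p.base (dq p (X p)) (dq p (X' p)))) u := by
    apply ContMDiffOn.clm_bundle_apply₂ (F₁ := Eu n) (F₂ := Eu n)
    · exact (g.contMDiff.comp (contMDiff_base n Φ)).contMDiffOn
    · exact h1.comp_contMDiffOn hX
    · exact h1.comp_contMDiffOn hX'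
  intro p hp
  have := h p hp
  simp only [Bundle.contMDiffWithinAt_totalSpace] at this
  exact this.2

lemma lift_self_ne_zero (g : Metric n Y) (p : Cover Φ) {v : TangentSpace (𝓡 n) p} (hv : v ≠ 0) :
    g.lift Φ p v v ≠ 0 := by
  have h : dq p v ≠ 0 := fun h => hv (by rw [← dqInv_dq p v, h, map_zero])
  exact (g.pos p.base _ h).ne'

variable {g : Metric n Y} (CS : CliffordModule HS (g.lift Φ))

/-- Clifford multiplication with a gradient, in a frame of the tangent space. -/
lemma gradCliff_eq_sum {ψ : Y → ℝ} (hψ : ContMDiff (𝓡 n) 𝓘(ℝ, ℝ) ∞ ψ) (p : Cover Φ)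
    (A : Eu n ≃ₗ[ℝ] TangentSpace (𝓡 n) p) (s : S p) :
    gradCliff CS ψ p s = ∑ j, ∑ k,
      (((gram fun v w => g.lift Φ p (A v) (A w))⁻¹ j k * dAt (fun p : Cover Φ => ψ p.base) p (A (stdVec k)) : ℝ) : ℂ) •
        CS.cHat p (A (stdVec j)) s := by
  have hd : ∀ v : TangentSpace (𝓡 n) p, dAt (fun p : Cover Φ => ψ p.base) p v = dAt ψ p.base (dq p v) := fun v =>
    dAt_comp (f := ψ) (q := Cover.base) (hψ.mdifferentiableAt (by simp)) ((contMDiff_base n Φ).mdifferentiableAt (by simp)) v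
  have h1 := contraction_lift Φ g p (cl := fun v => CS.cHat p v)
    (α := fun v => ((dAt (fun p : Cover Φ => ψ p.base) p v : ℝ) : ℂ) • s)
    (fun v w x => by rw [CS.cHat_add, LinearMap.add_apply])
    (fun r v x => by rw [CS.cHat_smul, LinearMap.smul_apply])
    (fun v w => by rw [dAt_map_add, Complex.ofReal_add, add_smul])
    (fun r v => by rw [dAt_map_smul, smul_eq_mul, Complex.ofReal_mul, mul_smul])
  have h2 := contraction_lift_comp Φ g p A (cl := fun v => CS.cHat p v)
    (α := fun v => ((dAt (fun p : Cover Φ => ψ p.base) p v : ℝ) : ℂ) • s)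
    (fun v w x => by rw [CS.cHat_add, LinearMap.add_apply])
    (fun r v x => by rw [CS.cHat_smul, LinearMap.smul_apply])
    (fun v w => by rw [dAt_map_add, Complex.ofReal_add, add_smul])
    (fun r v => by rw [dAt_map_smul, smul_eq_mul, Complex.ofReal_mul, mul_smul])
  have h3 : gradCliff CS ψ p s = contractionAt p (g.lift Φ p) (fun v => CS.cHat p v)
      (fun v => ((dAt (fun p : Cover Φ => ψ p.base) p v : ℝ) : ℂ) • s) := by
    rw [h1, gradCliff_apply]
    simp only [hd, dq_dqInv]
  rw [h3, ← h2, contraction]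
  refine Finset.sum_congr rfl fun j _ => Finset.sum_congr rfl fun k _ => ?_
  rw [map_smul, Complex.ofReal_mul, mul_smul]

lemma smoothOn_cHat {X : ∀ p : Cover Φ, TangentSpace (𝓡 n) p} {u : Set (Cover Φ)} (hu : IsOpen u)
    (hX : SmoothFieldOn X u) {σ : ∀ p, S p} (hσ : HS.SmoothOn σ u) : HS.SmoothOn (fun p => CS.cHat p (X p) (σ p)) u :=
  CS.smooth u hu X _ hX (CS.grading_smooth u hu σ hσ)

/-- The definition contracts in the standard basis of each tangent space, which depends on the chart
preferred at that point and is no smooth frame. In a local smooth frame the inverse Gram matrix, the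
derivatives of ψ and the Clifford products all depend smoothly on the point. -/
lemma smoothOn_gradCliff {ψ : Y → ℝ} (hψ : ContMDiff (𝓡 n) 𝓘(ℝ, ℝ) ∞ ψ) (u : Set (Cover Φ)) (hu : IsOpen u)
    (σ : ∀ p, S p) (hσ : HS.SmoothOn σ u) : HS.SmoothOn (fun p => gradCliff CS ψ p (σ p)) u := by
  refine HermitianBundle.smoothOn_of_locally fun x hx => ?_
  let e := trivializationAt (Eu n) (TangentSpace (𝓡 n)) x
  have hb : ∀ j, (EuclideanSpace.basisFun (Fin n) ℝ).toBasis j = stdVec j := fun j => by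
    rw [OrthonormalBasis.coe_toBasis, EuclideanSpace.basisFun_apply]; rfl
  let X : Fin n → ∀ p : Cover Φ, TangentSpace (𝓡 n) p := fun j =>
    e.localFrame (EuclideanSpace.basisFun (Fin n) ℝ).toBasis j
  have hX : ∀ j, SmoothFieldOn (X j) e.baseSet := fun j =>
    e.contMDiffOn_localFrame_baseSet ∞ (EuclideanSpace.basisFun (Fin n) ℝ).toBasis j
  have hXA : ∀ j p (hp : p ∈ e.baseSet), X j p = (e.linearEquivAt ℝ p hp).symm (stdVec j) := fun j p hp => by
    rw [← hb j]
    refine (e.localFrame_apply_of_mem_baseSet _ hp).trans ?_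
    simp [Bundle.Trivialization.basisAt]
  have hue : IsOpen (u ∩ e.baseSet) := hu.inter e.open_baseSet
  have hX' : ∀ j, SmoothFieldOn (X j) (u ∩ e.baseSet) := fun j => (hX j).mono Set.inter_subset_right
  refine ⟨e.baseSet, e.open_baseSet, FiberBundle.mem_baseSet_trivializationAt' x, ?_⟩
  refine HermitianBundle.SmoothOn.congr (σ := fun p => ∑ j, ∑ k,
    (((Matrix.of fun j k => g.lift Φ p (X j p) (X k p))⁻¹ j k * dAt (fun p : Cover Φ => ψ p.base) p (X k p) : ℝ) : ℂ) •
      CS.cHat p (X j p) (σ p)) ?_ fun p hp => ?_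
  · refine HermitianBundle.SmoothOn.sum fun j _ => HermitianBundle.SmoothOn.sum fun k _ =>
      HermitianBundle.SmoothOn.smul ?_ (smoothOn_cHat CS hue (hX' j) (hσ.mono Set.inter_subset_left))
    refine contMDiff_ofReal.comp_contMDiffOn (ContMDiffOn.mul ?_
      (contMDiffOn_dAt (hψ.comp (contMDiff_base n Φ)) (hX' k)))
    refine contMDiffOn_matrix_inv (M := fun p => Matrix.of fun j k => g.lift Φ p (X j p) (X k p))
      (fun i j => contMDiffOn_lift g (hX' i) (hX' j)) (fun p hp => ?_) j k
    let A := (e.linearEquivAt ℝ p hp.2).symm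
    have := det_gram_ne_zero (LinearMap.mk₂ ℝ (fun v w => g.lift Φ p (A v) (A w))
      (fun v v' w => by rw [map_add, g.lift_add_left]) (fun r v w => by rw [map_smul, g.lift_smul_left])
      (fun v w w' => by rw [map_add, g.lift_add_right]) (fun r v w => by rw [map_smul, g.lift_smul_right]))
      fun v hv => lift_self_ne_zero g p fun h => hv (A.map_eq_zero_iff.1 h)
    simp only [hXA _ p hp.2]
    exact this
  · rw [gradCliff_eq_sum CS hψ p (e.linearEquivAt ℝ p hp.2).symm]
    simp only [hXA _ p hp.2]
    rfl

end Gradient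

end PiCover

end

noncomputable section

namespace PiCover

/-! ### The Dirac operators correspond -/

section DiracClosure

open MeasureTheory Filter Topology

/-- Expresses an endomorphism of the second factor by its matrix in a frame; with smooth entries it
preserves `QSmooth`. -/
lemma coeff_lTensor {L V V' ι : Type*} [NormedAddCommGroup L] [InnerProductSpace ℂ L] [NormedAddCommGroup V]
    [InnerProductSpace ℂ V] [NormedAddCommGroup V'] [InnerProductSpace ℂ V'] [Fintype ι] (b : OrthonormalBasis ι ℂ V)
    (A : V →ₗ[ℂ] V') (e : V') (t : L ⊗[ℂ] V) :
    coeff e (A.lTensor L t) = ∑ l, ⟪e, A (b l)⟫_ℂ • coeff (b l) t := by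
  conv_lhs => rw [← sum_coeff_tmul b t]
  simp only [map_sum, LinearMap.lTensor_tmul, coeff_tmul]

variable {G : Type*} [Group G] [TopologicalSpace G] [IsTopologicalGroup G] {T : Subgroup G} [IsTorus T]
  {P : Type*} [Group P] {τ : CentralExtension T P}
  {n : ℕ} {Y : Type*} [TopologicalSpace Y] [ChartedSpace (Eu n) Y] [IsManifold (𝓡 n) ∞ Y] {Φ : Y → T}
  [ChartedSpace (Eu n) (Cover Φ)] [IsManifold (𝓡 n) ∞ (Cover Φ)] [IsSmoothCover n Φ]
  {S : Cover Φ → Type*} [∀ p, NormedAddCommGroup (S p)] [∀ p, InnerProductSpace ℂ (S p)]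
  {E : Y → Type*} [∀ y, NormedAddCommGroup (E y)] [∀ y, InnerProductSpace ℂ (E y)]
  {HS : HermitianBundle n S} {HE : HermitianBundle n E}
  {AS : BundleAction HS fun (x : P) (p : Cover Φ) => p.deck (τ.proj x)}

lemma lTensor_mapIsometry_rho {A : ∀ p, S p →ₗ[ℂ] S p} (hA : ∀ x p s, AS.map x p (A p s) = A _ (AS.map x p s))
    (x : P) (p : Cover Φ) (t : L2tau τ ⊗[ℂ] TensorFib S E p) :
    ((A (p.deck (τ.proj x))).rTensor (E (p.deck (τ.proj x)).base)).lTensor (L2tau τ)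
        (TensorProduct.mapIsometry (rho τ x) (actSE E AS x p) t) =
      TensorProduct.mapIsometry (rho τ x) (actSE E AS x p) (((A p).rTensor (E p.base)).lTensor (L2tau τ) t) :=
  ev_ext τ fun z => by
    rw [ev_lTensor]
    refine (congrArg _ (ev_mapIsometry_rho τ z x (actSE E AS x p) t)).trans ?_
    rw [ev_mapIsometry_rho, ev_lTensor, actSE_rTensor hA]
    rfl

/-- The action of an equivariant bundle endomorphism on the fibres of the quotient bundle. -/
def endoFib {A : ∀ p, S p →ₗ[ℂ] S p} (hA : ∀ x p s, AS.map x p (A p s) = A _ (AS.map x p s))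
    (v : ∀ y, QFib (W := TensorFib S E) τ (actSE E AS) y) (y : Y) : QFib (W := TensorFib S E) τ (actSE E AS) y :=
  ⟨fun p => ((A p.1).rTensor (E p.1.base)).lTensor (L2tau τ) ((v y).1 p), fun x p =>
    (congrArg _ ((v y).2 x p)).trans (lTensor_mapIsometry_rho hA x p.1 _)⟩

lemma upstairs_endoFib {A : ∀ p, S p →ₗ[ℂ] S p} (hA : ∀ x p s, AS.map x p (A p s) = A _ (AS.map x p s))
    (v : ∀ y, QFib (W := TensorFib S E) τ (actSE E AS) y) (p : Cover Φ) :
    upstairs (W := TensorFib S E) (endoFib hA v) p =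
      ((A p).rTensor (E p.base)).lTensor (L2tau τ) (upstairs (W := TensorFib S E) v p) := rfl

lemma sec_endoFib {A : ∀ p, S p →ₗ[ℂ] S p} (hA : ∀ x p s, AS.map x p (A p s) = A _ (AS.map x p s))
    (v : ∀ y, QFib (W := TensorFib S E) τ (actSE E AS) y) (p : Cover Φ) :
    sec (W := TensorFib S E) (endoFib hA v) p = (A p).rTensor (E p.base) (sec (W := TensorFib S E) v p) := by
  rw [sec, upstairs_endoFib, ev_lTensor]
  rfl

lemma smoothOn_rTensor_frame {A : ∀ p, S p →ₗ[ℂ] S p}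
    (hAs : ∀ u, IsOpen u → ∀ σ, HS.SmoothOn σ u → HS.SmoothOn (fun p => A p (σ p)) u) (p : Cover Φ)
    (l : (bundleSE HS HE).idx p) : (bundleSE HS HE).SmoothOn
      (fun x => (A x).rTensor (E x.base) ((bundleSE HS HE).frame p l x)) ((bundleSE HS HE).baseSet p) :=
  smoothOn_tmul (contMDiff_base n Φ) (u' := HE.baseSet p.base)
    ((hAs _ (HS.isOpen_baseSet p) _ (HS.smoothOn_frame p l.1)).mono Set.inter_subset_left)
    (HE.smoothOn_frame p.base l.2) Set.inter_subset_right

lemma qSmooth_endoFib {A : ∀ p, S p →ₗ[ℂ] S p} (hA : ∀ x p s, AS.map x p (A p s) = A _ (AS.map x p s))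
    (hAs : ∀ u, IsOpen u → ∀ σ, HS.SmoothOn σ u → HS.SmoothOn (fun p => A p (σ p)) u)
    {v : ∀ y, QFib (W := TensorFib S E) τ (actSE E AS) y} (hv : QSmooth (bundleSE HS HE) v) :
    QSmooth (bundleSE HS HE) (endoFib hA v) := fun p i => by
  have h : ContMDiffOn (𝓡 n) 𝓘(ℝ, L2tau τ) ∞ (fun x => ∑ l : (bundleSE HS HE).idx p,
      ⟪(bundleSE HS HE).frame p i x, (A x).rTensor (E x.base) ((bundleSE HS HE).frame p l x)⟫_ℂ •
        coeff ((bundleSE HS HE).frame p l x) (upstairs (W := TensorFib S E) v x)) ((bundleSE HS HE).baseSet p) := by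
    refine contMDiffOn_finsetSum fun l _ => ?_
    have h1 := smoothOn_rTensor_frame (HE := HE) hAs p l p i
    rw [Set.inter_self] at h1
    have h2 : ContMDiff 𝓘(ℝ, ℂ × L2tau τ) 𝓘(ℝ, L2tau τ) ∞ fun w : ℂ × L2tau τ => w.1 • w.2 :=
      (contDiff_fst.smul contDiff_snd).contMDiff
    exact h2.comp_contMDiffOn (h1.prodMk_space (hv p l))
  refine h.congr fun x hx => ?_
  rw [upstairs_endoFib]
  refine (coeff_lTensor ((bundleSE HS HE).onb p x hx) _ _ _).trans ?_
  simp only [HermitianBundle.onb_apply]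

variable [T2Space Y] [SecondCountableTopology Y]
  [MeasurableSpace Y] [BorelSpace Y] [MeasurableSpace (Cover Φ)] [BorelSpace (Cover Φ)]
  {μY : Measure Y} [IsFiniteMeasureOnCompacts μY] {μ : Measure (Cover Φ)} [IsFiniteMeasureOnCompacts μ]

/-- The action of an equivariant smooth bundle endomorphism on sections over `Y`. -/
def QCc.endo {A : ∀ p, S p →ₗ[ℂ] S p} (hA : ∀ x p s, AS.map x p (A p s) = A _ (AS.map x p s))
    (hAs : ∀ u, IsOpen u → ∀ σ, HS.SmoothOn σ u → HS.SmoothOn (fun p => A p (σ p)) u)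
    (v : QCc (bundleSE HS HE) τ (actSE E AS) μY) : QCc (bundleSE HS HE) τ (actSE E AS) μY :=
  ⟨endoFib hA v.1, qSmooth_endoFib hA hAs v.2.1, by
    obtain ⟨K, hK, h⟩ := v.2.2
    refine ⟨K, hK, fun y hy => Subtype.ext (funext fun p => ?_)⟩
    change ((A p.1).rTensor (E p.1.base)).lTensor (L2tau τ) ((v.1 y).1 p) = 0
    rw [h y hy]
    exact map_zero _⟩

lemma QCc.sec_endo {A : ∀ p, S p →ₗ[ℂ] S p} (hA : ∀ x p s, AS.map x p (A p s) = A _ (AS.map x p s))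
    (hAs : ∀ u, IsOpen u → ∀ σ, HS.SmoothOn σ u → HS.SmoothOn (fun p => A p (σ p)) u)
    (v : QCc (bundleSE HS HE) τ (actSE E AS) μY) (p : Cover Φ) :
    sec (W := TensorFib S E) (QCc.endo hA hAs v).1 p = (A p).rTensor (E p.base) (sec (W := TensorFib S E) v.1 p) :=
  sec_endoFib hA v.1 p

variable {g : Metric n Y} {CS : CliffordModule HS (g.lift Φ)} {DS : HermitianConnection HS} {DE : HermitianConnection HE}

/-- The operator is local and the truncation is locally the identity or zero, with the same
alternative for σ and σ'. -/
lemma IsDiracUp.trunc {σ σ' : ∀ p : Cover Φ, S p ⊗[ℂ] E p.base} (h : IsDiracUp CS DS DE σ σ') {V : Set (Cover Φ)}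
    {K : Set Y} (hV : IsSheetOver V K) (hσ : ∀ p : Cover Φ, p.base ∉ K → σ p = 0)
    (hσ' : ∀ p : Cover Φ, p.base ∉ K → σ' p = 0) (F : Finset (Lattice T)) :
    IsDiracUp CS DS DE (trunc (W := TensorFib S E) V F σ) (trunc (W := TensorFib S E) V F σ') := by
  rw [isDiracUp_iff] at h ⊢
  intro p
  rcases trunc_eventually (W := TensorFib S E) hV F p with h1 | h1
  · rw [h1.self_of_nhds σ' hσ', h p]
    exact (diracAt_congr CS DS DE (h1.mono fun q hq => hq σ hσ)).symm
  · rw [h1.self_of_nhds σ' hσ', diracAt_congr CS DS DE (h1.mono fun q hq => hq σ hσ)]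
    exact (diracAt_zero CS DS DE p).symm

/-- By the Leibniz rule the partner of ψv is ψv' plus the Clifford product of grad ψ with v. The
extra terms are smooth and compactly supported over Y, vanish off the support of ψ, and cancel over
a partition of unity. -/
lemma mem_graphClosure_dirac (hw : IsTwistedAction (W := S) AS.map)
    (hact : IsTwistedAction (W := TensorFib S E) (actSE E AS))
    (hsm : ∀ g σ, (bundleSE HS HE).SmoothOn σ Set.univ →
      (bundleSE HS HE).SmoothOn (pull (W := TensorFib S E) (actSE E AS) g σ) Set.univ)
    (hCA : CS.IsEquivariant AS) (hDA : DS.IsInvariant AS)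
    {v v' : QCc (bundleSE HS HE) τ (actSE E AS) μY} (h : IsDiracDown CS DS DE v.1 v'.1) :
    (v, v') ∈ graphClosure μY μ hact hsm (IsDiracUp CS DS DE) := by
  obtain ⟨K₁, hK₁, hv₁⟩ := v.2.2
  obtain ⟨K₂, hK₂, hv₂⟩ := v'.2.2
  have h' := (isDiracUp_iff CS DS DE).1 ((isDiracDown_iff DS DE hw hact hCA hDA v.2.1).1 h)
  have hv : ∀ y ∉ K₁ ∪ K₂, v.1 y = 0 := fun y hy => hv₁ y fun h => hy (Or.inl h)
  have hv' : ∀ y ∉ K₁ ∪ K₂, v'.1 y = 0 := fun y hy => hv₂ y fun h => hy (Or.inr h)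
  have hs : (bundleSE HS HE).SmoothOn (sec (W := TensorFib S E) v.1) Set.univ := smoothOn_sec v.2.1
  refine mem_graphClosure_of_partition (μ := μ) hact hsm ?_ ?_ (hK₁.union hK₂) hv
    (fun ψ hψ => QCc.mul hψ v' + QCc.endo (fun x p s => map_gradCliff hCA ψ x p s) (smoothOn_gradCliff CS hψ) v) ?_ ?_
  · exact (isDiracUp_iff CS DS DE).2 fun p => (diracAt_zero CS DS DE p).symm
  · intro σ₁ σ₁' σ₂ σ₂' h₁ h₂
    rw [isDiracUp_iff] at h₁ h₂ ⊢
    intro p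
    refine Eq.trans ?_ (diracAt_add CS DS DE σ₁.2.1 σ₂.2.1 p).symm
    rw [← h₁ p, ← h₂ p]
    rfl
  · intro m ψ hψ h1
    refine QCc.ext fun p => ?_
    rw [QCc.sec_sum]
    have h2 : ∀ i, sec (W := TensorFib S E) (QCc.mul (hψ i) v' + QCc.endo (fun x p s => map_gradCliff hCA (ψ i) x p s)
        (smoothOn_gradCliff CS (hψ i)) v : QCc (bundleSE HS HE) τ (actSE E AS) μY).1 p =
        (ψ i p.base : ℂ) • sec (W := TensorFib S E) v'.1 p +
          (gradCliff CS (ψ i) p).rTensor (E p.base) (sec (W := TensorFib S E) v.1 p) := fun i => by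
      rw [← QCc.sec_mul, ← QCc.sec_endo]
      exact sec_add (W := TensorFib S E) _ _ p
    refine (Finset.sum_congr rfl fun i _ => h2 i).trans ?_
    by_cases hp : p.base ∈ K₁ ∪ K₂
    · have h3 : ∑ i, (gradCliff CS (ψ i) p).rTensor (E p.base) = 0 := by
        refine (map_sum (LinearMap.rTensorHom (E p.base)) (fun i => gradCliff CS (ψ i) p) Finset.univ).symm.trans ?_
        rw [sum_gradCliff_eq_zero CS hψ (h1 _ hp), map_zero]
      rw [Finset.sum_add_distrib, ← Finset.sum_smul, ← Complex.ofReal_sum, (h1 _ hp).self_of_nhds, Complex.ofReal_one,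
        one_smul, ← LinearMap.sum_apply, h3, LinearMap.zero_apply, add_zero]
    · have h3 := sec_eq_zero (W := TensorFib S E) (hv _ hp)
      have h4 := sec_eq_zero (W := TensorFib S E) (hv' _ hp)
      simp only [h3, h4, smul_zero, map_zero, add_zero, Finset.sum_const_zero]
  · intro ψ hψ V hV hz
    have h2 : ∀ p, sec (W := TensorFib S E) (QCc.mul hψ v' + QCc.endo (fun x p s => map_gradCliff hCA ψ x p s)
        (smoothOn_gradCliff CS hψ) v : QCc (bundleSE HS HE) τ (actSE E AS) μY).1 p =
        (ψ p.base : ℂ) • sec (W := TensorFib S E) v'.1 p +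
          (gradCliff CS ψ p).rTensor (E p.base) (sec (W := TensorFib S E) v.1 p) := fun p => by
      rw [← QCc.sec_mul, ← QCc.sec_endo]
      exact sec_add (W := TensorFib S E) _ _ p
    have hup : IsDiracUp CS DS DE (sec (W := TensorFib S E) (QCc.mul hψ v).1) (sec (W := TensorFib S E)
        (QCc.mul hψ v' + QCc.endo (fun x p s => map_gradCliff hCA ψ x p s)
          (smoothOn_gradCliff CS hψ) v : QCc (bundleSE HS HE) τ (actSE E AS) μY).1) := by
      rw [isDiracUp_iff]
      intro p
      rw [h2, funext (QCc.sec_mul hψ v), h' p]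
      exact (diracAt_mul CS DS DE hψ hs p).symm
    have hz' : ∀ p : Cover Φ, p.base ∉ (K₁ ∪ K₂) ∩ tsupport ψ → sec (W := TensorFib S E)
        (QCc.mul hψ v' + QCc.endo (fun x p s => map_gradCliff hCA ψ x p s)
          (smoothOn_gradCliff CS hψ) v : QCc (bundleSE HS HE) τ (actSE E AS) μY).1 p = 0 := fun p hp => by
      rw [h2]
      by_cases hpK : p.base ∈ K₁ ∪ K₂
      -- Off the closed support ψ vanishes near the point, so the gradient term vanishes along with
      -- ψ.
      · have hpt : p.base ∉ tsupport ψ := fun h => hp ⟨hpK, h⟩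
        rw [image_eq_zero_of_notMem_tsupport hpt, Complex.ofReal_zero, zero_smul,
          gradCliff_eq_zero CS (notMem_tsupport_iff_eventuallyEq.1 hpt), LinearMap.rTensor_zero,
          LinearMap.zero_apply, add_zero]
      · have h3 := sec_eq_zero (W := TensorFib S E) (hv _ hpK)
        have h4 := sec_eq_zero (W := TensorFib S E) (hv' _ hpK)
        simp only [h3, h4, smul_zero, map_zero, add_zero]
    refine mem_closure_of_trunc (μ := μ) hact hsm hV hV hz hz' (Equiv.refl _) fun F => ?_
    have he : F.map (Equiv.refl (Lattice T)).toEmbedding = F := by simp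
    rw [he]
    exact hup.trunc hV hz hz' F

end DiracClosure

end PiCover

end

/-! ### The proposition -/

theorem mainTheorem12
    -- a torus `T` in a topological group `G`
    {G : Type*} [Group G] [TopologicalSpace G] [IsTopologicalGroup G] (T : Subgroup G)
    [PiCover.IsTorus T]
    -- a central extension of the integral lattice with an action of `N(T)`
    {P : Type*} [Group P] (τ : PiCover.CentralExtension T P)
    -- an `N(T)`-manifold `Y` with an equivariant map to `T`
    {n : ℕ} {Y : Type*} [TopologicalSpace Y] [T2Space Y] [SecondCountableTopology Y]
    [MeasurableSpace Y] [BorelSpace Y] [ChartedSpace (PiCover.Eu n) Y] [IsManifold (𝓡 n) ∞ Y]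
    [MulAction (PiCover.Nrm T) Y]
    (hsmul : ∀ m : PiCover.Nrm T, ContMDiff (𝓡 n) (𝓡 n) ∞ fun y : Y => m • y)
    (Φ : Y → T) (hΦc : Continuous Φ) (hΦ : ∀ (m : PiCover.Nrm T) y, Φ (m • y) = m • Φ y)
    -- an invariant Riemannian metric
    (g : PiCover.Metric n Y)
    (hg : ∀ (m : PiCover.Nrm T) (y : Y) (v w : TangentSpace (𝓡 n) y),
      g.form (m • y) (mfderiv (𝓡 n) (𝓡 n) (fun y : Y => m • y) y v)
        (mfderiv (𝓡 n) (𝓡 n) (fun y : Y => m • y) y w) = g.form y v w)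
    -- the covering space `𝒴` with the smooth structure lifted from `Y`
    [MeasurableSpace (PiCover.Cover Φ)] [BorelSpace (PiCover.Cover Φ)]
    [ChartedSpace (PiCover.Eu n) (PiCover.Cover Φ)] [IsManifold (𝓡 n) ∞ (PiCover.Cover Φ)]
    [PiCover.IsSmoothCover n Φ]
    -- the Riemannian measures
    (μY : MeasureTheory.Measure Y) [MeasureTheory.IsFiniteMeasureOnCompacts μY]
    (hμY : PiCover.IsRiemannianVolume g.form μY)
    (μ : MeasureTheory.Measure (PiCover.Cover Φ)) [MeasureTheory.IsFiniteMeasureOnCompacts μ]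
    (hμ : PiCover.IsRiemannianVolume (g.lift Φ) μ)
    -- an equivariant Hermitian bundle `E` over `Y` with a Hermitian connection
    {E : Y → Type*} [∀ y, NormedAddCommGroup (E y)] [∀ y, InnerProductSpace ℂ (E y)]
    (HE : PiCover.HermitianBundle n E)
    (NE : PiCover.BundleAction HE fun (m : PiCover.Nrm T) y => m • y)
    (DE : PiCover.HermitianConnection HE)
    -- an `N(T) ⋉ Π^τ`-equivariant Clifford module `S` over `𝒴`, on which `U(1)` acts with weight `1`
    {S : PiCover.Cover Φ → Type*} [∀ p, NormedAddCommGroup (S p)] [∀ p, InnerProductSpace ℂ (S p)]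
    (HS : PiCover.HermitianBundle n S) (CS : PiCover.CliffordModule HS (g.lift Φ))
    (AS : PiCover.BundleAction HS fun (x : P) (p : PiCover.Cover Φ) => p.deck (τ.proj x))
    (NS : PiCover.BundleAction HS (PiCover.Cover.conj hΦ))
    (hweight : ∀ (z : Circle) p (s : S p),
      (⟨_, AS.map (τ.incl z) p s⟩ : Σ p, S p) = ⟨p, (z : ℂ) • s⟩)
    (hNA : ∀ (m : PiCover.Nrm T) (x : P) p (s : S p),
      (⟨_, NS.map m _ (AS.map x p s)⟩ : Σ p, S p) =
        ⟨_, AS.map (τ.conj m x) _ (NS.map m p s)⟩)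
    (hCA : CS.IsEquivariant AS) (hCN : CS.IsEquivariant NS)
    -- an invariant Hermitian connection on `S`
    (DS : PiCover.HermitianConnection HS) (hDA : DS.IsInvariant AS) :
    ∃ U : PiCover.QL2 τ (PiCover.actSE E AS) (PiCover.bundleSE HS HE) μY ≃ₗᵢ[ℂ]
        (PiCover.bundleSE HS HE).L2 μ,
      -- smooth compactly supported sections are sent to such sections by the inverse of `U`
      (∀ s : (PiCover.bundleSE HS HE).Cc μ,
        ∃ v : PiCover.QCc (PiCover.bundleSE HS HE) τ (PiCover.actSE E AS) μY, U ↑v = ↑s) ∧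
      -- `U` is `N(T)`-equivariant
      (∀ m : PiCover.Nrm T, PiCover.Corresponds U (PiCover.IsTranslateDown NS NE m)
        (PiCover.IsTranslateUp NS NE m)) ∧
      -- `U` respects the gradings and intertwines the Clifford actions
      PiCover.Corresponds U (PiCover.IsEndoDown fun p => (CS.grading p).toLinearMap)
        (PiCover.IsEndoUp fun p => (CS.grading p).toLinearMap) ∧
      (∀ X : ∀ y : Y, TangentSpace (𝓡 n) y, PiCover.SmoothFieldOn X Set.univ →
        PiCover.Corresponds U (PiCover.IsEndoDown (PiCover.cliff CS X))
          (PiCover.IsEndoUp (PiCover.cliff CS X))) ∧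
      -- `U` identifies `D^E` with the Dirac operator on `𝒴`
      PiCover.Corresponds U (PiCover.IsDiracDown CS DS DE) (PiCover.IsDiracUp CS DS DE) := by
  have hw := PiCover.BundleAction.isTwistedAction (AS := AS) hweight
  have hact := PiCover.isTwistedAction_actSE (E := E) (AS := AS) hweight
  have hsm : ∀ x σ, (PiCover.bundleSE HS HE).SmoothOn σ Set.univ →
      (PiCover.bundleSE HS HE).SmoothOn
        (PiCover.pull (W := PiCover.TensorFib S E) (PiCover.actSE E AS) x σ) Set.univ :=
    fun x σ hσ => PiCover.smoothOn_pull_actSE hw x σ hσ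
  obtain ⟨U, hU, hR⟩ := PiCover.exists_unitary (H := PiCover.bundleSE HS HE) hμY hμ hact hsm
  have hgr : ∀ x p s, AS.map x p ((CS.grading p).toLinearMap s) =
      (CS.grading (p.deck (τ.proj x))).toLinearMap (AS.map x p s) := fun x p s => (hCA x p s).1.symm
  have hcl : ∀ (X : ∀ y : Y, TangentSpace (𝓡 n) y) x p s, AS.map x p (PiCover.cliff CS X p s) =
      PiCover.cliff CS X (p.deck (τ.proj x)) (AS.map x p s) := fun X x p s => by
    have h := (hCA x p s).2 (PiCover.dqInv p (X p.base))
    rw [← PiCover.dqInv_deck] at h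
    exact h.symm
  -- Each correspondence comes from the criterion in `exists_unitary`: a relation over 𝒴 implies the
  -- one over Y, and pairs related over Y lie in the graph closure.
  refine ⟨U, fun s => ⟨_, hU s⟩, fun m => hR _ _ (fun v v' h => ?_) fun v v' h => ?_,
    hR _ _ (fun v v' h => ?_) fun v v' h => ?_, fun X _ => hR _ _ (fun v v' h => ?_) fun v v' h => ?_,
    hR _ _ (fun v v' h => ?_) fun v v' h => ?_⟩
  · exact (PiCover.isTranslateDown_iff hact hNA m _ _).2 h
  · exact PiCover.mem_graphClosure_translate hact hsm hNA hsmul h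
  · exact (PiCover.isEndoDown_iff hact hgr _ _).2 h
  · exact PiCover.mem_graphClosure_endo hact hsm hgr h
  · exact (PiCover.isEndoDown_iff hact (hcl X) _ _).2 h
  · exact PiCover.mem_graphClosure_endo hact hsm (hcl X) h
  · exact (PiCover.isDiracDown_iff DS DE hw hact hCA hDA v.2.1).2 h
  · exact PiCover.mem_graphClosure_dirac hw hact hsm hCA hDA h
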